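/- Let $(P_\theta)_{\theta\in\Theta}$, $\Theta\subset\mathbb{R}^m$, be a statistical model with densities $p(z|\theta)$ with respect to a common measure $\mu$, and let $\theta_0\in\operatorname{int}(\Theta)$. Assume that the model is differentiable in quadratic mean at $\theta_0$, i.e. there is a score function $s:\mathcal Z\to\mathbb{R}^m$ with $$\int\Big[\sqrt{p(z|\theta_0+h)}-\sqrt{p(z|\theta_0)}-\tfrac12 h's(z)\sqrt{p(z|\theta_0)}\Big]^2\,d\mu(z)=o(\|h\|^2)\quad\text{as }h\to0,$$ and that the Fisher information matrix $J_0=E_{\theta_0}[ss']$ is nonsingular. Let $D\ge 1$, $0<t_1<t_2<\dots<t_D\le 1$ and $I_d=[0,t_d]$. For each $n$ let $z_1,\dots,z_n$ be i.i.d. observations, and let $S_n(t_1),\dots,S_n(t_D)$ be real-valued statistics adapted to the information sets, that is, $S_n(t_d)$ is a measurable function of the observations $z_i$ with $i/n\in I_d$. Suppose that for every $h\in\mathbb{R}^m$ the vector $(S_n(t_1),\dots,S_n(t_D))$ converges weakly, when the observations have distribution $P_{\theta_n(h)}$ with $\theta_n(h)=\theta_0+h/\sqrt n$ and $n\to\infty$,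 to a probability law $\mathcal L_h$ on $\mathbb{R}^D$. Let $B$ be an $m$-dimensional standard Brownian motion on $[0,1]$, let $U\sim\mathrm{Unif}[0,1]$ be independent of $B$, and for $h\in\mathbb{R}^m$ let $W(t)=th+J_0^{-1/2}B(t)$, $t\in[0,1]$. Then: (i) There are measurable functions $T_1,\dots,T_D$, not depending on $h$, such that for every $h\in\mathbb{R}^m$ $$\big(T_1(W(t_1),U),\;T_2(W(t_1),W(t_2),U),\;\dots,\;T_D(W(t_1),\dots,W(t_D),U)\big)\sim\mathcal L_h.$$ (ii) Let $V(t)=B(t)-\frac{t}{t_D}B(t_D)$, $0\le t\le t_D$, be the Brownian bridge built from $B$. There are measurable functions $\tilde T_1,\dots,\tilde T_D$, not depending on $h$, such that for every $h\in\mathbb{R}^m$ the random vector whose first component is $\tilde T_1(W(t_1),U)$, whose $d$-th component for $1<d<D$ is $\tilde T_d(W(t_d),V(t_1),\dots,V(t_d),U)$, and whose $D$-th component is $\tilde T_D(W(t_D),V(t_1),\dots,V(t_{D-1}),U)$ has law $\mathcal L_h$ (for $D=1$ there is the single component $\tilde T_1(W(t_1),U)$). -/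

import Mathlib

open MeasureTheory ProbabilityTheory Filter
open scoped Topology unitInterval

noncomputable section

namespace LimitExperiment

/-! ### The statistical model -/

/-- `p θ`, `θ ∈ Θ`, is a family of probability densities with respect to the measure `μ`. -/
structure IsDensityFamily {m : ℕ} {𝒵 : Type*} [MeasurableSpace 𝒵] (μ : Measure 𝒵)
    (Θ : Set (EuclideanSpace ℝ (Fin m))) (p : EuclideanSpace ℝ (Fin m) → 𝒵 → ℝ) : Prop where
  measurable : ∀ θ ∈ Θ, Measurable (p θ)
  nonneg : ∀ θ ∈ Θ, ∀ z, 0 ≤ p θ z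
  lintegral_eq_one : ∀ θ ∈ Θ, ∫⁻ z, ENNReal.ofReal (p θ z) ∂μ = 1

/-- The distribution `P_θ` of one observation: it has density `p θ` with respect to `μ`. -/
def obsLaw {m : ℕ} {𝒵 : Type*} [MeasurableSpace 𝒵] (μ : Measure 𝒵)
    (p : EuclideanSpace ℝ (Fin m) → 𝒵 → ℝ) (θ : EuclideanSpace ℝ (Fin m)) : Measure 𝒵 :=
  μ.withDensity fun z => ENNReal.ofReal (p θ z)

/-- The joint distribution of `n` i.i.d. observations from `P_θ`. -/
def sampleLaw {m : ℕ} {𝒵 : Type*} [MeasurableSpace 𝒵] (μ : Measure 𝒵)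
    (p : EuclideanSpace ℝ (Fin m) → 𝒵 → ℝ) (θ : EuclideanSpace ℝ (Fin m)) (n : ℕ) :
    Measure (Fin n → 𝒵) :=
  Measure.pi fun _ => obsLaw μ p θ

/-- The remainder in the expansion of the square root density at `θ₀` in the direction `h`,
`√p(θ₀ + h) - √p(θ₀) - (1/2) (h' s) √p(θ₀)`. -/
def dqmRemainder {m : ℕ} {𝒵 : Type*} (p : EuclideanSpace ℝ (Fin m) → 𝒵 → ℝ)
    (θ₀ : EuclideanSpace ℝ (Fin m)) (s : 𝒵 → EuclideanSpace ℝ (Fin m))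
    (h : EuclideanSpace ℝ (Fin m)) (z : 𝒵) : ℝ :=
  √(p (θ₀ + h) z) - √(p θ₀ z) - 1 / 2 * inner ℝ h (s z) * √(p θ₀ z)

/-- Differentiability in quadratic mean at `θ₀` with score function `s`. -/
structure IsDQM {m : ℕ} {𝒵 : Type*} [MeasurableSpace 𝒵] (μ : Measure 𝒵)
    (p : EuclideanSpace ℝ (Fin m) → 𝒵 → ℝ) (θ₀ : EuclideanSpace ℝ (Fin m))
    (s : 𝒵 → EuclideanSpace ℝ (Fin m)) : Prop where
  measurable_score : Measurable s
  integrable : ∀ᶠ h in 𝓝 0, Integrable (fun z => dqmRemainder p θ₀ s h z ^ 2) μ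
  isLittleO : (fun h => ∫ z, dqmRemainder p θ₀ s h z ^ 2 ∂μ) =o[𝓝 0] fun h => ‖h‖ ^ 2

/-- The Fisher information matrix `E_{θ₀}[s s']`. -/
def fisherInfo {m : ℕ} {𝒵 : Type*} [MeasurableSpace 𝒵] (μ : Measure 𝒵)
    (p : EuclideanSpace ℝ (Fin m) → 𝒵 → ℝ) (θ₀ : EuclideanSpace ℝ (Fin m))
    (s : 𝒵 → EuclideanSpace ℝ (Fin m)) : Matrix (Fin m) (Fin m) ℝ :=
  Matrix.of fun i j => ∫ z, s z i * s z j ∂(obsLaw μ p θ₀)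

/-- The local parameter `θ_n(h) = θ₀ + h / √n`. -/
def localParam {m : ℕ} (θ₀ h : EuclideanSpace ℝ (Fin m)) (n : ℕ) : EuclideanSpace ℝ (Fin m) :=
  θ₀ + (√(n : ℝ))⁻¹ • h

/-! ### Statistics and their limits -/

/-- `S n z d` is the value of the `d`-th statistic on the sample `z = (z_1, …, z_n)`.
The statistics are adapted to the information sets `[0, t d]`: they are measurable, and the `d`-th
statistic uses only those observations `z_i` with `i / n ∈ [0, t d]`.
(The index `i : Fin n` stands for the observation number `i + 1`.) -/
structure IsAdapted {D : ℕ} {𝒵 : Type*} [MeasurableSpace 𝒵] (t : Fin D → I)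
    (S : (n : ℕ) → (Fin n → 𝒵) → Fin D → ℝ) : Prop where
  measurable : ∀ n, Measurable (S n)
  dependsOn : ∀ n d, DependsOn (fun z => S n z d)
    {i : Fin n | ((i : ℕ) + 1 : ℝ) / n ∈ Set.Icc (0 : ℝ) (t d)}

/-- Weak convergence of the measures `ν n` to `ν'`: convergence of the integrals of all bounded
continuous functions. -/
def ConvergesWeakly {E : Type*} [TopologicalSpace E] [MeasurableSpace E]
    (ν : ℕ → Measure E) (ν' : Measure E) : Prop :=
  ∀ f : BoundedContinuousFunction E ℝ,
    Tendsto (fun n => ∫ x, f x ∂(ν n)) atTop (𝓝 (∫ x, f x ∂ν'))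

/-! ### The limit experiment -/

/-- `B` is an `m`-dimensional standard Brownian motion on the time interval `[0, 1]`. -/
structure IsStdBrownianMotion {m : ℕ} {Ω : Type*} [MeasurableSpace Ω]
    (B : I → Ω → EuclideanSpace ℝ (Fin m)) (P : Measure Ω) : Prop where
  start_zero : ∀ᵐ ω ∂P, B 0 ω = 0
  indep_increments : HasIndepIncrements B P
  law_increment : ∀ r t : I, r ≤ t →
    HasLaw (fun ω => B t ω - B r ω) (multivariateGaussian 0 (((t : ℝ) - (r : ℝ)) • 1)) P
  continuous_paths : ∀ᵐ ω ∂P, Continuous fun t => B t ω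

open scoped MatrixOrder in
/-- The inverse square root `J^{-1/2}` of a positive definite matrix. -/
def invSqrt {m : ℕ} (J : Matrix (Fin m) (Fin m) ℝ) : Matrix (Fin m) (Fin m) ℝ :=
  (CFC.sqrt J)⁻¹

/-- The drifted Brownian motion `W(t) = t h + J^{-1/2} B(t)`. -/
def driftedBM {m : ℕ} {Ω : Type*} (J : Matrix (Fin m) (Fin m) ℝ)
    (B : I → Ω → EuclideanSpace ℝ (Fin m)) (h : EuclideanSpace ℝ (Fin m)) (t : I) (ω : Ω) :
    EuclideanSpace ℝ (Fin m) :=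
  (t : ℝ) • h + Matrix.toEuclideanCLM (𝕜 := ℝ) (invSqrt J) (B t ω)

/-- The Brownian bridge `V(t) = B(t) - (t / τ) B(τ)` on `[0, τ]` built from `B`. -/
def bridge {m : ℕ} {Ω : Type*} (B : I → Ω → EuclideanSpace ℝ (Fin m)) (τ t : I) (ω : Ω) :
    EuclideanSpace ℝ (Fin m) :=
  B t ω - ((t : ℝ) / (τ : ℝ)) • B τ ω

/-- The indices `c` of the bridge values `V(t_c)` on which the `d`-th function in the bridge
representation may depend: none for the first function, `c ≤ d` for an intermediate function, and
`c < D` (one-based) for the last, `D`-th, function. -/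
def bridgeIndices {D : ℕ} (d : Fin D) : Set (Fin D) :=
  {c | 0 < (d : ℕ) ∧ c ≤ d ∧ (c : ℕ) + 1 < D}

end LimitExperiment

end

/-! ### Product measures with densities -/

/-! The experiments are compared through their likelihood ratios with respect to `θ₀`.
Differentiability in quadratic mean makes the law of the sample under `θ₀ + h / √n` close in total
variation to the measure with density `∏ (1 + X i)` under `θ₀`, where `X i` is the truncated and
centred score in the direction `h`, divided by `√n` (`IsRegularModel.tendsto_integral_sub`). The
statistics ignore the observations after the last time `t_D`, so those mean-one factors integrate
out. The remaining product is close in `L²` to `exp (h'Δ - t_D h'J₀h / 2)`, with `Δ` the sum of the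
normalized scores up to `t_D` (`IsSmallArray.tendsto_integral_sq`). Hence every `L h` is a limit of
exponentially tilted expectations under the single parameter `θ₀`.

Split `Δ` into block sums `ξ_d` over the intervals between successive times. Jointly with the
statistics they are tight under `θ₀`. In a limit law `Q`, `ξ_d` is Gaussian with covariance `(t_d -
t_{d-1}) J₀` and independent of the earlier statistics and blocks (`exists_adapted_limit`). Being a
function of the past does not survive weak limits, but independence of the next innovation does, and
it suffices. Drawing each statistic from its conditional law given the past and the current
innovation, by means of a fresh uniform variable, writes the vector as adapted functions of
innovations and independent uniforms (`exists_adapted_representation`).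

By the Cameron-Martin formula, tilting `Q` shifts `ξ_d` by `(t_d - t_{d-1}) J₀ h`. The shifted
innovations have the law of `J₀` times the increments of `W`, and one uniform variable generates all
the uniforms needed; this gives (i). For (ii), `W(t_c)` with `c ≤ d` is recovered from `W(t_d)` and
the bridge, because `W(t_c) - (t_c / t_d) W(t_d)` is free of `h` and equals `J₀^{-1/2} (V(t_c) -
(t_c / t_d) V(t_d))`. -/

theorem MeasureTheory.Measure.pi_withDensity {ι : Type*} [Fintype ι] {X : ι → Type*}
    [∀ i, MeasurableSpace (X i)] (μ : ∀ i, Measure (X i)) [∀ i, IsProbabilityMeasure (μ i)]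
    (f : ∀ i, X i → ENNReal) (hf : ∀ i, Measurable (f i))
    [∀ i, SigmaFinite ((μ i).withDensity (f i))] :
    Measure.pi (fun i => (μ i).withDensity (f i)) =
      (Measure.pi μ).withDensity fun x => ∏ i, f i (x i) := by
  classical
  -- Boxes determine a product measure. On a box, the density times the indicator is a product of
  -- functions of single coordinates, which are independent, so its integral factors.
  refine Measure.pi_eq (fun s hs => ?_)
  have hms : MeasurableSet (Set.univ.pi s) := MeasurableSet.univ_pi hs
  rw [withDensity_apply _ hms, ← lintegral_indicator hms]
  have h1 : (Set.univ.pi s).indicator (fun x => ∏ i, f i (x i)) =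
      fun x : ∀ i, X i => ∏ i, (s i).indicator (f i) (x i) := by
    funext x
    by_cases hx : x ∈ Set.univ.pi s
    · rw [Set.indicator_of_mem hx]
      exact Finset.prod_congr rfl fun i _ => by
        rw [Set.indicator_of_mem (hx i (Set.mem_univ i))]
    · rw [Set.indicator_of_notMem hx]
      simp only [Set.mem_univ_pi, not_forall] at hx
      obtain ⟨i, hi⟩ := hx
      exact (Finset.prod_eq_zero (Finset.mem_univ i) (Set.indicator_of_notMem hi _)).symm
  have hg : ∀ i, Measurable ((s i).indicator (f i)) := fun i => (hf i).indicator (hs i)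
  have h2 := lintegral_prod_eq_prod_lintegral_of_indepFun (μ := Measure.pi μ) Finset.univ
    (fun i (x : ∀ i, X i) => (s i).indicator (f i) (x i))
    (iIndepFun_pi (μ := μ) (X := fun i => (s i).indicator (f i)) fun i => (hg i).aemeasurable)
    (fun i => (hg i).comp (measurable_pi_apply i))
  rw [h1, h2]
  refine Finset.prod_congr rfl fun i _ => ?_
  rw [(measurePreserving_eval μ i).lintegral_comp (hg i), lintegral_indicator (hs i),
    withDensity_apply _ (hs i)]

/-! ### Adapted representation of a sequence by functions of innovations and uniform variables -/

/-- Fubini: both measures of a set integrate the `κ a`-mass of its section at `a`. This trades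
randomization by a kernel for a function of an independent uniform variable. -/
theorem map_prod_volume_eq_compProd {X Y : Type*} [MeasurableSpace X] [MeasurableSpace Y]
    (μ : Measure X) [IsFiniteMeasure μ] (κ : Kernel X Y) [IsMarkovKernel κ] (f : X → I → Y)
    (hf : Measurable (Function.uncurry f)) (hκ : ∀ a, volume.map (f a) = κ a) :
    (μ.prod (volume : Measure I)).map (fun p => (p.1, f p.1 p.2)) = μ.compProd κ := by
  have hm : Measurable fun p : X × I => (p.1, f p.1 p.2) := measurable_fst.prodMk hf
  ext s hs
  rw [Measure.map_apply hm hs, Measure.prod_apply (hm hs), Measure.compProd_apply hs]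
  refine lintegral_congr fun a => ?_
  rw [← hκ a, Measure.map_apply (hf.of_uncurry_left) (measurable_prodMk_left hs)]
  rfl

theorem measurable_fin_snoc {n : ℕ} {X : Type*} [MeasurableSpace X] :
    Measurable fun p : (Fin n → X) × X => (Fin.snoc p.1 p.2 : Fin (n + 1) → X) := by
  refine measurable_pi_lambda _ fun d => ?_
  refine Fin.lastCases ?_ (fun d => ?_) d
  · simpa using measurable_snd
  · simp only [Fin.snoc_castSucc]
    exact (measurable_pi_apply d).comp measurable_fst

theorem map_last_init_pi {n : ℕ} {X : Type*} [MeasurableSpace X] (ν : Fin (n + 1) → Measure X)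
    [∀ i, SigmaFinite (ν i)] :
    (Measure.pi ν).map (fun w => ((fun d : Fin n => w d.castSucc), w (Fin.last n))) =
      (Measure.pi fun d : Fin n => ν d.castSucc).prod (ν (Fin.last n)) := by
  have h := (measurePreserving_piFinSuccAbove ν (Fin.last n)).map_eq
  -- `piFinSuccAbove` puts the removed coordinate first, hence the swap.
  have h2 := congrArg (Measure.map Prod.swap) h
  rw [Measure.map_map measurable_swap (MeasurableEquiv.measurable _), Measure.prod_swap] at h2
  simp only [Fin.succAbove_last] at h2
  rw [← h2]
  congr 1
  funext w
  simp [MeasurableEquiv.piFinSuccAbove, Fin.insertNthEquiv, Fin.init_def]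

/-- Induction on the number of statistics. The last statistic is drawn from its conditional law
given the history and the last innovation. Independence makes the joint law of these two a product,
and the induction hypothesis reproduces the history factor from earlier innovations and uniforms.
Keeping the innovations in the joint law lets a density in the innovations be transported along. -/
theorem exists_adapted_representation {E Ω : Type*} [MeasurableSpace E] [MeasurableSpace Ω]
    (Q : Measure Ω) [IsProbabilityMeasure Q] (n : ℕ) (S : Fin n → Ω → ℝ) (ξ : Fin n → Ω → E)
    (hS : ∀ d, Measurable (S d)) (hξ : ∀ d, Measurable (ξ d))
    (hind : ∀ d, IndepFun (fun ω (c : Set.Iio d) => (S c ω, ξ c ω)) (ξ d) Q) :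
    ∃ T : Fin n → (Fin n → E × I) → ℝ, (∀ d, Measurable (T d)) ∧
      (∀ d, DependsOn (T d) (Set.Iic d)) ∧
      (Measure.pi fun d => (Q.map (ξ d)).prod volume).map (fun w d => (T d w, (w d).1)) =
        Q.map (fun ω d => (S d ω, ξ d ω)) := by
  induction n with
  | zero =>
    refine ⟨fun d => d.elim0, fun d => d.elim0, fun d => d.elim0, ?_⟩
    have : ∀ d, IsProbabilityMeasure (Q.map (ξ d)) := fun d => d.elim0
    have e1 : IsProbabilityMeasure ((Measure.pi fun d => (Q.map (ξ d)).prod volume).map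
      (fun (w : Fin 0 → E × I) (d : Fin 0) => ((d.elim0 : ℝ), (w d).1))) :=
      Measure.isProbabilityMeasure_map (measurable_pi_lambda _ fun d => d.elim0).aemeasurable
    have e2 : IsProbabilityMeasure (Q.map (fun ω (d : Fin 0) => (S d ω, ξ d ω))) :=
      Measure.isProbabilityMeasure_map (measurable_pi_lambda _ fun d => d.elim0).aemeasurable
    -- The empty family is the only point of the space, and both measures have mass one.
    ext s hs
    rcases Set.eq_empty_or_nonempty s with rfl | hne
    · simp
    · have : s = Set.univ := Subsingleton.eq_univ_of_nonempty hne
      subst this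
      rw [e2.measure_univ, ← e1.measure_univ]
      congr 2
      funext w d
      exact d.elim0
  | succ n ih =>
    obtain ⟨T, hTm, hTd, hTl⟩ := ih (fun d => S d.castSucc) (fun d => ξ d.castSucc)
      (fun d => hS _) (fun d => hξ _) (fun d =>
        (hind d.castSucc).comp
          (φ := fun (w : Set.Iio d.castSucc → ℝ × E) (c : Set.Iio d) =>
            w ⟨(c : Fin n).castSucc, Fin.castSucc_lt_castSucc_iff.2 c.2⟩)
          (measurable_pi_lambda _ fun c => measurable_pi_apply _) measurable_id)
    have hp : ∀ d, IsProbabilityMeasure (Q.map (ξ d)) := fun d =>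
      Measure.isProbabilityMeasure_map (hξ d).aemeasurable
    set H : Ω → Fin n → ℝ × E := fun ω d => (S d.castSucc ω, ξ d.castSucc ω) with hH
    have hHm : Measurable H := measurable_pi_lambda _ fun d => (hS _).prodMk (hξ _)
    have hHp : IsProbabilityMeasure (Q.map H) := Measure.isProbabilityMeasure_map hHm.aemeasurable
    have hHi : IndepFun H (ξ (Fin.last n)) Q :=
      (hind (Fin.last n)).comp
        (φ := fun (w : Set.Iio (Fin.last n) → ℝ × E) (c : Fin n) =>
          w ⟨c.castSucc, Fin.castSucc_lt_last c⟩)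
        (measurable_pi_lambda _ fun c => measurable_pi_apply _) measurable_id
    -- A uniform variable realizes the conditional law of the last statistic given the history and
    -- the last innovation.
    obtain ⟨f, hf, hfκ⟩ := Kernel.exists_measurable_map_eq_unitInterval
      (condDistrib (S (Fin.last n)) (fun ω => (H ω, ξ (Fin.last n) ω)) Q)
    set G : (Fin n → E × I) → Fin n → ℝ × E := fun w d => (T d w, (w d).1) with hG
    have hGm : Measurable G := measurable_pi_lambda _ fun d =>
      (hTm d).prodMk (measurable_fst.comp (measurable_pi_apply d))
    set ini : (Fin (n + 1) → E × I) → Fin n → E × I := fun w d => w d.castSucc with hini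
    have him : Measurable ini := measurable_pi_lambda _ fun d => measurable_pi_apply _
    -- The history inserted in `f` is the one rebuilt by `T`, so the new statistic has the right
    -- joint law with the earlier ones.
    set TL : (Fin (n + 1) → E × I) → ℝ := fun w =>
      f (G (ini w), (w (Fin.last n)).1) (w (Fin.last n)).2 with hTL
    have hTLm : Measurable TL :=
      hf.comp (((hGm.comp him).prodMk (measurable_fst.comp (measurable_pi_apply _))).prodMk
        (measurable_snd.comp (measurable_pi_apply _)))
    refine ⟨fun d => Fin.lastCases (motive := fun _ => (Fin (n + 1) → E × I) → ℝ) TL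
      (fun d w => T d (ini w)) d, fun d => ?_, fun d => ?_, ?_⟩
    · refine Fin.lastCases ?_ (fun d => ?_) d
      · simpa using hTLm
      · simp only [Fin.lastCases_castSucc]
        exact (hTm d).comp him
    · refine Fin.lastCases ?_ (fun d => ?_) d
      · intro w w' hw
        have : w = w' := funext fun i => hw i (Fin.le_last i)
        rw [this]
      · intro w w' hw
        simp only [Fin.lastCases_castSucc]
        exact hTd d fun i hi => hw _ (by simpa using hi)
    · -- the joint law of history, current innovation and current statistic
      have hreal : Q.map (fun ω => ((H ω, ξ (Fin.last n) ω), S (Fin.last n) ω)) =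
          (((Q.map H).prod (Q.map (ξ (Fin.last n)))).prod (volume : Measure I)).map
            (fun p => (p.1, f p.1 p.2)) := by
        rw [map_prod_volume_eq_compProd _ _ f hf hfκ,
          ← (indepFun_iff_map_prod_eq_prod_map_map hHm.aemeasurable (hξ _).aemeasurable).1 hHi,
          compProd_map_condDistrib (hS _).aemeasurable]
      have hfm : Measurable fun p : ((Fin n → ℝ × E) × E) × I => (p.1, f p.1 p.2) :=
        measurable_fst.prodMk hf
      set R : ((Fin n → ℝ × E) × E) × ℝ → Fin (n + 1) → ℝ × E :=
        fun p => Fin.snoc p.1.1 (p.2, p.1.2) with hR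
      have hRm : Measurable R := measurable_fin_snoc.comp
        ((measurable_fst.comp measurable_fst).prodMk
          (measurable_snd.prodMk (measurable_snd.comp measurable_fst)))
      have hright : Q.map (fun ω d => (S d ω, ξ d ω)) =
          (Q.map (fun ω => ((H ω, ξ (Fin.last n) ω), S (Fin.last n) ω))).map R := by
        rw [Measure.map_map hRm ((hHm.prodMk (hξ _)).prodMk (hS _))]
        congr 1
        funext ω d
        refine Fin.lastCases ?_ (fun d => ?_) d <;> simp [hR, hH]
      rw [hright, hreal, ← hTl,
        show (Measure.map (ξ (Fin.last n)) Q) = (Measure.map (ξ (Fin.last n)) Q).map id by simp,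
        Measure.map_prod_map _ _ hGm measurable_id,
        show (volume : Measure I) = (volume : Measure I).map id by simp,
        Measure.map_prod_map _ _ (hGm.prodMap measurable_id) measurable_id]
      simp only [Measure.map_id]
      set ν : Fin (n + 1) → Measure (E × I) := fun d => (Q.map (ξ d)).prod volume with hν
      have hassoc : ((Measure.pi fun d : Fin n => ν d.castSucc).prod
          (Q.map (ξ (Fin.last n)))).prod (volume : Measure I) =
          (Measure.pi ν).map (fun w => ((ini w, (w (Fin.last n)).1), (w (Fin.last n)).2)) := by
        have hA := (measurePreserving_prodAssoc (Measure.pi fun d : Fin n => ν d.castSucc)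
          (Q.map (ξ (Fin.last n))) (volume : Measure I)).symm.map_eq
        rw [← hA, show ((Q.map (ξ (Fin.last n))).prod volume) = ν (Fin.last n) from rfl,
          ← map_last_init_pi ν, Measure.map_map (MeasurableEquiv.measurable _) (by fun_prop)]
        rfl
      rw [hassoc, Measure.map_map, Measure.map_map, Measure.map_map]
      · congr 1
        funext w d
        refine Fin.lastCases ?_ (fun d => ?_) d <;> simp [hR, hG, hTL, hini]
      all_goals try first | exact hRm | fun_prop

/-! ### Uniform variables on the unit interval -/

/-- Passes from the law of `U`, a measure on `ℝ`, to the volume of the subtype `I` on which the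
randomizations are defined. -/
theorem map_projIcc_volume :
    ((volume : Measure ℝ).restrict (Set.Icc 0 1)).map
      (Set.projIcc (0 : ℝ) 1 zero_le_one) = (volume : Measure I) := by
  have h : Measurable (Set.projIcc (0 : ℝ) 1 zero_le_one) := continuous_projIcc.measurable
  rw [← map_comap_subtype_coe (measurableSet_Icc (a := (0 : ℝ)) (b := 1)) volume,
    Measure.map_map h measurable_subtype_coe]
  have : Set.projIcc (0 : ℝ) 1 zero_le_one ∘ (Subtype.val : Set.Icc (0 : ℝ) 1 → ℝ) = id := by
    funext x
    exact Set.projIcc_val zero_le_one x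
  rw [this, Measure.map_id]
  rfl

/-- The cube is a standard Borel space, so its uniform law is an image of the uniform law on the
interval. One variable `U` thus supplies a separate randomization for every statistic. -/
theorem exists_measurable_map_pi_volume (n : ℕ) :
    ∃ g : ℝ → Fin n → I, Measurable g ∧
      ((volume : Measure ℝ).restrict (Set.Icc 0 1)).map g =
        Measure.pi fun _ => (volume : Measure I) := by
  obtain ⟨g, hg, hgl⟩ := Measure.exists_measurable_map_eq
    (Measure.pi fun _ : Fin n => (volume : Measure I))
  have h : Measurable (Set.projIcc (0 : ℝ) 1 zero_le_one) := continuous_projIcc.measurable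
  refine ⟨g ∘ Set.projIcc (0 : ℝ) 1 zero_le_one, hg.comp h, ?_⟩
  rw [← Measure.map_map hg h, map_projIcc_volume, hgl]

/-! ### Shifts of Gaussian measures -/

theorem withDensity_map_eq {X Y : Type*} [MeasurableSpace X] [MeasurableSpace Y] (μ : Measure X)
    {e : X → Y} (he : Measurable e) {f : Y → ENNReal} (hf : Measurable f) :
    (μ.map e).withDensity f = (μ.withDensity fun x => f (e x)).map e := by
  ext s hs
  rw [withDensity_apply _ hs, Measure.map_apply he hs, withDensity_apply _ (he hs),
    setLIntegral_map hs hf he]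

/-- Completing the square: `-x² / 2 + a x - a² / 2 = -(x - a)² / 2`. -/
theorem gaussianReal_withDensity_exp (a : ℝ) :
    (gaussianReal 0 1).withDensity (fun x => ENNReal.ofReal (Real.exp (a * x - a ^ 2 / 2))) =
      gaussianReal a 1 := by
  rw [gaussianReal_of_var_ne_zero 0 one_ne_zero, gaussianReal_of_var_ne_zero a one_ne_zero,
    ← withDensity_mul _ (measurable_gaussianPDF 0 1) (by fun_prop)]
  congr 1
  funext x
  simp only [Pi.mul_apply, gaussianPDF]
  rw [← ENNReal.ofReal_mul (gaussianPDFReal_nonneg _ _ _)]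
  congr 1
  simp only [gaussianPDFReal, mul_assoc, ← Real.exp_add]
  congr 2
  push_cast
  ring

/-- Finite-dimensional Cameron-Martin formula. The coordinates are independent and the density
factors, so the one-dimensional case applies to each of them. -/
theorem stdGaussian_withDensity_exp {ι : Type*} [Fintype ι] (a : EuclideanSpace ℝ ι) :
    (stdGaussian (EuclideanSpace ℝ ι)).withDensity
        (fun x => ENNReal.ofReal (Real.exp (inner ℝ a x - ‖a‖ ^ 2 / 2))) =
      (stdGaussian (EuclideanSpace ℝ ι)).map (· + a) := by
  have hm : Measurable fun x : EuclideanSpace ℝ ι =>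
    ENNReal.ofReal (Real.exp (inner ℝ a x - ‖a‖ ^ 2 / 2)) := by fun_prop
  have hL : Measurable (WithLp.toLp 2 : (ι → ℝ) → EuclideanSpace ℝ ι) := by fun_prop
  have : ∀ i, SigmaFinite ((gaussianReal 0 1).withDensity
      (fun x => ENNReal.ofReal (Real.exp (a i * x - a i ^ 2 / 2)))) := fun i => by
    rw [gaussianReal_withDensity_exp]; infer_instance
  rw [← map_pi_eq_stdGaussian, withDensity_map_eq _ hL hm, Measure.map_map (by fun_prop) hL]
  have h1 : (fun x : ι → ℝ => ENNReal.ofReal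
        (Real.exp (inner ℝ a (WithLp.toLp 2 x) - ‖a‖ ^ 2 / 2))) =
      fun x => ∏ i, ENNReal.ofReal (Real.exp (a i * x i - a i ^ 2 / 2)) := by
    funext x
    rw [← ENNReal.ofReal_prod_of_nonneg fun i _ => (Real.exp_pos _).le, ← Real.exp_sum,
      EuclideanSpace.real_norm_sq_eq, Finset.sum_sub_distrib, Finset.sum_div]
    simp [PiLp.inner_apply, mul_comm]
  rw [h1, ← Measure.pi_withDensity (fun _ : ι => gaussianReal 0 1)
    (fun i x => ENNReal.ofReal (Real.exp (a i * x - a i ^ 2 / 2))) (fun i => by fun_prop)]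
  simp_rw [gaussianReal_withDensity_exp]
  have h2 : Measure.pi (fun i => gaussianReal (a i) 1) =
      (Measure.pi fun _ : ι => gaussianReal 0 1).map (fun x i => x i + a i) := by
    rw [Measure.pi_map_pi (f := fun i x => x + a i) fun i => by fun_prop]
    simp_rw [gaussianReal_map_add_const, zero_add]
  rw [h2, Measure.map_map hL (by fun_prop)]
  rfl

theorem MeasureTheory.Integrable.fun_sub {X G : Type*} [MeasurableSpace X] [NormedAddCommGroup G]
    {μ : Measure X} {f g : X → G} (hf : Integrable f μ) (hg : Integrable g μ) :
    Integrable (fun x => f x - g x) μ := hf.sub hg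

/-! ### Products of expectations over a triangular array -/

/-- The logarithm of the power is `(k n / n) * (n * log (1 + g n))`, and `n * log (1 + g n)` has the
same limit as `n * g n`. -/
theorem Complex.tendsto_one_add_pow_of_ratio {g : ℕ → ℂ} {c : ℂ} {k : ℕ → ℕ} {τ : ℝ}
    (hg : Tendsto (fun n : ℕ => n * g n) atTop (𝓝 c))
    (hk : Tendsto (fun n : ℕ => (k n : ℝ) / n) atTop (𝓝 τ)) :
    Tendsto (fun n => (1 + g n) ^ k n) atTop (𝓝 (Complex.exp (τ * c))) := by
  have h1 := Complex.tendsto_nat_mul_log_one_add_of_tendsto hg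
  have hk' : Tendsto (fun n : ℕ => (((k n : ℝ) / n : ℝ) : ℂ)) atTop (𝓝 (τ : ℂ)) :=
    (Complex.continuous_ofReal.tendsto τ).comp hk
  have h2 := (Complex.continuous_exp.tendsto _).comp (hk'.mul h1)
  have hg0 : Tendsto g atTop (𝓝 0) := by
    have h3 := (tendsto_inv_atTop_nhds_zero_nat (𝕜 := ℂ)).mul hg
    rw [zero_mul] at h3
    refine h3.congr' ?_
    filter_upwards [eventually_ne_atTop 0] with n hn
    have : (n : ℂ) ≠ 0 := by exact_mod_cast hn
    field_simp
  refine h2.congr' ?_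
  filter_upwards [eventually_ne_atTop 0,
    hg0.eventually_ne (show (0 : ℂ) ≠ -1 by simp)] with n hn hne
  have hn' : (n : ℂ) ≠ 0 := by exact_mod_cast hn
  have hne' : 1 + g n ≠ 0 := fun h => hne (by linear_combination h)
  simp only [Function.comp_apply]
  push_cast
  rw [show (k n : ℂ) / n * (n * Complex.log (1 + g n)) = k n * Complex.log (1 + g n) by
    field_simp, Complex.exp_nat_mul, Complex.exp_log hne']

/-- Remainder of the exponential series after three terms; `|x| ≤ 1` makes the exponential factor
uniform in `x`. A complex `w` covers characteristic functions and exponential moments at once. -/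
theorem norm_cexp_mul_sub_le (w : ℂ) (x : ℝ) (hx : |x| ≤ 1) :
    ‖Complex.exp (w * x) - (1 + w * x + w ^ 2 / 2 * x ^ 2)‖ ≤
      ‖w‖ ^ 3 * Real.exp ‖w‖ * |x| ^ 3 := by
  have h := Complex.norm_exp_sub_sum_le_norm_mul_exp (w * x) 3
  simp only [Finset.sum_range_succ, Finset.sum_range_zero, Nat.factorial] at h
  have e : Complex.exp (w * x) - (1 + w * x + w ^ 2 / 2 * x ^ 2) =
      Complex.exp (w * x) - (0 + (w * x) ^ 0 / ((1 : ℕ) : ℂ) +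
        (w * x) ^ 1 / (((0 + 1) * 1 : ℕ) : ℂ) + (w * x) ^ 2 / (((1 + 1) * ((0 + 1) * 1) : ℕ) : ℂ)) := by
    push_cast; ring
  rw [e]
  refine h.trans ?_
  have hn : ‖w * (x : ℂ)‖ = ‖w‖ * |x| := by simp
  rw [hn, mul_pow]
  have : Real.exp (‖w‖ * |x|) ≤ Real.exp ‖w‖ :=
    Real.exp_le_exp.2 (mul_le_of_le_one_right (norm_nonneg _) hx)
  calc ‖w‖ ^ 3 * |x| ^ 3 * Real.exp (‖w‖ * |x|) ≤ ‖w‖ ^ 3 * |x| ^ 3 * Real.exp ‖w‖ := by gcongr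
    _ = _ := by ring

/-- This is the cross term in `IsSmallArray.tendsto_integral_sq`. Multiplying `1 + x` by the Taylor
polynomial `1 + x + x² / 2` produces the stated quadratic and an extra `x³ / 2`. -/
theorem norm_one_add_mul_cexp_sub_le (x : ℝ) (hx : |x| ≤ 1) :
    ‖(1 + x) * Complex.exp x - (1 + 2 * x + 3 / 2 * x ^ 2)‖ ≤
      (2 * Real.exp 1 + 1) * |x| ^ 3 := by
  have h := norm_cexp_mul_sub_le 1 x hx
  simp only [norm_one, one_pow, one_mul] at h
  have e : (1 + x) * Complex.exp x - (1 + 2 * x + 3 / 2 * x ^ 2) =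
      (1 + x) * (Complex.exp x - (1 + x + 1 / 2 * x ^ 2)) + 1 / 2 * (x : ℂ) ^ 3 := by ring
  rw [e]
  have h1 : ‖(1 + x : ℂ)‖ ≤ 2 := by
    refine (norm_add_le _ _).trans ?_
    simp only [norm_one, Complex.norm_real, Real.norm_eq_abs]
    linarith
  calc _ ≤ ‖(1 + x : ℂ)‖ * ‖Complex.exp x - (1 + x + 1 / 2 * x ^ 2)‖ + ‖1 / 2 * (x : ℂ) ^ 3‖ := by
        refine (norm_add_le _ _).trans ?_
        rw [norm_mul]
    _ ≤ 2 * (Real.exp 1 * |x| ^ 3) + |x| ^ 3 := by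
        gcongr
        simp only [norm_mul, norm_pow, Complex.norm_real, Real.norm_eq_abs]
        norm_num
        have : 0 ≤ |x| ^ 3 := by positivity
        linarith
    _ = _ := by ring

/-- A triangular array `X n` of bounded, centred variables, uniformly small, with variances of
order `v / n`. -/
structure IsSmallArray {Z : Type*} [MeasurableSpace Z] (P : Measure Z) (X : ℕ → Z → ℝ)
    (ε : ℕ → ℝ) (v : ℝ) : Prop where
  measurable : ∀ n, Measurable (X n)
  tendsto_bound : Tendsto ε atTop (𝓝 0)
  abs_le : ∀ n z, |X n z| ≤ ε n
  integral_eq_zero : ∀ n, ∫ z, X n z ∂P = 0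
  tendsto_variance : Tendsto (fun n : ℕ => (n : ℝ) * ∫ z, X n z ^ 2 ∂P) atTop (𝓝 v)

/-! ### Exponential and product limits for small arrays. -/

section SmallArray

variable {Z : Type*} [MeasurableSpace Z] {P : Measure Z} [IsProbabilityMeasure P]
  {X : ℕ → Z → ℝ} {ε : ℕ → ℝ} {v : ℝ}

/-- Centring removes the linear term, so `E φ(X n) = 1 + b E X² + O(ε n * E X²)`. Multiplied by `n`,
the excess over one tends to `b * v`, and the power becomes an exponential. -/
theorem IsSmallArray.tendsto_integral_pow (hX : IsSmallArray P X ε v) {φ : ℝ → ℂ}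
    (hφm : Continuous φ) {a b : ℂ} {C : ℝ}
    (hφ : ∀ x : ℝ, |x| ≤ 1 → ‖φ x - (1 + a * x + b * x ^ 2)‖ ≤ C * |x| ^ 3)
    {k : ℕ → ℕ} {τ : ℝ} (hk : Tendsto (fun n : ℕ => (k n : ℝ) / n) atTop (𝓝 τ)) :
    Tendsto (fun n => (∫ z, φ (X n z) ∂P) ^ k n) atTop (𝓝 (Complex.exp (τ * (b * v)))) := by
  have hC : 0 ≤ C := by
    have := (norm_nonneg _).trans (hφ 1 (by simp))
    simpa using this
  have hint : ∀ n, ∀ j, Integrable (fun z => X n z ^ j) P := fun n j =>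
    Integrable.of_bound ((hX.measurable n).pow_const j).aestronglyMeasurable (ε n ^ j)
      (ae_of_all _ fun z => by
        rw [norm_pow, Real.norm_eq_abs]
        exact pow_le_pow_left₀ (abs_nonneg _) (hX.abs_le n z) j)
  set g : ℕ → ℂ := fun n => ∫ z, (φ (X n z) - 1) ∂P with hg
  have hev : ∀ᶠ n in atTop, ε n ≤ 1 :=
    (hX.tendsto_bound.eventually (gt_mem_nhds one_pos)).mono fun n h => le_of_lt h
  have hφint : ∀ᶠ n in atTop, Integrable (fun z => φ (X n z)) P := by
    filter_upwards [hev] with n hn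
    refine Integrable.of_bound (C := C + (1 + ‖a‖ + ‖b‖))
      ((hφm.measurable.comp (hX.measurable n)).aestronglyMeasurable) (ae_of_all _ fun z => ?_)
    have hx : |X n z| ≤ 1 := (hX.abs_le n z).trans hn
    have h1 := hφ _ hx
    have h2 : ‖1 + a * X n z + b * (X n z : ℂ) ^ 2‖ ≤ 1 + ‖a‖ + ‖b‖ := by
      refine (norm_add_le _ _).trans (add_le_add ((norm_add_le _ _).trans (add_le_add ?_ ?_)) ?_)
      · simp
      · rw [norm_mul, Complex.norm_real, Real.norm_eq_abs]
        exact mul_le_of_le_one_right (norm_nonneg _) hx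
      · rw [norm_mul, norm_pow, Complex.norm_real, Real.norm_eq_abs]
        exact mul_le_of_le_one_right (norm_nonneg _) (pow_le_one₀ (abs_nonneg _) hx)
    have h3 : C * |X n z| ^ 3 ≤ C :=
      mul_le_of_le_one_right hC (pow_le_one₀ (abs_nonneg _) hx)
    calc ‖φ (X n z)‖ = ‖(φ (X n z) - (1 + a * X n z + b * (X n z : ℂ) ^ 2)) +
          (1 + a * X n z + b * (X n z : ℂ) ^ 2)‖ := by ring_nf
      _ ≤ _ := (norm_add_le _ _).trans (add_le_add (h1.trans h3) h2)
  have hrem : ∀ᶠ n in atTop, ‖g n - b * (∫ z, X n z ^ 2 ∂P : ℝ)‖ ≤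
      C * ε n * ∫ z, X n z ^ 2 ∂P := by
    filter_upwards [hev, hφint] with n hn hi
    have i1 : Integrable (fun z => (X n z : ℂ)) P := by
      simpa using (hint n 1).ofReal (𝕜 := ℂ)
    have i2 : Integrable (fun z => (X n z : ℂ) ^ 2) P := by
      simpa using (hint n 2).ofReal (𝕜 := ℂ)
    have e1 : ∫ z, (X n z : ℂ) ∂P = 0 := by
      rw [integral_complex_ofReal, hX.integral_eq_zero n]; simp
    have e2 : ∫ z, (X n z : ℂ) ^ 2 ∂P = (∫ z, X n z ^ 2 ∂P : ℝ) := by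
      rw [← integral_complex_ofReal]; simp
    have e : g n - b * (∫ z, X n z ^ 2 ∂P : ℝ) =
        ∫ z, (φ (X n z) - (1 + a * X n z + b * (X n z : ℂ) ^ 2)) ∂P := by
      rw [hg, ← e2]
      have : ∀ z, φ (X n z) - (1 + a * X n z + b * (X n z : ℂ) ^ 2) =
        (φ (X n z) - 1) - (a * X n z + b * (X n z : ℂ) ^ 2) := fun z => by ring
      simp_rw [this]
      rw [integral_sub (hi.fun_sub (integrable_const _)) ((i1.const_mul a).fun_add (i2.const_mul b)),
        integral_add (i1.const_mul a) (i2.const_mul b), integral_const_mul, integral_const_mul, e1]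
      simp
    rw [e, ← integral_const_mul]
    refine norm_integral_le_of_norm_le ((hint n 2).const_mul _) (ae_of_all _ fun z => ?_)
    have hx : |X n z| ≤ 1 := (hX.abs_le n z).trans hn
    refine (hφ _ hx).trans ?_
    rw [mul_assoc]
    refine mul_le_mul_of_nonneg_left ?_ hC
    rw [pow_succ', ← sq_abs (X n z)]
    exact mul_le_mul_of_nonneg_right (hX.abs_le n z) (by positivity)
  have hgn : Tendsto (fun n : ℕ => n * g n) atTop (𝓝 (b * v)) := by
    have h1 : Tendsto (fun n : ℕ => b * (((n : ℝ) * ∫ z, X n z ^ 2 ∂P : ℝ) : ℂ)) atTop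
        (𝓝 (b * v)) :=
      ((Complex.continuous_ofReal.tendsto v).comp hX.tendsto_variance).const_mul b
    have h2 : Tendsto (fun n : ℕ => C * ε n * ((n : ℝ) * ∫ z, X n z ^ 2 ∂P)) atTop (𝓝 0) := by
      have := (hX.tendsto_bound.const_mul C).mul hX.tendsto_variance
      simpa using this
    have h3 : Tendsto (fun n : ℕ => n * g n - b * (((n : ℝ) * ∫ z, X n z ^ 2 ∂P : ℝ) : ℂ)) atTop
        (𝓝 0) := by
      refine squeeze_zero_norm' ?_ h2
      filter_upwards [hrem] with n hn
      have : (n : ℂ) * g n - b * (((n : ℝ) * ∫ z, X n z ^ 2 ∂P : ℝ) : ℂ) =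
        n * (g n - b * (∫ z, X n z ^ 2 ∂P : ℝ)) := by push_cast; ring
      rw [this, norm_mul, Complex.norm_natCast]
      calc _ ≤ (n : ℝ) * (C * ε n * ∫ z, X n z ^ 2 ∂P) := by gcongr
        _ = _ := by ring
    simpa using h3.add h1
  refine (Complex.tendsto_one_add_pow_of_ratio hgn hk).congr' ?_
  filter_upwards [hφint] with n hi
  congr 1
  rw [hg]
  simp only
  rw [integral_sub hi (integrable_const _)]
  simp

theorem integral_pi_finset_prod {ι 𝕜 : Type*} [Fintype ι] [RCLike 𝕜] (A : Finset ι) (f : Z → 𝕜) :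
    ∫ z : ι → Z, ∏ i ∈ A, f (z i) ∂(Measure.pi fun _ => P) = (∫ z, f z ∂P) ^ A.card := by
  classical
  have h := integral_fintype_prod_eq_prod (μ := fun _ : ι => P)
    (fun i z => if i ∈ A then f z else (1 : 𝕜))
  have e : ∀ z : ι → Z, (∏ i, if i ∈ A then f (z i) else (1 : 𝕜)) = ∏ i ∈ A, f (z i) := fun z => by
    rw [Finset.prod_ite_mem, Finset.univ_inter]
  simp only [e] at h
  rw [h, ← Finset.prod_const, ← Finset.univ_inter A, ← Finset.prod_ite_mem]
  refine Finset.prod_congr rfl fun i _ => ?_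
  simp only [Finset.univ_inter]
  split_ifs <;> simp

theorem IsSmallArray.tendsto_integral_prod (hX : IsSmallArray P X ε v) {φ : ℝ → ℂ}
    (hφm : Continuous φ) {a b : ℂ} {C : ℝ}
    (hφ : ∀ x : ℝ, |x| ≤ 1 → ‖φ x - (1 + a * x + b * x ^ 2)‖ ≤ C * |x| ^ 3)
    {A : ∀ n, Finset (Fin n)} {τ : ℝ}
    (hA : Tendsto (fun n : ℕ => ((A n).card : ℝ) / n) atTop (𝓝 τ)) :
    Tendsto (fun n => ∫ z : Fin n → Z, ∏ i ∈ A n, φ (X n (z i)) ∂(Measure.pi fun _ => P)) atTop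
      (𝓝 (Complex.exp (τ * (b * v)))) := by
  refine (hX.tendsto_integral_pow hφm hφ hA).congr fun n => ?_
  exact (integral_pi_finset_prod (P := P) (A n) (fun z => φ (X n z))).symm

theorem IsSmallArray.tendsto_integral_prod_real (hX : IsSmallArray P X ε v) {φ : ℝ → ℝ}
    (hφm : Continuous φ) {a b : ℝ} {C : ℝ}
    (hφ : ∀ x : ℝ, |x| ≤ 1 → ‖(φ x : ℂ) - (1 + a * x + b * x ^ 2)‖ ≤ C * |x| ^ 3)
    {A : ∀ n, Finset (Fin n)} {τ : ℝ}
    (hA : Tendsto (fun n : ℕ => ((A n).card : ℝ) / n) atTop (𝓝 τ)) :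
    Tendsto (fun n => ∫ z : Fin n → Z, ∏ i ∈ A n, φ (X n (z i)) ∂(Measure.pi fun _ => P)) atTop
      (𝓝 (Real.exp (τ * (b * v)))) := by
  have h := hX.tendsto_integral_prod (φ := fun x => (φ x : ℂ))
    (Complex.continuous_ofReal.comp hφm) hφ hA
  have h2 := (Complex.continuous_re.tendsto _).comp h
  have e : (Complex.exp (τ * (b * v))).re = Real.exp (τ * (b * v)) := by
    rw [← Complex.exp_ofReal_re]; push_cast; rfl
  rw [e] at h2
  refine h2.congr fun n => ?_
  simp only [Function.comp_apply]
  simp_rw [← Complex.ofReal_prod]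
  rw [integral_complex_ofReal, Complex.ofReal_re]

/-- Central limit theorem for the array in exponential form; `w = Complex.I` gives the
characteristic functions. -/
theorem IsSmallArray.tendsto_integral_exp (hX : IsSmallArray P X ε v) (w : ℂ)
    {A : ∀ n, Finset (Fin n)} {τ : ℝ}
    (hA : Tendsto (fun n : ℕ => ((A n).card : ℝ) / n) atTop (𝓝 τ)) :
    Tendsto (fun n => ∫ z : Fin n → Z, Complex.exp (w * ∑ i ∈ A n, X n (z i))
      ∂(Measure.pi fun _ => P)) atTop (𝓝 (Complex.exp (τ * (w ^ 2 / 2 * v)))) := by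
  refine (hX.tendsto_integral_prod (φ := fun x => Complex.exp (w * x)) (by fun_prop)
    (norm_cexp_mul_sub_le w) hA).congr fun n => ?_
  refine integral_congr_ae (ae_of_all _ fun z => ?_)
  simp only
  rw [← Complex.exp_sum, ← Finset.mul_sum]
  push_cast
  rfl

theorem IsSmallArray.tendsto_integral_exp_real (hX : IsSmallArray P X ε v) (w : ℝ)
    {A : ∀ n, Finset (Fin n)} {τ : ℝ}
    (hA : Tendsto (fun n : ℕ => ((A n).card : ℝ) / n) atTop (𝓝 τ)) :
    Tendsto (fun n => ∫ z : Fin n → Z, Real.exp (w * ∑ i ∈ A n, X n (z i))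
      ∂(Measure.pi fun _ => P)) atTop (𝓝 (Real.exp (τ * (w ^ 2 / 2 * v)))) := by
  refine (hX.tendsto_integral_prod_real (φ := fun x => Real.exp (w * x)) (a := w)
    (b := w ^ 2 / 2) (C := ‖(w : ℂ)‖ ^ 3 * Real.exp ‖(w : ℂ)‖) (by fun_prop)
    (fun x hx => ?_) hA).congr fun n => ?_
  · have := norm_cexp_mul_sub_le w x hx
    push_cast
    exact this
  · refine integral_congr_ae (ae_of_all _ fun z => ?_)
    simp only
    rw [← Real.exp_sum, Finset.mul_sum]

omit [IsProbabilityMeasure P] in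
theorem IsSmallArray.abs_sum_le (hX : IsSmallArray P X ε v) (n : ℕ) (z : Fin n → Z)
    (A : Finset (Fin n)) : |∑ i ∈ A, X n (z i)| ≤ n * |ε n| := by
  calc |∑ i ∈ A, X n (z i)| ≤ ∑ i ∈ A, |X n (z i)| := Finset.abs_sum_le_sum_abs _ _
    _ ≤ ∑ i ∈ A, |ε n| := Finset.sum_le_sum fun i _ => (hX.abs_le n _).trans (le_abs_self _)
    _ = A.card * |ε n| := by simp
    _ ≤ n * |ε n| := by
      gcongr
      simpa using A.card_le_univ

theorem IsSmallArray.integrable_exp (hX : IsSmallArray P X ε v) (n : ℕ) (A : Finset (Fin n))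
    (w : ℝ) : Integrable (fun z : Fin n → Z => Real.exp (w * ∑ i ∈ A, X n (z i)))
      (Measure.pi fun _ => P) := by
  have hXm := hX.measurable n
  refine Integrable.of_bound (C := Real.exp (|w| * (n * |ε n|)))
    (Measurable.aestronglyMeasurable (by fun_prop)) (ae_of_all _ fun z => ?_)
  rw [Real.norm_eq_abs, Real.abs_exp]
  refine Real.exp_le_exp.2 ((le_abs_self _).trans ?_)
  rw [abs_mul]
  exact mul_le_mul_of_nonneg_left (hX.abs_sum_le n z A) (abs_nonneg _)

theorem IsSmallArray.integrable_prod_one_add (hX : IsSmallArray P X ε v) (n : ℕ)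
    (A : Finset (Fin n)) : Integrable (fun z : Fin n → Z => ∏ i ∈ A, (1 + X n (z i)))
      (Measure.pi fun _ => P) := by
  have hXm := hX.measurable n
  refine Integrable.of_bound (C := ∏ i ∈ A, (1 + |ε n|))
    (Measurable.aestronglyMeasurable (by fun_prop)) (ae_of_all _ fun z => ?_)
  rw [Real.norm_eq_abs, Finset.abs_prod]
  refine Finset.prod_le_prod (fun i _ => abs_nonneg _) fun i _ => ?_
  refine (abs_add_le _ _).trans ?_
  rw [abs_one]
  exact add_le_add le_rfl ((hX.abs_le n _).trans (le_abs_self _))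

/-- Expanding the square gives three expectations with limits `e^{τv}`, `e^{3τv/2}` and `e^{2τv}`.
With the powers of the normalization `e^{-τv/2}` each of them contributes a multiple of `e^{τv}`,
with coefficients `1 - 2 + 1 = 0`. -/
theorem IsSmallArray.tendsto_integral_sq (hX : IsSmallArray P X ε v)
    {A : ∀ n, Finset (Fin n)} {τ : ℝ}
    (hA : Tendsto (fun n : ℕ => ((A n).card : ℝ) / n) atTop (𝓝 τ)) :
    Tendsto (fun n => ∫ z : Fin n → Z, (∏ i ∈ A n, (1 + X n (z i)) -
      Real.exp (∑ i ∈ A n, X n (z i) - τ * v / 2)) ^ 2 ∂(Measure.pi fun _ => P)) atTop (𝓝 0) := by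
  have h1 := hX.tendsto_integral_prod_real (φ := fun x => (1 + x) ^ 2) (a := 2) (b := 1) (C := 0)
    (by fun_prop) (fun x _ => by
      have : (((1 + x) ^ 2 : ℝ) : ℂ) - (1 + (2 : ℝ) * x + (1 : ℝ) * x ^ 2) = 0 := by
        push_cast; ring
      rw [this]; simp) hA
  have h2 := hX.tendsto_integral_prod_real (φ := fun x => (1 + x) * Real.exp x)
    (a := 2) (b := 3 / 2) (by fun_prop) (fun x hx => by
      have := norm_one_add_mul_cexp_sub_le x hx
      push_cast
      exact this) hA
  have h3 := hX.tendsto_integral_exp_real 2 hA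
  have h := (h1.sub (h2.const_mul (2 * Real.exp (-(τ * v / 2))))).add
    (h3.const_mul (Real.exp (-(τ * v / 2)) ^ 2))
  have e0 : Real.exp (τ * (1 * v)) - 2 * Real.exp (-(τ * v / 2)) * Real.exp (τ * (3 / 2 * v)) +
      Real.exp (-(τ * v / 2)) ^ 2 * Real.exp (τ * (2 ^ 2 / 2 * v)) = 0 := by
    rw [← Real.exp_nat_mul, mul_assoc, ← Real.exp_add, ← Real.exp_add]
    have e1 : -(τ * v / 2) + τ * (3 / 2 * v) = τ * (1 * v) := by ring
    have e2 : ((2 : ℕ) : ℝ) * -(τ * v / 2) + τ * (2 ^ 2 / 2 * v) = τ * (1 * v) := by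
      push_cast; ring
    rw [e1, e2]
    ring
  rw [e0] at h
  refine h.congr fun n => ?_
  have hXm := hX.measurable n
  have i1 : Integrable (fun z : Fin n → Z => ∏ i ∈ A n, (1 + X n (z i)) ^ 2)
      (Measure.pi fun _ => P) := by
    refine Integrable.of_bound (C := ∏ i ∈ A n, (1 + |ε n|) ^ 2)
      (Measurable.aestronglyMeasurable (by fun_prop)) (ae_of_all _ fun z => ?_)
    rw [Real.norm_eq_abs, Finset.abs_prod]
    refine Finset.prod_le_prod (fun i _ => abs_nonneg _) fun i _ => ?_
    rw [abs_pow]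
    refine pow_le_pow_left₀ (abs_nonneg _) ((abs_add_le _ _).trans ?_) 2
    rw [abs_one]
    exact add_le_add le_rfl ((hX.abs_le n _).trans (le_abs_self _))
  have i2 : Integrable (fun z : Fin n → Z => ∏ i ∈ A n, ((1 + X n (z i)) * Real.exp (X n (z i))))
      (Measure.pi fun _ => P) := by
    refine Integrable.of_bound (C := ∏ i ∈ A n, ((1 + |ε n|) * Real.exp |ε n|))
      (Measurable.aestronglyMeasurable (by fun_prop)) (ae_of_all _ fun z => ?_)
    rw [Real.norm_eq_abs, Finset.abs_prod]
    refine Finset.prod_le_prod (fun i _ => abs_nonneg _) fun i _ => ?_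
    rw [abs_mul, Real.abs_exp]
    have hb := (hX.abs_le n (z i)).trans (le_abs_self _)
    refine mul_le_mul ((abs_add_le _ _).trans ?_)
      (Real.exp_le_exp.2 ((le_abs_self _).trans hb)) (Real.exp_pos _).le (by positivity)
    rw [abs_one]
    exact add_le_add le_rfl hb
  have i3 := hX.integrable_exp n (A n) 2
  rw [← integral_const_mul, ← integral_const_mul, ← integral_sub i1 (i2.const_mul _),
    ← integral_add (i1.fun_sub (i2.const_mul _)) (i3.const_mul _)]
  refine integral_congr_ae (ae_of_all _ fun z => ?_)
  simp only
  rw [Finset.prod_mul_distrib, Finset.prod_pow, ← Real.exp_sum,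
    show ∑ i ∈ A n, X n (z i) - τ * v / 2 = -(τ * v / 2) + ∑ i ∈ A n, X n (z i) by ring,
    Real.exp_add, show (2 : ℝ) * ∑ i ∈ A n, X n (z i) = ((2 : ℕ) : ℝ) * ∑ i ∈ A n, X n (z i) by
      norm_num, Real.exp_nat_mul]
  ring

end SmallArray

/-- Nonnegativity of the variance of `|f|`. -/
theorem integral_abs_le_sqrt {Ω : Type*} [MeasurableSpace Ω] (P : Measure Ω)
    [IsProbabilityMeasure P] {f : Ω → ℝ} (hf : Integrable f P)
    (hf2 : Integrable (fun ω => f ω ^ 2) P) :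
    ∫ ω, |f ω| ∂P ≤ √(∫ ω, f ω ^ 2 ∂P) := by
  refine Real.le_sqrt_of_sq_le ?_
  set c := ∫ ω, |f ω| ∂P with hc
  have h0 : 0 ≤ ∫ ω, (|f ω| - c) ^ 2 ∂P := integral_nonneg fun ω => sq_nonneg _
  have e : ∫ ω, (|f ω| - c) ^ 2 ∂P = ∫ ω, f ω ^ 2 ∂P - c ^ 2 := by
    have : ∀ ω, (|f ω| - c) ^ 2 = f ω ^ 2 - (2 * c * |f ω| - c ^ 2) := fun ω => by
      rw [sub_sq, sq_abs]; ring
    simp_rw [this]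
    rw [integral_sub hf2 ((hf.abs.const_mul _).fun_sub (integrable_const _)),
      integral_sub (hf.abs.const_mul _) (integrable_const _), integral_const_mul, ← hc]
    simp
    ring
  linarith

/-! ### Comparison of product measures through the Hellinger affinity -/

theorem abs_integral_mul_le_sqrt {Ω : Type*} [MeasurableSpace Ω] {P : Measure Ω} {f g : Ω → ℝ}
    (hf : MemLp f 2 P) (hg : MemLp g 2 P) :
    ∫ ω, |f ω * g ω| ∂P ≤ √(∫ ω, f ω ^ 2 ∂P) * √(∫ ω, g ω ^ 2 ∂P) := by
  have h := integral_mul_norm_le_Lp_mul_Lq (μ := P) (f := f) (g := g)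
    Real.HolderConjugate.two_two (by simpa using hf) (by simpa using hg)
  simp only [Real.norm_eq_abs, Real.rpow_two, sq_abs, ← Real.sqrt_eq_rpow] at h
  simpa only [abs_mul] using h

/-- The affinity `a = ∫ √f √g` is multiplicative over the sample, so Bernoulli's inequality bounds
`1 - a ^ n` by `n (1 - a)`. Factoring `F - G = (√F - √G) (√F + √G)` and applying Cauchy-Schwarz
bounds the `L¹` distance of the product densities by `2 √(2 n (1 - a))`. As `P₁` need not be
dominated by `P₀`, mass outside the product of the sets `A` remains; it equals `1 - ∫ F`, which is
at most the same distance because `∫ G = 1`. The two contributions add up to the constant `4`. -/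
theorem abs_integral_pi_sub_le {Z : Type*} [MeasurableSpace Z] (P₀ P₁ : Measure Z)
    [IsProbabilityMeasure P₀] [IsProbabilityMeasure P₁] {A : Set Z} (hA : MeasurableSet A)
    {f g : Z → ℝ} (hfm : Measurable f) (hgm : Measurable g) (hf0 : ∀ z, 0 ≤ f z)
    (hg0 : ∀ z, 0 ≤ g z) (hf : P₁.restrict A = P₀.withDensity fun z => ENNReal.ofReal (f z))
    (hgi : Integrable g P₀) (hg : ∫ z, g z ∂P₀ = 1) (n : ℕ) {φ : (Fin n → Z) → ℝ}
    (hφm : Measurable φ) {C : ℝ} (hφ : ∀ z, |φ z| ≤ C) :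
    |∫ z, φ z ∂(Measure.pi fun _ : Fin n => P₁) -
      ∫ z, φ z * ∏ i, g (z i) ∂(Measure.pi fun _ : Fin n => P₀)| ≤
      4 * C * √(2 * (n * (1 - ∫ z, √(f z) * √(g z) ∂P₀))) := by
  have hlint : ∫⁻ z, ENNReal.ofReal (f z) ∂P₀ = P₁ A := by
    rw [← Measure.restrict_apply_univ A, hf, withDensity_apply _ MeasurableSet.univ,
      Measure.restrict_univ]
  have hfi : Integrable f P₀ := by
    refine ⟨hfm.aestronglyMeasurable, ?_⟩
    rw [hasFiniteIntegral_iff_ofReal (ae_of_all _ hf0), hlint]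
    exact measure_lt_top _ _
  have hf1 : ∫ z, f z ∂P₀ ≤ 1 := by
    rw [integral_eq_lintegral_of_nonneg_ae (ae_of_all _ hf0) hfm.aestronglyMeasurable, hlint]
    exact measureReal_le_one
  have hsf : MemLp (fun z => √(f z)) 2 P₀ := by
    refine (memLp_two_iff_integrable_sq hfm.sqrt.aestronglyMeasurable).2 ?_
    simpa only [Real.sq_sqrt (hf0 _)] using hfi
  have hsg : MemLp (fun z => √(g z)) 2 P₀ := by
    refine (memLp_two_iff_integrable_sq hgm.sqrt.aestronglyMeasurable).2 ?_
    simpa only [Real.sq_sqrt (hg0 _)] using hgi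
  set a := ∫ z, √(f z) * √(g z) ∂P₀ with ha
  have ha0 : 0 ≤ a := integral_nonneg fun z => mul_nonneg (Real.sqrt_nonneg _) (Real.sqrt_nonneg _)
  set π₀ := Measure.pi fun _ : Fin n => P₀ with hπ₀
  set π₁ := Measure.pi fun _ : Fin n => P₁ with hπ₁
  set F : (Fin n → Z) → ℝ := fun z => ∏ i, f (z i) with hF
  set G : (Fin n → Z) → ℝ := fun z => ∏ i, g (z i) with hG
  have hFm : Measurable F := by fun_prop
  have hGm : Measurable G := by fun_prop
  have hF0 : ∀ z, 0 ≤ F z := fun z => Finset.prod_nonneg fun i _ => hf0 _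
  have hG0 : ∀ z, 0 ≤ G z := fun z => Finset.prod_nonneg fun i _ => hg0 _
  have hFi : Integrable F π₀ := Integrable.fintype_prod fun _ => hfi
  have hGi : Integrable G π₀ := Integrable.fintype_prod fun _ => hgi
  have hFint : ∫ z, F z ∂π₀ = (∫ z, f z ∂P₀) ^ n := by
    rw [hF, hπ₀, integral_fintype_prod_eq_pow]; simp
  have hGint : ∫ z, G z ∂π₀ = 1 := by
    rw [hG, hπ₀, integral_fintype_prod_eq_pow, hg, one_pow]
  have hF1 : ∫ z, F z ∂π₀ ≤ 1 := by
    rw [hFint]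
    exact pow_le_one₀ (integral_nonneg hf0) hf1
  have hsF : MemLp (fun z => √(F z)) 2 π₀ := by
    refine (memLp_two_iff_integrable_sq hFm.sqrt.aestronglyMeasurable).2 ?_
    simpa only [Real.sq_sqrt (hF0 _)] using hFi
  have hsG : MemLp (fun z => √(G z)) 2 π₀ := by
    refine (memLp_two_iff_integrable_sq hGm.sqrt.aestronglyMeasurable).2 ?_
    simpa only [Real.sq_sqrt (hG0 _)] using hGi
  have hFGi : Integrable (fun z => √(F z) * √(G z)) π₀ := hsF.integrable_mul hsG
  have hsqrt : ∀ (u : Z → ℝ), (∀ z, 0 ≤ u z) → ∀ z : Fin n → Z,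
      √(∏ i, u (z i)) = ∏ i, √(u (z i)) := fun u hu z =>
    Real.sqrt_prod _ fun i _ => hu _
  have haff : ∫ z, √(F z) * √(G z) ∂π₀ = a ^ n := by
    have : ∀ z, √(F z) * √(G z) = ∏ i, (√(f (z i)) * √(g (z i))) := fun z => by
      rw [Finset.prod_mul_distrib, hF, hG, hsqrt f hf0, hsqrt g hg0]
    simp_rw [this]
    rw [hπ₀, integral_fintype_prod_eq_pow (fun z => √(f z) * √(g z))]
    simp [ha]
  have hbern : 1 - a ^ n ≤ n * (1 - a) := by
    have := one_add_mul_le_pow (a := a - 1) (by linarith) n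
    rw [add_sub_cancel] at this
    linarith
  have e1 : ∫ z, (√(F z) - √(G z)) ^ 2 ∂π₀ = ∫ z, F z ∂π₀ + 1 - 2 * a ^ n := by
    have : ∀ z, (√(F z) - √(G z)) ^ 2 = (F z + G z) - 2 * (√(F z) * √(G z)) := fun z => by
      rw [sub_sq, Real.sq_sqrt (hF0 z), Real.sq_sqrt (hG0 z)]; ring
    simp_rw [this]
    rw [integral_sub (hFi.fun_add hGi) (hFGi.const_mul 2), integral_add hFi hGi,
      integral_const_mul, haff, hGint]
  have e2 : ∫ z, (√(F z) + √(G z)) ^ 2 ∂π₀ ≤ 4 := by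
    have : ∀ z, (√(F z) + √(G z)) ^ 2 = 2 * (F z + G z) - (√(F z) - √(G z)) ^ 2 := fun z => by
      rw [sub_sq, add_sq, Real.sq_sqrt (hF0 z), Real.sq_sqrt (hG0 z)]; ring
    have hi : Integrable (fun z => (√(F z) - √(G z)) ^ 2) π₀ := (hsF.sub hsG).integrable_sq
    simp_rw [this]
    rw [integral_sub ((hFi.fun_add hGi).const_mul 2) hi,
      integral_const_mul, integral_add hFi hGi, hGint]
    have : 0 ≤ ∫ z, (√(F z) - √(G z)) ^ 2 ∂π₀ := integral_nonneg fun z => sq_nonneg _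
    linarith
  have hL1 : ∫ z, |F z - G z| ∂π₀ ≤ 2 * √(2 * (n * (1 - a))) := by
    have h := abs_integral_mul_le_sqrt (hsF.sub hsG) (hsF.add hsG)
    have e : ∀ z, (√(F z) - √(G z)) * (√(F z) + √(G z)) = F z - G z := fun z => by
      have h1 := Real.sq_sqrt (hF0 z)
      have h2 := Real.sq_sqrt (hG0 z)
      linear_combination h1 - h2
    simp only [Pi.sub_apply, Pi.add_apply, e] at h
    refine h.trans ?_
    rw [mul_comm 2 (√_)]
    refine mul_le_mul (Real.sqrt_le_sqrt ?_) ?_ (Real.sqrt_nonneg _) (Real.sqrt_nonneg _)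
    · rw [e1]; linarith
    · rw [show (2 : ℝ) = √4 by
        rw [show (4 : ℝ) = 2 ^ 2 by norm_num, Real.sqrt_sq (by norm_num)]]
      exact Real.sqrt_le_sqrt e2
  set B : Set (Fin n → Z) := Set.univ.pi fun _ => A with hB
  have hBm : MeasurableSet B := MeasurableSet.univ_pi fun _ => hA
  have hres : π₁.restrict B = π₀.withDensity fun z => ENNReal.ofReal (F z) := by
    have : SigmaFinite (P₀.withDensity fun z => ENNReal.ofReal (f z)) := by
      rw [← hf]; infer_instance
    rw [hB, hπ₁, Measure.restrict_pi_pi]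
    simp_rw [hf]
    rw [Measure.pi_withDensity (fun _ => P₀) (fun _ z => ENNReal.ofReal (f z))
      fun _ => hfm.ennreal_ofReal]
    simp_rw [hF, ENNReal.ofReal_prod_of_nonneg fun i _ => hf0 _]
    rfl
  have hC0 : 0 ≤ C := by
    have : Nonempty Z := P₀.nonempty_of_neZero
    exact (abs_nonneg _).trans (hφ fun _ => Classical.arbitrary Z)
  have hφi : Integrable φ π₁ := Integrable.of_bound hφm.aestronglyMeasurable C (ae_of_all _ hφ)
  have hresint : ∀ ψ : (Fin n → Z) → ℝ, ∫ z in B, ψ z ∂π₁ = ∫ z, ψ z * F z ∂π₀ := fun ψ => by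
    rw [hres, integral_withDensity_eq_integral_toReal_smul hFm.ennreal_ofReal (by simp)]
    refine integral_congr_ae (ae_of_all _ fun z => ?_)
    simp [ENNReal.toReal_ofReal (hF0 z), mul_comm]
  have hBF : π₁.real B = ∫ z, F z ∂π₀ := by
    have := hresint fun _ => 1
    simpa using this
  have hcompl : |∫ z in Bᶜ, φ z ∂π₁| ≤ C * (1 - ∫ z, F z ∂π₀) := by
    have h := norm_setIntegral_le_of_norm_le_const (μ := π₁) (s := Bᶜ) (f := φ) (C := C)
      (measure_lt_top _ _) (fun z _ => hφ z)
    rw [probReal_compl_eq_one_sub hBm, hBF] at h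
    exact h
  have hFG : Integrable (fun z => |F z - G z|) π₀ := (hFi.fun_sub hGi).abs
  have hdef : 1 - ∫ z, F z ∂π₀ ≤ ∫ z, |F z - G z| ∂π₀ := by
    rw [← hGint, ← integral_sub hGi hFi]
    exact integral_mono (hGi.fun_sub hFi) hFG fun z => by
      rw [abs_sub_comm]; exact le_abs_self _
  have hφF : Integrable (fun z => φ z * F z) π₀ := hFi.bdd_mul hφm.aestronglyMeasurable (ae_of_all _ hφ)
  have hφG : Integrable (fun z => φ z * G z) π₀ := hGi.bdd_mul hφm.aestronglyMeasurable (ae_of_all _ hφ)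
  have hdiff : |∫ z, φ z * F z ∂π₀ - ∫ z, φ z * G z ∂π₀| ≤ C * ∫ z, |F z - G z| ∂π₀ := by
    rw [← integral_sub hφF hφG, ← integral_const_mul, ← Real.norm_eq_abs]
    refine norm_integral_le_of_norm_le (hFG.const_mul C) (ae_of_all _ fun z => ?_)
    rw [← mul_sub, norm_mul]
    exact mul_le_mul_of_nonneg_right (hφ z) (norm_nonneg _)
  have hsplit : ∫ z, φ z ∂π₁ = ∫ z, φ z * F z ∂π₀ + ∫ z in Bᶜ, φ z ∂π₁ := by
    rw [← hresint, integral_add_compl hBm hφi]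
  rw [hsplit]
  calc |∫ z, φ z * F z ∂π₀ + ∫ z in Bᶜ, φ z ∂π₁ - ∫ z, φ z * G z ∂π₀|
      ≤ |∫ z, φ z * F z ∂π₀ - ∫ z, φ z * G z ∂π₀| + |∫ z in Bᶜ, φ z ∂π₁| := by
        rw [add_sub_right_comm]; exact abs_add_le _ _
    _ ≤ C * (2 * √(2 * (n * (1 - a)))) + C * (2 * √(2 * (n * (1 - a)))) :=
        add_le_add (hdiff.trans (mul_le_mul_of_nonneg_left hL1 hC0))
          (hcompl.trans (mul_le_mul_of_nonneg_left (hdef.trans hL1) hC0))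
    _ = _ := by ring

/-! ### Differentiability in quadratic mean -/

namespace LimitExperiment

/-- A dominated model that is differentiable in quadratic mean at an interior point. -/
structure IsRegularModel {m : ℕ} {𝒵 : Type*} [MeasurableSpace 𝒵] (μ : Measure 𝒵)
    (Θ : Set (EuclideanSpace ℝ (Fin m))) (p : EuclideanSpace ℝ (Fin m) → 𝒵 → ℝ)
    (θ₀ : EuclideanSpace ℝ (Fin m)) (s : 𝒵 → EuclideanSpace ℝ (Fin m)) : Prop where
  density : IsDensityFamily μ Θ p
  mem_interior : θ₀ ∈ interior Θ
  dqm : IsDQM μ p θ₀ s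

/-! ### Densities and their square roots as square integrable functions. -/

section Density

variable {m : ℕ} {𝒵 : Type*} [MeasurableSpace 𝒵] {μ : Measure 𝒵}
  {Θ : Set (EuclideanSpace ℝ (Fin m))} {p : EuclideanSpace ℝ (Fin m) → 𝒵 → ℝ}
  {θ : EuclideanSpace ℝ (Fin m)}

theorem IsDensityFamily.isProbabilityMeasure (hp : IsDensityFamily μ Θ p) (hθ : θ ∈ Θ) :
    IsProbabilityMeasure (obsLaw μ p θ) :=
  ⟨by rw [obsLaw, withDensity_apply _ MeasurableSet.univ, Measure.restrict_univ,
    hp.lintegral_eq_one θ hθ]⟩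

theorem IsDensityFamily.integral_obsLaw (hp : IsDensityFamily μ Θ p) (hθ : θ ∈ Θ) (f : 𝒵 → ℝ) :
    ∫ z, f z ∂(obsLaw μ p θ) = ∫ z, p θ z * f z ∂μ := by
  rw [obsLaw, integral_withDensity_eq_integral_toReal_smul
    (hp.measurable θ hθ).ennreal_ofReal (by simp)]
  simp [ENNReal.toReal_ofReal (hp.nonneg θ hθ _)]

theorem IsDensityFamily.integrable_obsLaw_iff (hp : IsDensityFamily μ Θ p) (hθ : θ ∈ Θ)
    {f : 𝒵 → ℝ} : Integrable f (obsLaw μ p θ) ↔ Integrable (fun z => p θ z * f z) μ := by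
  rw [obsLaw, integrable_withDensity_iff_integrable_smul'
    (hp.measurable θ hθ).ennreal_ofReal (by simp)]
  simp [ENNReal.toReal_ofReal (hp.nonneg θ hθ _)]

theorem IsDensityFamily.integrable (hp : IsDensityFamily μ Θ p) (hθ : θ ∈ Θ) :
    Integrable (p θ) μ := by
  refine ⟨(hp.measurable θ hθ).aestronglyMeasurable, ?_⟩
  rw [hasFiniteIntegral_iff_ofReal (ae_of_all _ (hp.nonneg θ hθ)), hp.lintegral_eq_one θ hθ]
  exact ENNReal.one_lt_top

theorem IsDensityFamily.integral_eq_one (hp : IsDensityFamily μ Θ p) (hθ : θ ∈ Θ) :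
    ∫ z, p θ z ∂μ = 1 := by
  rw [integral_eq_lintegral_of_nonneg_ae (ae_of_all _ (hp.nonneg θ hθ))
    (hp.measurable θ hθ).aestronglyMeasurable, hp.lintegral_eq_one θ hθ]
  rfl

theorem IsDensityFamily.memLp_sqrt (hp : IsDensityFamily μ Θ p) (hθ : θ ∈ Θ) :
    MemLp (fun z => √(p θ z)) 2 μ := by
  refine (memLp_two_iff_integrable_sq (hp.measurable θ hθ).sqrt.aestronglyMeasurable).2 ?_
  simpa only [Real.sq_sqrt (hp.nonneg θ hθ _)] using hp.integrable hθ

end Density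

/-! ### Square integrability and centring of the score. -/

section RegularModel

variable {m : ℕ} {𝒵 : Type*} [MeasurableSpace 𝒵] {μ : Measure 𝒵}
  {Θ : Set (EuclideanSpace ℝ (Fin m))} {p : EuclideanSpace ℝ (Fin m) → 𝒵 → ℝ}
  {θ₀ : EuclideanSpace ℝ (Fin m)} {s : 𝒵 → EuclideanSpace ℝ (Fin m)}

theorem IsRegularModel.mem (hM : IsRegularModel μ Θ p θ₀ s) : θ₀ ∈ Θ :=
  interior_subset hM.mem_interior

theorem IsRegularModel.measurable_inner (hM : IsRegularModel μ Θ p θ₀ s)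
    (h : EuclideanSpace ℝ (Fin m)) : Measurable fun z => inner ℝ h (s z) :=
  (continuous_const.inner continuous_id).measurable.comp hM.dqm.measurable_score

theorem IsRegularModel.measurable_remainder (hM : IsRegularModel μ Θ p θ₀ s)
    {h : EuclideanSpace ℝ (Fin m)} (hh : θ₀ + h ∈ Θ) : Measurable (dqmRemainder p θ₀ s h) := by
  have h1 := hM.density.measurable _ hh
  have h2 := hM.density.measurable _ hM.mem
  have h3 := hM.measurable_inner h
  unfold dqmRemainder
  fun_prop

theorem IsRegularModel.eventually_mem (hM : IsRegularModel μ Θ p θ₀ s) :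
    ∀ᶠ h in 𝓝 0, θ₀ + h ∈ Θ := by
  have : Tendsto (fun h => θ₀ + h) (𝓝 0) (𝓝 θ₀) := by
    simpa using (continuous_const.add continuous_id).tendsto (0 : EuclideanSpace ℝ (Fin m))
      (f := fun h => θ₀ + h)
  exact this.eventually (mem_interior_iff_mem_nhds.1 hM.mem_interior)

theorem IsRegularModel.eventually_memLp (hM : IsRegularModel μ Θ p θ₀ s) :
    ∀ᶠ h in 𝓝 0, θ₀ + h ∈ Θ ∧ MemLp (dqmRemainder p θ₀ s h) 2 μ := by
  filter_upwards [hM.eventually_mem, hM.dqm.integrable] with h h1 h2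
  exact ⟨h1, (memLp_two_iff_integrable_sq (hM.measurable_remainder h1).aestronglyMeasurable).2 h2⟩

/-- Finite Fisher information is a consequence of differentiability. For one small `c > 0`, `(c / 2)
h's √p(θ₀)` is the difference of two square root densities minus a square integrable remainder. -/
theorem IsRegularModel.memLp_inner_mul_sqrt (hM : IsRegularModel μ Θ p θ₀ s)
    (h : EuclideanSpace ℝ (Fin m)) :
    MemLp (fun z => inner ℝ h (s z) * √(p θ₀ z)) 2 μ := by
  have ht : Tendsto (fun c : ℝ => c • h) (𝓝[>] 0) (𝓝 0) := by
    have : Tendsto (fun c : ℝ => c • h) (𝓝 0) (𝓝 ((0 : ℝ) • h)) :=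
      (continuous_id.smul continuous_const).tendsto (0 : ℝ)
    rw [zero_smul] at this
    exact this.mono_left nhdsWithin_le_nhds
  obtain ⟨c, ⟨hc1, hc2⟩, hc0⟩ :=
    ((ht.eventually hM.eventually_memLp).and self_mem_nhdsWithin).exists
  have hc : c ≠ 0 := ne_of_gt hc0
  have h1 := ((hM.density.memLp_sqrt hc1).sub (hM.density.memLp_sqrt hM.mem)).sub hc2
  have h2 := h1.const_mul (2 / c)
  refine h2.congr_norm ?_ (ae_of_all _ fun z => ?_)
  · exact ((hM.measurable_inner h).mul
      (hM.density.measurable _ hM.mem).sqrt).aestronglyMeasurable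
  · congr 1
    simp only [Pi.sub_apply, dqmRemainder, inner_smul_left, RCLike.conj_to_real]
    field_simp
    ring

theorem IsRegularModel.memLp_inner (hM : IsRegularModel μ Θ p θ₀ s)
    (h : EuclideanSpace ℝ (Fin m)) :
    MemLp (fun z => inner ℝ h (s z)) 2 (obsLaw μ p θ₀) := by
  refine (memLp_two_iff_integrable_sq (hM.measurable_inner h).aestronglyMeasurable).2 ?_
  rw [hM.density.integrable_obsLaw_iff hM.mem]
  refine (hM.memLp_inner_mul_sqrt h).integrable_sq.congr (ae_of_all _ fun z => ?_)
  simp only [mul_pow, Real.sq_sqrt (hM.density.nonneg _ hM.mem z)]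
  ring

theorem IsRegularModel.memLp_score (hM : IsRegularModel μ Θ p θ₀ s) :
    MemLp s 2 (obsLaw μ p θ₀) := by
  rw [← memLp_norm_iff hM.dqm.measurable_score.aestronglyMeasurable]
  refine (memLp_two_iff_integrable_sq hM.dqm.measurable_score.norm.aestronglyMeasurable).2 ?_
  simp_rw [EuclideanSpace.real_norm_sq_eq]
  refine integrable_finsetSum _ fun i _ => ?_
  refine (hM.memLp_inner (EuclideanSpace.single i 1)).integrable_sq.congr
    (ae_of_all _ fun z => ?_)
  simp [EuclideanSpace.inner_single_left]

/-! ### Local sequences -/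

theorem tendsto_inv_sqrt_nat : Tendsto (fun n : ℕ => (√(n : ℝ))⁻¹) atTop (𝓝 0) :=
  tendsto_inv_atTop_zero.comp (Real.tendsto_sqrt_atTop.comp tendsto_natCast_atTop_atTop)

theorem tendsto_inv_sqrt_nat_smul (h : EuclideanSpace ℝ (Fin m)) :
    Tendsto (fun n : ℕ => (√(n : ℝ))⁻¹ • h) atTop (𝓝 0) := by
  simpa using tendsto_inv_sqrt_nat.smul_const h

theorem IsRegularModel.tendsto_remainder (hM : IsRegularModel μ Θ p θ₀ s)
    (h : EuclideanSpace ℝ (Fin m)) :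
    Tendsto (fun n : ℕ => (n : ℝ) * ∫ z, dqmRemainder p θ₀ s ((√(n : ℝ))⁻¹ • h) z ^ 2 ∂μ) atTop
      (𝓝 0) := by
  have h1 := hM.dqm.isLittleO.comp_tendsto (tendsto_inv_sqrt_nat_smul h)
  have h2 : (fun n : ℕ => ‖(√(n : ℝ))⁻¹ • h‖ ^ 2) =O[atTop] fun n : ℕ => (n : ℝ)⁻¹ := by
    refine Asymptotics.IsBigO.of_bound (‖h‖ ^ 2) (Eventually.of_forall fun n => ?_)
    rw [Real.norm_of_nonneg (by positivity), Real.norm_of_nonneg (by positivity), norm_smul,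
      mul_pow, norm_inv, inv_pow, Real.norm_eq_abs, sq_abs, Real.sq_sqrt (Nat.cast_nonneg n),
      mul_comm]
  have h3 := h1.trans_isBigO h2
  rw [Asymptotics.isLittleO_iff_tendsto'] at h3
  · refine h3.congr fun n => ?_
    simp only [Function.comp_apply, div_inv_eq_mul, mul_comm]
  · filter_upwards [eventually_ne_atTop 0] with n hn h0
    exact absurd (inv_eq_zero.1 h0) (by exact_mod_cast hn)

theorem IsRegularModel.eventually_memLp_local (hM : IsRegularModel μ Θ p θ₀ s)
    (h : EuclideanSpace ℝ (Fin m)) :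
    ∀ᶠ n : ℕ in atTop, localParam θ₀ h n ∈ Θ ∧
      MemLp (dqmRemainder p θ₀ s ((√(n : ℝ))⁻¹ • h)) 2 μ :=
  (tendsto_inv_sqrt_nat_smul h).eventually hM.eventually_memLp

/-- Let `g` be the increment of the square root density and `a = √p(θ₀)`. Both densities have
integral one, so `∫ g² + 2 ∫ g a = 0`. Here `∫ g²` is `O(1 / n)`, and `∫ g a` is `τ / 2` times the
mean of the score in the direction `h`, up to `o(1 / √n)`. Multiplication by `√n = 1 / τ` forces
that mean to vanish. -/
theorem IsRegularModel.integral_inner_eq_zero (hM : IsRegularModel μ Θ p θ₀ s)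
    (h : EuclideanSpace ℝ (Fin m)) : ∫ z, inner ℝ h (s z) ∂(obsLaw μ p θ₀) = 0 := by
  set q : ℕ → ℝ := fun n => ∫ z, dqmRemainder p θ₀ s ((√(n : ℝ))⁻¹ • h) z ^ 2 ∂μ with hq
  set J := ∫ z, inner ℝ h (s z) ^ 2 ∂(obsLaw μ p θ₀) with hJ
  set e := ∫ z, inner ℝ h (s z) ∂(obsLaw μ p θ₀) with he
  have hM0 := hM.mem
  have hp0 := hM.density.nonneg _ hM0
  have ht := hM.tendsto_remainder h
  -- the expansion of the identity that the densities have equal integrals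
  have key : ∀ᶠ n : ℕ in atTop, |e| ≤ 1 / 2 * J * (√(n : ℝ))⁻¹ +
      2 * (n * q n) * (√(n : ℝ))⁻¹ + 2 * √(n * q n) := by
    filter_upwards [hM.eventually_memLp_local h, eventually_gt_atTop 0] with n ⟨hn1, hn2⟩ hn0
    set τ : ℝ := (√(n : ℝ))⁻¹ with hτ
    replace hn1 : θ₀ + τ • h ∈ Θ := hn1
    have hn0' : (0 : ℝ) < n := by exact_mod_cast hn0
    have hsq : 0 < √(n : ℝ) := Real.sqrt_pos.2 hn0'
    have hτ0 : 0 < τ := by positivity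
    set a : 𝒵 → ℝ := fun z => √(p θ₀ z) with ha
    set r := dqmRemainder p θ₀ s (τ • h) with hr
    set u : 𝒵 → ℝ := fun z => inner ℝ h (s z) * a z with hu
    have haL : MemLp a 2 μ := hM.density.memLp_sqrt hM0
    have huL : MemLp u 2 μ := hM.memLp_inner_mul_sqrt h
    set g : 𝒵 → ℝ := fun z => √(p (θ₀ + τ • h) z) - a z with hg
    have hgL : MemLp g 2 μ := (hM.density.memLp_sqrt hn1).sub haL
    have hgr : ∀ z, g z = τ / 2 * u z + r z := fun z => by
      simp only [hg, hr, hu, dqmRemainder, inner_smul_left, RCLike.conj_to_real, ha]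
      ring
    have hea : e = ∫ z, u z * a z ∂μ := by
      rw [he, hM.density.integral_obsLaw hM0]
      refine integral_congr_ae (ae_of_all _ fun z => ?_)
      simp only [hu, ha, mul_assoc, Real.mul_self_sqrt (hp0 z)]
      ring
    have hJu : J = ∫ z, u z ^ 2 ∂μ := by
      rw [hJ, hM.density.integral_obsLaw hM0]
      refine integral_congr_ae (ae_of_all _ fun z => ?_)
      simp only [hu, ha, mul_pow, Real.sq_sqrt (hp0 z)]
      ring
    have ha1 : ∫ z, a z ^ 2 ∂μ = 1 := by
      simp only [ha, Real.sq_sqrt (hp0 _)]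
      exact hM.density.integral_eq_one hM0
    have h0 : ∫ z, g z ^ 2 ∂μ + 2 * ∫ z, g z * a z ∂μ = 0 := by
      have h1 : ∫ z, (g z + a z) ^ 2 ∂μ = 1 := by
        simp only [hg, sub_add_cancel, Real.sq_sqrt (hM.density.nonneg _ hn1 _)]
        exact hM.density.integral_eq_one hn1
      have h2 : ∀ z, (g z + a z) ^ 2 = (g z ^ 2 + 2 * (g z * a z)) + a z ^ 2 := fun z => by ring
      simp_rw [h2] at h1
      have hga : Integrable (fun z => g z * a z) μ := hgL.integrable_mul haL
      rw [integral_add (hgL.integrable_sq.fun_add (hga.const_mul 2)) haL.integrable_sq,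
        integral_add hgL.integrable_sq (hga.const_mul 2), integral_const_mul, ha1] at h1
      linarith
    have h1 : ∫ z, g z * a z ∂μ = τ / 2 * e + ∫ z, r z * a z ∂μ := by
      have hua : Integrable (fun z => u z * a z) μ := huL.integrable_mul haL
      have hra : Integrable (fun z => r z * a z) μ := hn2.integrable_mul haL
      rw [hea, ← integral_const_mul, ← integral_add (hua.const_mul _) hra]
      refine integral_congr_ae (ae_of_all _ fun z => ?_)
      simp only [hgr]
      ring
    -- From `(x + y)² ≤ 2 x² + 2 y²` with `x = (τ / 2) u` and `y = r`.
    have h2 : ∫ z, g z ^ 2 ∂μ ≤ 1 / 2 * τ ^ 2 * J + 2 * q n := by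
      rw [hJu, hq, ← integral_const_mul, ← integral_const_mul,
        ← integral_add (huL.integrable_sq.const_mul _) (hn2.integrable_sq.const_mul _)]
      refine integral_mono hgL.integrable_sq
        ((huL.integrable_sq.const_mul _).fun_add (hn2.integrable_sq.const_mul _)) fun z => ?_
      simp only [hgr]
      have : 0 ≤ (τ / 2 * u z - r z) ^ 2 := sq_nonneg _
      change (τ / 2 * u z + r z) ^ 2 ≤ 1 / 2 * τ ^ 2 * u z ^ 2 + 2 * r z ^ 2
      nlinarith
    have h3 : |∫ z, r z * a z ∂μ| ≤ √(q n) := by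
      refine abs_integral_le_integral_abs.trans ((abs_integral_mul_le_sqrt hn2 haL).trans ?_)
      rw [ha1, Real.sqrt_one, mul_one]
    have h4 : 0 ≤ ∫ z, g z ^ 2 ∂μ := integral_nonneg fun z => sq_nonneg _
    have h5 : τ * |e| ≤ (1 / 2 * τ ^ 2 * J + 2 * q n) + 2 * √(q n) := by
      have : τ * e = -(∫ z, g z ^ 2 ∂μ) - 2 * ∫ z, r z * a z ∂μ := by
        rw [h1] at h0; linarith
      rw [← abs_of_pos hτ0, ← abs_mul, this, abs_of_pos hτ0]
      rw [abs_le] at h3 ⊢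
      constructor <;> linarith [h3.1, h3.2]
    have h6 : √(n : ℝ) * τ = 1 := by rw [hτ]; exact mul_inv_cancel₀ hsq.ne'
    have h7 : (n : ℝ) * τ = √(n : ℝ) := by
      nth_rw 1 [← Real.mul_self_sqrt hn0'.le]
      rw [mul_assoc, h6, mul_one]
    calc |e| = √(n : ℝ) * (τ * |e|) := by rw [← mul_assoc, h6, one_mul]
      _ ≤ √(n : ℝ) * ((1 / 2 * τ ^ 2 * J + 2 * q n) + 2 * √(q n)) := by gcongr
      _ = 1 / 2 * J * ((√(n : ℝ) * τ) * τ) + 2 * (√(n : ℝ) * q n) +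
          2 * (√(n : ℝ) * √(q n)) := by ring
      _ = _ := by
        rw [h6, one_mul, Real.sqrt_mul hn0'.le, ← h7]
        ring
  have hlim : Tendsto (fun n : ℕ => 1 / 2 * J * (√(n : ℝ))⁻¹ +
      2 * (n * q n) * (√(n : ℝ))⁻¹ + 2 * √(n * q n)) atTop (𝓝 0) := by
    have h1 := tendsto_inv_sqrt_nat.const_mul (1 / 2 * J)
    have h2 := (ht.const_mul 2).mul tendsto_inv_sqrt_nat
    have h3 := ((Real.continuous_sqrt.tendsto 0).comp ht).const_mul 2
    rw [Real.sqrt_zero] at h3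
    simpa using (h1.add h2).add h3
  have : |e| ≤ 0 := ge_of_tendsto hlim key
  exact abs_eq_zero.1 (le_antisymm this (abs_nonneg _))

end RegularModel

end LimitExperiment

namespace LimitExperiment

/-! ### Truncated and centred scores -/

section Truncation

variable {m : ℕ} {Z : Type*} [MeasurableSpace Z]

open Classical in
/-- The score `s` truncated at the level `n ^ (1 / 4)`. -/
noncomputable def truncScore (s : Z → EuclideanSpace ℝ (Fin m)) (n : ℕ) (z : Z) :
    EuclideanSpace ℝ (Fin m) := if ‖s z‖ ≤ √√(n : ℝ) then s z else 0

/-- The score truncated at the level `n ^ (1 / 4)` and centred under `P`. -/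
noncomputable def centredScore (P : Measure Z) (s : Z → EuclideanSpace ℝ (Fin m)) (n : ℕ) (z : Z) :
    EuclideanSpace ℝ (Fin m) := truncScore s n z - ∫ w, truncScore s n w ∂P

variable {P : Measure Z} [IsProbabilityMeasure P] {s : Z → EuclideanSpace ℝ (Fin m)}

theorem measurable_truncScore (hs : Measurable s) (n : ℕ) : Measurable (truncScore s n) :=
  Measurable.ite (measurableSet_le hs.norm measurable_const) hs measurable_const

theorem measurable_centredScore (P : Measure Z) (hs : Measurable s) (n : ℕ) :
    Measurable (centredScore P s n) := (measurable_truncScore hs n).sub measurable_const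

omit [MeasurableSpace Z] in
theorem norm_truncScore_le (n : ℕ) (z : Z) : ‖truncScore s n z‖ ≤ √√(n : ℝ) := by
  unfold truncScore
  split_ifs with h
  · exact h
  · simp

omit [MeasurableSpace Z] in
theorem norm_truncScore_le_norm (n : ℕ) (z : Z) : ‖truncScore s n z‖ ≤ ‖s z‖ := by
  unfold truncScore
  split_ifs with h
  · exact le_rfl
  · simp

theorem integrable_truncScore (hs : Measurable s) (n : ℕ) : Integrable (truncScore s n) P :=
  Integrable.of_bound (measurable_truncScore hs n).aestronglyMeasurable _
    (ae_of_all _ (norm_truncScore_le n))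

theorem norm_centredScore_le (n : ℕ) (z : Z) : ‖centredScore P s n z‖ ≤ 2 * √√(n : ℝ) := by
  have h : ‖∫ w, truncScore s n w ∂P‖ ≤ √√(n : ℝ) := by
    refine (norm_integral_le_of_norm_le_const (ae_of_all _ (norm_truncScore_le n))).trans ?_
    simp
  calc _ ≤ ‖truncScore s n z‖ + ‖∫ w, truncScore s n w ∂P‖ := norm_sub_le _ _
    _ ≤ √√(n : ℝ) + √√(n : ℝ) := add_le_add (norm_truncScore_le n z) h
    _ = _ := by ring

/-- An envelope that does not depend on `n`, for dominated convergence. -/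
theorem norm_centredScore_le_add (hs2 : MemLp s 2 P) (n : ℕ) (z : Z) :
    ‖centredScore P s n z‖ ≤ ‖s z‖ + ∫ w, ‖s w‖ ∂P := by
  have hi : Integrable s P := hs2.integrable (by norm_num)
  have h : ‖∫ w, truncScore s n w ∂P‖ ≤ ∫ w, ‖s w‖ ∂P :=
    norm_integral_le_of_norm_le hi.norm (ae_of_all _ (norm_truncScore_le_norm n))
  exact (norm_sub_le _ _).trans (add_le_add (norm_truncScore_le_norm n z) h)

theorem tendsto_sqrt_sqrt_nat : Tendsto (fun n : ℕ => √√(n : ℝ)) atTop atTop :=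
  Real.tendsto_sqrt_atTop.comp (Real.tendsto_sqrt_atTop.comp tendsto_natCast_atTop_atTop)

omit [MeasurableSpace Z] in
theorem tendsto_truncScore (z : Z) : Tendsto (fun n => truncScore s n z) atTop (𝓝 (s z)) := by
  refine tendsto_nhds_of_eventually_eq ?_
  filter_upwards [tendsto_sqrt_sqrt_nat.eventually_ge_atTop ‖s z‖] with n hn
  rw [truncScore, if_pos hn]

/-- The centring constant tends to the mean of the score, which is zero. -/
theorem tendsto_centredScore (hs : Measurable s) (hs2 : MemLp s 2 P) (hs0 : ∫ z, s z ∂P = 0)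
    (z : Z) : Tendsto (fun n => centredScore P s n z) atTop (𝓝 (s z)) := by
  have h : Tendsto (fun n => ∫ w, truncScore s n w ∂P) atTop (𝓝 (∫ w, s w ∂P)) :=
    tendsto_integral_of_dominated_convergence (fun w => ‖s w‖)
      (fun n => (measurable_truncScore hs n).aestronglyMeasurable)
      (hs2.integrable (by norm_num)).norm (fun n => ae_of_all _ (norm_truncScore_le_norm n))
      (ae_of_all _ tendsto_truncScore)
  rw [hs0] at h
  have h2 := (tendsto_truncScore (s := s) z).sub h
  rw [sub_zero] at h2
  exact h2

theorem integral_inner_centredScore (hs : Measurable s) (h : EuclideanSpace ℝ (Fin m)) (n : ℕ) :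
    ∫ z, inner ℝ h (centredScore P s n z) ∂P = 0 := by
  have hi := integrable_truncScore (P := P) hs n
  have hc : Integrable (centredScore P s n) P := hi.fun_sub (integrable_const _)
  rw [integral_inner hc]
  have : ∫ z, centredScore P s n z ∂P = 0 := by
    unfold centredScore
    rw [integral_sub hi (integrable_const _)]
    simp
  rw [this, inner_zero_right]

theorem integrable_norm_add_sq (hs2 : MemLp s 2 P) (c : ℝ) :
    Integrable (fun z => (‖s z‖ + c) ^ 2) P :=
  (hs2.norm.add (memLp_const c)).integrable_sq

theorem tendsto_integral_inner_centredScore_sq (hs : Measurable s) (hs2 : MemLp s 2 P)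
    (hs0 : ∫ z, s z ∂P = 0) (h : EuclideanSpace ℝ (Fin m)) :
    Tendsto (fun n => ∫ z, inner ℝ h (centredScore P s n z) ^ 2 ∂P) atTop
      (𝓝 (∫ z, inner ℝ h (s z) ^ 2 ∂P)) := by
  set K := ∫ w, ‖s w‖ ∂P with hK
  refine tendsto_integral_of_dominated_convergence (fun z => ‖h‖ ^ 2 * (‖s z‖ + K) ^ 2)
    (fun n => ?_) ((integrable_norm_add_sq hs2 K).const_mul _)
    (fun n => ae_of_all _ fun z => ?_) (ae_of_all _ fun z => ?_)
  · have := measurable_centredScore P hs n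
    exact Measurable.aestronglyMeasurable (by fun_prop)
  · rw [norm_pow, ← mul_pow]
    refine pow_le_pow_left₀ (norm_nonneg _) ((norm_inner_le_norm _ _).trans ?_) 2
    exact mul_le_mul_of_nonneg_left (norm_centredScore_le_add hs2 n z) (norm_nonneg _)
  · exact (tendsto_const_nhds.inner (tendsto_centredScore hs hs2 hs0 z)).pow 2

theorem tendsto_integral_inner_sub_sq (hs : Measurable s) (hs2 : MemLp s 2 P)
    (hs0 : ∫ z, s z ∂P = 0) (h : EuclideanSpace ℝ (Fin m)) :
    Tendsto (fun n => ∫ z, inner ℝ h (s z - centredScore P s n z) ^ 2 ∂P) atTop (𝓝 0) := by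
  set K := ∫ w, ‖s w‖ ∂P with hK
  have hz : ∫ z, (0 : ℝ) ∂P = 0 := by simp
  rw [← hz]
  refine tendsto_integral_of_dominated_convergence (fun z => ‖h‖ ^ 2 * (2 * (‖s z‖ + K)) ^ 2)
    (fun n => ?_) ?_ (fun n => ae_of_all _ fun z => ?_) (ae_of_all _ fun z => ?_)
  · have := measurable_centredScore P hs n
    exact Measurable.aestronglyMeasurable (by fun_prop)
  · simp_rw [mul_pow]
    exact ((integrable_norm_add_sq hs2 K).const_mul _).const_mul _
  · rw [norm_pow, ← mul_pow]
    refine pow_le_pow_left₀ (norm_nonneg _) ((norm_inner_le_norm _ _).trans ?_) 2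
    refine mul_le_mul_of_nonneg_left ((norm_sub_le _ _).trans ?_) (norm_nonneg _)
    have h1 := norm_centredScore_le_add hs2 n z
    have h2 : 0 ≤ K := integral_nonneg fun _ => norm_nonneg _
    linarith
  · have h1 : Tendsto (fun n => s z - centredScore P s n z) atTop (𝓝 (s z - s z)) :=
      tendsto_const_nhds.sub (tendsto_centredScore hs hs2 hs0 z)
    have h2 := (Tendsto.inner (𝕜 := ℝ) (tendsto_const_nhds (x := h)) h1).pow 2
    simpa using h2

/-- The level `n ^ (1 / 4)` is small against `√n`, so the normalized scores are uniformly of order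
`n ^ (-1 / 4)`; it still tends to infinity, so the limiting variance is that of the untruncated
score. -/
theorem isSmallArray_centredScore (hs : Measurable s) (hs2 : MemLp s 2 P)
    (hs0 : ∫ z, s z ∂P = 0) (h : EuclideanSpace ℝ (Fin m)) :
    IsSmallArray P (fun n z => (√(n : ℝ))⁻¹ * inner ℝ h (centredScore P s n z))
      (fun n => 2 * ‖h‖ * (√√(n : ℝ))⁻¹) (∫ z, inner ℝ h (s z) ^ 2 ∂P) where
  measurable n := by
    have := measurable_centredScore P hs n
    fun_prop
  tendsto_bound := by
    simpa using (tendsto_inv_atTop_zero.comp tendsto_sqrt_sqrt_nat).const_mul (2 * ‖h‖)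
  abs_le n z := by
    have h1 : |(inner ℝ h (centredScore P s n z) : ℝ)| ≤ ‖h‖ * (2 * √√(n : ℝ)) :=
      (abs_real_inner_le_norm _ _).trans
        (mul_le_mul_of_nonneg_left (norm_centredScore_le n z) (norm_nonneg _))
    have h2 : (√(n : ℝ))⁻¹ * √√(n : ℝ) = (√√(n : ℝ))⁻¹ := by
      rcases eq_or_ne (√√(n : ℝ)) 0 with h0 | h0
      · simp [h0]
      · refine eq_inv_of_mul_eq_one_left ?_
        rw [mul_assoc, Real.mul_self_sqrt (Real.sqrt_nonneg _)]
        refine inv_mul_cancel₀ fun h => h0 ?_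
        rw [h, Real.sqrt_zero]
    rw [abs_mul, abs_of_nonneg (by positivity : (0 : ℝ) ≤ (√(n : ℝ))⁻¹)]
    calc _ ≤ (√(n : ℝ))⁻¹ * (‖h‖ * (2 * √√(n : ℝ))) := by gcongr
      _ = 2 * ‖h‖ * ((√(n : ℝ))⁻¹ * √√(n : ℝ)) := by ring
      _ = _ := by rw [h2]
  integral_eq_zero n := by
    rw [integral_const_mul, integral_inner_centredScore hs, mul_zero]
  tendsto_variance := by
    refine (tendsto_integral_inner_centredScore_sq hs hs2 hs0 h).congr' ?_
    filter_upwards [eventually_gt_atTop 0] with n hn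
    have hn' : (0 : ℝ) < n := by exact_mod_cast hn
    simp_rw [mul_pow]
    rw [integral_const_mul, inv_pow, Real.sq_sqrt hn'.le, ← mul_assoc, mul_inv_cancel₀ hn'.ne',
      one_mul]

end Truncation

/-! ### The local likelihood ratio -/

section Likelihood

variable {m : ℕ} {𝒵 : Type*} [MeasurableSpace 𝒵] {μ : Measure 𝒵}
  {Θ : Set (EuclideanSpace ℝ (Fin m))} {p : EuclideanSpace ℝ (Fin m) → 𝒵 → ℝ}
  {θ₀ : EuclideanSpace ℝ (Fin m)} {s : 𝒵 → EuclideanSpace ℝ (Fin m)}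

theorem IsRegularModel.isProbabilityMeasure (hM : IsRegularModel μ Θ p θ₀ s) :
    IsProbabilityMeasure (obsLaw μ p θ₀) := hM.density.isProbabilityMeasure hM.mem

theorem IsRegularModel.integral_score (hM : IsRegularModel μ Θ p θ₀ s) :
    ∫ z, s z ∂(obsLaw μ p θ₀) = 0 := by
  have := hM.isProbabilityMeasure
  have hi : Integrable s (obsLaw μ p θ₀) := hM.memLp_score.integrable (by norm_num)
  refine ext_inner_left ℝ fun h => ?_
  rw [← integral_inner hi, hM.integral_inner_eq_zero, inner_zero_right]

/-- The array of local score increments in the direction `h`. -/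
noncomputable def scoreArray (P : Measure 𝒵) (s : 𝒵 → EuclideanSpace ℝ (Fin m))
    (h : EuclideanSpace ℝ (Fin m)) (n : ℕ) (z : 𝒵) : ℝ :=
  (√(n : ℝ))⁻¹ * inner ℝ h (centredScore P s n z)

theorem IsRegularModel.isSmallArray (hM : IsRegularModel μ Θ p θ₀ s)
    (h : EuclideanSpace ℝ (Fin m)) :
    IsSmallArray (obsLaw μ p θ₀) (scoreArray (obsLaw μ p θ₀) s h)
      (fun n => 2 * ‖h‖ * (√√(n : ℝ))⁻¹) (∫ z, inner ℝ h (s z) ^ 2 ∂(obsLaw μ p θ₀)) := by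
  have := hM.isProbabilityMeasure
  exact isSmallArray_centredScore hM.dqm.measurable_score hM.memLp_score hM.integral_score h

/-- Where `p θ₁` vanishes the quotient is zero by convention, and so is its product with `p θ₁`;
elsewhere `p θ₁` cancels. The quotient is therefore the density of the part of `P_{θ₂}` that
`P_{θ₁}` dominates. -/
theorem restrict_obsLaw_eq_withDensity (hp : IsDensityFamily μ Θ p) {θ₁ θ₂} (h₁ : θ₁ ∈ Θ)
    (h₂ : θ₂ ∈ Θ) : (obsLaw μ p θ₂).restrict {z | p θ₁ z ≠ 0} =
      (obsLaw μ p θ₁).withDensity fun z => ENNReal.ofReal (p θ₂ z / p θ₁ z) := by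
  have hm₁ := hp.measurable _ h₁
  have hm₂ := hp.measurable _ h₂
  have hA : MeasurableSet {z | p θ₁ z ≠ 0} := hm₁ (measurableSet_singleton (0 : ℝ)).compl
  rw [obsLaw, obsLaw, restrict_withDensity hA, ← withDensity_indicator hA]
  refine Eq.trans ?_ (withDensity_mul μ hm₁.ennreal_ofReal (hm₂.div hm₁).ennreal_ofReal)
  congr 1
  funext z
  simp only [Pi.mul_apply]
  rw [← ENNReal.ofReal_mul (hp.nonneg _ h₁ z)]
  by_cases hz : p θ₁ z = 0
  · rw [Set.indicator_of_notMem (by simp [hz]), hz, zero_mul, ENNReal.ofReal_zero]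
  · rw [Set.indicator_of_mem (by simpa using hz), mul_div_cancel₀ _ hz]

/-- With `y = √(1 + x)`, the difference is `(y - 1)² / 2`, and `|y - 1| ≤ |x|` because `x = (y - 1)
(y + 1)` with `y + 1 ≥ 1`. -/
theorem sq_one_add_half_sub_sqrt_le {x : ℝ} (hx : -1 ≤ x) :
    (1 + x / 2 - √(1 + x)) ^ 2 ≤ x ^ 4 := by
  set y := √(1 + x) with hy
  have hy0 : 0 ≤ y := Real.sqrt_nonneg _
  have hy2 : y ^ 2 = 1 + x := Real.sq_sqrt (by linarith)
  have h1 : 1 + x / 2 - y = (y - 1) ^ 2 / 2 := by linear_combination (-1 / 2) * hy2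
  have hx' : x = (y - 1) * (y + 1) := by linear_combination (-1) * hy2
  have h2 : (y - 1) ^ 2 ≤ x ^ 2 := by
    rw [hx', mul_pow]
    exact le_mul_of_one_le_right (sq_nonneg _) (by nlinarith)
  have h3 : ((y - 1) ^ 2) ^ 2 ≤ (x ^ 2) ^ 2 := pow_le_pow_left₀ (sq_nonneg _) h2 2
  rw [h1]
  nlinarith [sq_nonneg ((y - 1) ^ 2)]

/-- The left side is the squared `L²` distance of `√f` and `√(1 + X)` plus the singular mass `1 - ∫
f`. The distance splits into the remainder `r`, the truncation error and the Taylor error of the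
square root; the square of a sum of three terms costs a factor `3`. The singular mass is at most `∫
r²`, since `r` is the square root density where `p θ₀` vanishes; hence `4 = 3 + 1`. -/
theorem IsRegularModel.one_sub_affinity_le (hM : IsRegularModel μ Θ p θ₀ s)
    (h : EuclideanSpace ℝ (Fin m)) {n : ℕ} (hn1 : θ₀ + (√(n : ℝ))⁻¹ • h ∈ Θ)
    (hn2 : MemLp (dqmRemainder p θ₀ s ((√(n : ℝ))⁻¹ • h)) 2 μ) {ε : ℝ} (hε1 : ε ≤ 1)
    (hε : ∀ z, |scoreArray (obsLaw μ p θ₀) s h n z| ≤ ε) :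
    2 * (1 - ∫ z, √(p (θ₀ + (√(n : ℝ))⁻¹ • h) z / p θ₀ z) *
        √(1 + scoreArray (obsLaw μ p θ₀) s h n z) ∂(obsLaw μ p θ₀)) ≤
      4 * (∫ z, dqmRemainder p θ₀ s ((√(n : ℝ))⁻¹ • h) z ^ 2 ∂μ) +
      (√(n : ℝ))⁻¹ ^ 2 * (∫ z, inner ℝ h (s z - centredScore (obsLaw μ p θ₀) s n z) ^ 2
        ∂(obsLaw μ p θ₀)) +
      3 * ε ^ 2 * ∫ z, scoreArray (obsLaw μ p θ₀) s h n z ^ 2 ∂(obsLaw μ p θ₀) := by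
  have hP := hM.isProbabilityMeasure
  set P := obsLaw μ p θ₀ with hPdef
  set τ : ℝ := (√(n : ℝ))⁻¹ with hτ
  set X := scoreArray P s h n with hX
  set r := dqmRemainder p θ₀ s (τ • h) with hr
  set f : 𝒵 → ℝ := fun z => p (θ₀ + τ • h) z / p θ₀ z with hf
  have hm0 := hM.density.measurable _ hM.mem
  have hm1 := hM.density.measurable _ hn1
  have h00 := hM.density.nonneg _ hM.mem
  have h01 := hM.density.nonneg _ hn1
  have hXm : Measurable X := (hM.isSmallArray h).measurable n
  have hsm := hM.dqm.measurable_score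
  have hcm := measurable_centredScore P hsm n
  have hfm : Measurable f := hm1.div hm0
  have hf0 : ∀ z, 0 ≤ f z := fun z => div_nonneg (h01 z) (h00 z)
  have hX1 : ∀ z, -1 ≤ X z := fun z => by linarith [(abs_le.1 (hε z)).1]
  have hXi : Integrable X P := Integrable.of_bound hXm.aestronglyMeasurable ε (ae_of_all _ hε)
  have hXL : MemLp X 2 P := MemLp.of_bound hXm.aestronglyMeasurable ε (ae_of_all _ hε)
  have hpf : ∀ z, p θ₀ z ≠ 0 → p θ₀ z * f z = p (θ₀ + τ • h) z := fun z hz =>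
    mul_div_cancel₀ _ hz
  have hpfi : Integrable (fun z => p θ₀ z * f z) μ := by
    refine (hM.density.integrable hn1).mono (hm0.mul hfm).aestronglyMeasurable
      (ae_of_all _ fun z => ?_)
    by_cases hz : p θ₀ z = 0
    · simp [hz]
    · rw [hpf z hz]
  have hfi : Integrable f P := (hM.density.integrable_obsLaw_iff hM.mem).2 hpfi
  have hsf : MemLp (fun z => √(f z)) 2 P := by
    refine (memLp_two_iff_integrable_sq hfm.sqrt.aestronglyMeasurable).2 ?_
    simpa only [Real.sq_sqrt (hf0 _)] using hfi
  have hg0 : ∀ z, 0 ≤ 1 + X z := fun z => by linarith [hX1 z]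
  have hsg : MemLp (fun z => √(1 + X z)) 2 P := by
    refine (memLp_two_iff_integrable_sq (by fun_prop)).2 ?_
    simp only [Real.sq_sqrt (hg0 _)]
    exact (integrable_const _).fun_add hXi
  have hr2 := hn2.integrable_sq
  -- the mass of the singular part
  have hdef : 1 - ∫ z, f z ∂P ≤ ∫ z, r z ^ 2 ∂μ := by
    rw [hPdef, hM.density.integral_obsLaw hM.mem, ← hM.density.integral_eq_one hn1,
      ← integral_sub (hM.density.integrable hn1) hpfi]
    refine integral_mono ((hM.density.integrable hn1).fun_sub hpfi) hr2 fun z => ?_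
    simp only
    by_cases hz : p θ₀ z = 0
    · have : r z = √(p (θ₀ + τ • h) z) := by simp [hr, dqmRemainder, hz]
      rw [this, Real.sq_sqrt (h01 z), hz, zero_mul, sub_zero]
    · rw [hpf z hz, sub_self]; positivity
  set D : 𝒵 → ℝ := fun z => inner ℝ h (s z - centredScore P s n z) with hD
  have hDL : MemLp D 2 P := by
    have h1 : MemLp (fun z => inner ℝ h (centredScore P s n z)) 2 P := by
      refine MemLp.of_bound (by fun_prop) (‖h‖ * (2 * √√(n : ℝ))) (ae_of_all _ fun z => ?_)
      exact (abs_real_inner_le_norm _ _).trans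
        (mul_le_mul_of_nonneg_left (norm_centredScore_le n z) (norm_nonneg _))
    have h2 := (hM.memLp_inner h).sub h1
    refine h2.congr_norm (by fun_prop) (ae_of_all _ fun z => ?_)
    simp [hD, inner_sub_right]
  have hH : ∫ z, (√(f z) - √(1 + X z)) ^ 2 ∂P ≤ 3 * ∫ z, r z ^ 2 ∂μ +
      (τ ^ 2 * ∫ z, D z ^ 2 ∂P + 3 * ε ^ 2 * ∫ z, X z ^ 2 ∂P) := by
    have hbi : Integrable (fun z => τ ^ 2 * D z ^ 2 + 3 * ε ^ 2 * X z ^ 2) P :=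
      (hDL.integrable_sq.const_mul _).fun_add (hXL.integrable_sq.const_mul _)
    have hlhs : Integrable (fun z => (√(f z) - √(1 + X z)) ^ 2) P := (hsf.sub hsg).integrable_sq
    rw [← integral_const_mul, ← integral_const_mul (τ ^ 2), ← integral_const_mul (3 * ε ^ 2),
      ← integral_add (hDL.integrable_sq.const_mul _) (hXL.integrable_sq.const_mul _)]
    have hbi' := (hM.density.integrable_obsLaw_iff hM.mem).1 hbi
    have hlhs' := (hM.density.integrable_obsLaw_iff hM.mem).1 hlhs
    rw [hPdef, hM.density.integral_obsLaw hM.mem, hM.density.integral_obsLaw hM.mem,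
      ← integral_add (hr2.const_mul 3) hbi']
    refine integral_mono hlhs' ((hr2.const_mul 3).fun_add hbi') fun z => ?_
    simp only
    by_cases hz : p θ₀ z = 0
    · rw [hz, zero_mul, zero_mul, add_zero]; positivity
    · set a := √(p θ₀ z) with ha
      have ha2 : p θ₀ z = a ^ 2 := (Real.sq_sqrt (h00 z)).symm
      have haf : a * √(f z) = √(p (θ₀ + τ • h) z) := by
        rw [ha, ← Real.sqrt_mul (h00 z), hpf z hz]
      -- The linear term `(τ / 2) h's` equals `(τ / 2) D + X / 2`, by the definition of the
      -- truncation error `D`.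
      have hexp : a * (√(f z) - √(1 + X z)) = r z + a * (τ / 2 * D z) +
          a * (1 + X z / 2 - √(1 + X z)) := by
        rw [mul_sub, haf]
        simp only [hr, dqmRemainder, hD, hX, scoreArray, inner_smul_left, RCLike.conj_to_real,
          inner_sub_right, ← hτ, ← ha]
        ring
      have hb := sq_one_add_half_sub_sqrt_le (hX1 z)
      have hb2 : X z ^ 4 ≤ ε ^ 2 * X z ^ 2 := by
        have : X z ^ 2 ≤ ε ^ 2 := sq_le_sq' (by linarith [(abs_le.1 (hε z)).1])
          (abs_le.1 (hε z)).2
        nlinarith [sq_nonneg (X z)]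
      rw [ha2, ← mul_pow, hexp]
      have h3 : ∀ x y w : ℝ, (x + y + w) ^ 2 ≤ 3 * (x ^ 2 + y ^ 2 + w ^ 2) := fun x y w => by
        nlinarith [sq_nonneg (x - y), sq_nonneg (x - w), sq_nonneg (y - w)]
      refine (h3 _ _ _).trans ?_
      have h4 : a ^ 2 * (1 + X z / 2 - √(1 + X z)) ^ 2 ≤ a ^ 2 * (ε ^ 2 * X z ^ 2) :=
        mul_le_mul_of_nonneg_left (hb.trans hb2) (sq_nonneg _)
      have h5 : 0 ≤ a ^ 2 * (τ ^ 2 * D z ^ 2) := by positivity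
      -- The truncation term has coefficient `3 / 4`, which is rounded up to `1`.
      rw [mul_pow, mul_pow a, mul_pow (τ / 2), div_pow]
      linarith
  have hfg : Integrable (fun z => √(f z) * √(1 + X z)) P := hsf.integrable_mul hsg
  have hexpand : ∫ z, (√(f z) - √(1 + X z)) ^ 2 ∂P =
      ∫ z, f z ∂P + 1 - 2 * ∫ z, √(f z) * √(1 + X z) ∂P := by
    have : ∀ z, (√(f z) - √(1 + X z)) ^ 2 = (f z + (1 + X z)) - 2 * (√(f z) * √(1 + X z)) :=
      fun z => by rw [sub_sq, Real.sq_sqrt (hf0 z), Real.sq_sqrt (hg0 z)]; ring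
    simp_rw [this]
    rw [integral_sub (hfi.fun_add ((integrable_const _).fun_add hXi)) (hfg.const_mul 2),
      integral_add hfi ((integrable_const _).fun_add hXi), integral_add (integrable_const _) hXi,
      integral_const_mul, (hM.isSmallArray h).integral_eq_zero n]
    simp
  linarith

/-- Multiplied by `n`, each of the three terms of `IsRegularModel.one_sub_affinity_le` tends to
zero, and the Hellinger comparison of product measures applies. -/
theorem IsRegularModel.tendsto_integral_sub (hM : IsRegularModel μ Θ p θ₀ s)
    (h : EuclideanSpace ℝ (Fin m)) {φ : ∀ n : ℕ, (Fin n → 𝒵) → ℝ} (hφm : ∀ n, Measurable (φ n))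
    {C : ℝ} (hφ : ∀ n z, |φ n z| ≤ C) :
    Tendsto (fun n : ℕ => ∫ z, φ n z ∂(sampleLaw μ p (localParam θ₀ h n) n) -
      ∫ z, φ n z * ∏ i, (1 + scoreArray (obsLaw μ p θ₀) s h n (z i)) ∂(sampleLaw μ p θ₀ n))
      atTop (𝓝 0) := by
  have hP := hM.isProbabilityMeasure
  have hA := hM.isSmallArray h
  set P := obsLaw μ p θ₀ with hPdef
  set ε : ℕ → ℝ := fun n => 2 * ‖h‖ * (√√(n : ℝ))⁻¹ with hε
  set b : ℕ → ℝ := fun n =>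
    4 * (n * ∫ z, dqmRemainder p θ₀ s ((√(n : ℝ))⁻¹ • h) z ^ 2 ∂μ) +
      (∫ z, inner ℝ h (s z - centredScore P s n z) ^ 2 ∂P) +
      3 * ε n ^ 2 * (n * ∫ z, scoreArray P s h n z ^ 2 ∂P) with hb
  have hb0 : Tendsto b atTop (𝓝 0) := by
    have h1 := (hM.tendsto_remainder h).const_mul 4
    have h2 := tendsto_integral_inner_sub_sq hM.dqm.measurable_score hM.memLp_score
      hM.integral_score h
    have h3 := ((hA.tendsto_bound.pow 2).const_mul 3).mul hA.tendsto_variance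
    simpa using (h1.add h2).add h3
  have hlim : Tendsto (fun n => 4 * C * √(b n)) atTop (𝓝 0) := by
    simpa using ((Real.continuous_sqrt.tendsto 0).comp hb0).const_mul (4 * C)
  have hev : ∀ᶠ n in atTop, ε n ≤ 1 :=
    (hA.tendsto_bound.eventually (gt_mem_nhds one_pos)).mono fun n h => le_of_lt h
  refine squeeze_zero_norm' ?_ hlim
  filter_upwards [hev, hM.eventually_memLp_local h, eventually_gt_atTop 0] with n hn1 ⟨hn2, hn3⟩ hn0
  have hn0' : (0 : ℝ) < n := by exact_mod_cast hn0
  have hP1 := hM.density.isProbabilityMeasure hn2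
  have hXm := hA.measurable n
  have hXi : Integrable (scoreArray P s h n) P :=
    Integrable.of_bound hXm.aestronglyMeasurable _ (ae_of_all _ (hA.abs_le n))
  have hm0 := hM.density.measurable _ hM.mem
  have hm1 := hM.density.measurable _ hn2
  have hC0 : 0 ≤ C := by
    have : Nonempty 𝒵 := P.nonempty_of_neZero
    exact (abs_nonneg _).trans (hφ n fun _ => Classical.arbitrary 𝒵)
  refine (abs_integral_pi_sub_le P (obsLaw μ p (localParam θ₀ h n))
    (hm0 (measurableSet_singleton (0 : ℝ)).compl)
    (f := fun z => p (localParam θ₀ h n) z / p θ₀ z) (g := fun z => 1 + scoreArray P s h n z) (hm1.div hm0)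
    (measurable_const.add hXm)
    (fun z => div_nonneg (hM.density.nonneg _ hn2 z) (hM.density.nonneg _ hM.mem z))
    (fun z => by linarith [(abs_le.1 (hA.abs_le n z)).1])
    (restrict_obsLaw_eq_withDensity hM.density hM.mem hn2)
    ((integrable_const _).fun_add hXi) ?_ n (hφm n) (hφ n)).trans ?_
  · rw [integral_add (integrable_const _) hXi, hA.integral_eq_zero n]
    simp
  · refine mul_le_mul_of_nonneg_left (Real.sqrt_le_sqrt ?_) (by positivity)
    have h1 := mul_le_mul_of_nonneg_left
      (hM.one_sub_affinity_le h hn2 hn3 hn1 (hA.abs_le n)) hn0'.le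
    have h2 : (n : ℝ) * (√(n : ℝ))⁻¹ ^ 2 = 1 := by
      rw [inv_pow, Real.sq_sqrt hn0'.le, mul_inv_cancel₀ hn0'.ne']
    calc _ = (n : ℝ) * (2 * (1 - ∫ z, √(p (localParam θ₀ h n) z / p θ₀ z) *
          √(1 + scoreArray P s h n z) ∂P)) := by ring
      _ ≤ _ := h1
      _ = 4 * (n * ∫ z, dqmRemainder p θ₀ s ((√(n : ℝ))⁻¹ • h) z ^ 2 ∂μ) +
        ((n : ℝ) * (√(n : ℝ))⁻¹ ^ 2) *
          (∫ z, inner ℝ h (s z - centredScore P s n z) ^ 2 ∂P) +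
        3 * ε n ^ 2 * (n * ∫ z, scoreArray P s h n z ^ 2 ∂P) := by
          rw [hε, hPdef]
          ring
      _ = b n := by rw [h2, one_mul]

end Likelihood

end LimitExperiment

/-! ### Limits of exponentially tilted expectations -/

/-- The truncation acts only where `e^y ≥ M`, and there `e^y ≤ e^{2y} / M`. Bounded second
exponential moments thus give uniform integrability. -/
theorem exp_sub_min_le {y M : ℝ} (hM : 0 < M) :
    |Real.exp y - min (Real.exp y) M| ≤ Real.exp (2 * y) / M := by
  rcases le_total (Real.exp y) M with h | h
  · rw [min_eq_left h, sub_self, abs_zero]; positivity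
  · rw [min_eq_right h, abs_of_nonneg (by linarith), le_div_iff₀ hM, two_mul, Real.exp_add]
    nlinarith [Real.exp_pos y]

theorem integrable_exp_of_integrable_exp_two_mul {X : Type*} [MeasurableSpace X] {ν : Measure X}
    [IsFiniteMeasure ν] {y : X → ℝ} (hy : Measurable y)
    (hi : Integrable (fun x => Real.exp (2 * y x)) ν) : Integrable (fun x => Real.exp (y x)) ν := by
  refine ((integrable_const (1 : ℝ)).add hi).mono' hy.exp.aestronglyMeasurable
    (ae_of_all _ fun x => ?_)
  rw [Real.norm_eq_abs, Real.abs_exp]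
  simp only [Pi.add_apply, two_mul, Real.exp_add]
  nlinarith [sq_nonneg (Real.exp (y x) - 1), Real.exp_pos (y x)]

theorem abs_integral_mul_exp_sub_le {X : Type*} [MeasurableSpace X] {ν : Measure X}
    [IsProbabilityMeasure ν] {y f : X → ℝ} (hy : Measurable y) (hf : Measurable f) {K C M : ℝ}
    (hfK : ∀ x, |f x| ≤ K) (hi : Integrable (fun x => Real.exp (2 * y x)) ν)
    (hC : ∫ x, Real.exp (2 * y x) ∂ν ≤ C) (hM : 0 < M) :
    |∫ x, f x * Real.exp (y x) ∂ν - ∫ x, f x * min (Real.exp (y x)) M ∂ν| ≤ K * (C / M) := by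
  have hK : 0 ≤ K := by
    have : Nonempty X := ν.nonempty_of_neZero
    exact (abs_nonneg _).trans (hfK (Classical.arbitrary X))
  have i1 : Integrable (fun x => f x * Real.exp (y x)) ν :=
    (integrable_exp_of_integrable_exp_two_mul hy hi).bdd_mul hf.aestronglyMeasurable
      (ae_of_all _ hfK)
  have i2 : Integrable (fun x => f x * min (Real.exp (y x)) M) ν := by
    refine Integrable.bdd_mul (Integrable.of_bound (by fun_prop) M (ae_of_all _ fun x => ?_))
      hf.aestronglyMeasurable (ae_of_all _ hfK)
    rw [Real.norm_eq_abs, abs_of_nonneg (le_min (Real.exp_pos _).le hM.le)]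
    exact min_le_right _ _
  rw [← integral_sub i1 i2, ← Real.norm_eq_abs]
  calc _ ≤ ∫ x, K * (Real.exp (2 * y x) / M) ∂ν := by
        refine norm_integral_le_of_norm_le ((hi.div_const M).const_mul K)
          (ae_of_all _ fun x => ?_)
        rw [← mul_sub, norm_mul]
        exact mul_le_mul (hfK x) (exp_sub_min_le hM) (norm_nonneg _) hK
    _ = K * ((∫ x, Real.exp (2 * y x) ∂ν) / M) := by rw [integral_const_mul, integral_div]
    _ ≤ _ := by gcongr

theorem BoundedContinuousFunction.tendsto_of_tendsto_probabilityMeasure {X ι : Type*}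
    [TopologicalSpace X] [MeasurableSpace X] [OpensMeasurableSpace X] {𝓕 : Filter ι}
    {ν : ι → ProbabilityMeasure X} {ν' : ProbabilityMeasure X} (h : Tendsto ν 𝓕 (𝓝 ν'))
    {f : X → ℝ} (hf : Continuous f) {K : ℝ} (hK : ∀ x, |f x| ≤ K) :
    Tendsto (fun n => ∫ x, f x ∂(ν n : Measure X)) 𝓕 (𝓝 (∫ x, f x ∂(ν' : Measure X))) :=
  ProbabilityMeasure.tendsto_iff_forall_integral_tendsto.1 h
    (BoundedContinuousFunction.ofNormedAddCommGroup f hf K hK)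

section TiltedLimit

variable {X ι : Type*} [TopologicalSpace X] [MeasurableSpace X] [BorelSpace X] {𝓕 : Filter ι}
  [𝓕.NeBot] {ν : ι → ProbabilityMeasure X} {ν' : ProbabilityMeasure X} {y : X → ℝ} {C : ℝ}

/-- Truncated exponentials are bounded and continuous, so the bound passes to the limit at each
level; Fatou's lemma removes the truncation. -/
theorem integrable_exp_of_tendsto (h : Tendsto ν 𝓕 (𝓝 ν')) (hy : Continuous y)
    (hi : ∀ᶠ n in 𝓕, Integrable (fun x => Real.exp (2 * y x)) (ν n : Measure X) ∧
      ∫ x, Real.exp (2 * y x) ∂(ν n : Measure X) ≤ C) :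
    Integrable (fun x => Real.exp (2 * y x)) (ν' : Measure X) ∧
      ∫ x, Real.exp (2 * y x) ∂(ν' : Measure X) ≤ C := by
  have hm : Measurable y := hy.measurable
  have hC0 : 0 ≤ C := by
    obtain ⟨n, hn⟩ := hi.exists
    exact (integral_nonneg fun x => (Real.exp_pos _).le).trans hn.2
  have hpos : ∀ (k : ℕ) x, 0 ≤ min (Real.exp (2 * y x)) k := fun k x =>
    le_min (Real.exp_pos _).le (Nat.cast_nonneg k)
  have hbd : ∀ (k : ℕ) x, |min (Real.exp (2 * y x)) k| ≤ k := fun k x => by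
    rw [abs_of_nonneg (hpos k x)]; exact min_le_right _ _
  have hk : ∀ k : ℕ, ∫ x, min (Real.exp (2 * y x)) k ∂(ν' : Measure X) ≤ C := fun k => by
    refine le_of_tendsto (BoundedContinuousFunction.tendsto_of_tendsto_probabilityMeasure h
      (f := fun x => min (Real.exp (2 * y x)) k) (by fun_prop) (hbd k)) ?_
    filter_upwards [hi] with n hn
    refine le_trans (integral_mono ?_ hn.1 fun x => min_le_left _ _) hn.2
    exact Integrable.of_bound (Measurable.aestronglyMeasurable (by fun_prop)) k
      (ae_of_all _ (hbd k))
  have hl : ∫⁻ x, ENNReal.ofReal (Real.exp (2 * y x)) ∂(ν' : Measure X) ≤ ENNReal.ofReal C := by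
    have hlim : ∀ x, Tendsto (fun k : ℕ => ENNReal.ofReal (min (Real.exp (2 * y x)) k)) atTop
        (𝓝 (ENNReal.ofReal (Real.exp (2 * y x)))) := fun x => by
      refine tendsto_nhds_of_eventually_eq ?_
      filter_upwards [(tendsto_natCast_atTop_atTop (R := ℝ)).eventually_ge_atTop
        (Real.exp (2 * y x))] with k hk
      rw [min_eq_left hk]
    calc ∫⁻ x, ENNReal.ofReal (Real.exp (2 * y x)) ∂(ν' : Measure X)
        = ∫⁻ x, liminf (fun k : ℕ => ENNReal.ofReal (min (Real.exp (2 * y x)) k)) atTop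
          ∂(ν' : Measure X) := lintegral_congr fun x => (hlim x).liminf_eq.symm
      _ ≤ liminf (fun k : ℕ => ∫⁻ x, ENNReal.ofReal (min (Real.exp (2 * y x)) k)
          ∂(ν' : Measure X)) atTop := lintegral_liminf_le fun k => by fun_prop
      _ ≤ liminf (fun _ : ℕ => ENNReal.ofReal C) atTop := by
          refine liminf_le_liminf (Eventually.of_forall fun k => ?_)
          rw [← ofReal_integral_eq_lintegral_ofReal (Integrable.of_bound
            (Measurable.aestronglyMeasurable (by fun_prop)) k (ae_of_all _ (hbd k)))
            (ae_of_all _ (hpos k))]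
          exact ENNReal.ofReal_le_ofReal (hk k)
      _ = _ := by simp
  have hint : Integrable (fun x => Real.exp (2 * y x)) (ν' : Measure X) := by
    refine ⟨Measurable.aestronglyMeasurable (by fun_prop), ?_⟩
    rw [hasFiniteIntegral_iff_ofReal (ae_of_all _ fun x => (Real.exp_pos _).le)]
    exact hl.trans_lt ENNReal.ofReal_lt_top
  refine ⟨hint, ?_⟩
  rw [← ENNReal.ofReal_le_ofReal_iff hC0,
    ofReal_integral_eq_lintegral_ofReal hint (ae_of_all _ fun x => (Real.exp_pos _).le)]
  exact hl

/-- The integrand is unbounded, so it is cut at a level `M` whose error `K * (C / M)` is uniform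
along the filter and also valid for the limit law. -/
theorem tendsto_integral_mul_exp_of_tendsto (h : Tendsto ν 𝓕 (𝓝 ν')) (hy : Continuous y)
    (hi : ∀ᶠ n in 𝓕, Integrable (fun x => Real.exp (2 * y x)) (ν n : Measure X) ∧
      ∫ x, Real.exp (2 * y x) ∂(ν n : Measure X) ≤ C) {f : X → ℝ} (hf : Continuous f) {K : ℝ}
    (hfK : ∀ x, |f x| ≤ K) :
    Tendsto (fun n => ∫ x, f x * Real.exp (y x) ∂(ν n : Measure X)) 𝓕
      (𝓝 (∫ x, f x * Real.exp (y x) ∂(ν' : Measure X))) := by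
  obtain ⟨hi', hC'⟩ := integrable_exp_of_tendsto h hy hi
  have hlim : Tendsto (fun M : ℝ => K * (C / M)) atTop (𝓝 0) := by
    simpa using (tendsto_const_nhds.div_atTop tendsto_id (a := C)).const_mul K
  rw [Metric.tendsto_nhds]
  intro ε hε
  obtain ⟨M, hM1, hM0⟩ := ((hlim.eventually (gt_mem_nhds (show (0 : ℝ) < ε / 3 by positivity))).and
    (eventually_gt_atTop 0)).exists
  have hbd : ∀ x, |f x * min (Real.exp (y x)) M| ≤ K * M := fun x => by
    rw [abs_mul, abs_of_nonneg (le_min (Real.exp_pos (y x)).le hM0.le)]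
    exact mul_le_mul (hfK x) (min_le_right _ _) (le_min (Real.exp_pos _).le hM0.le)
      ((abs_nonneg _).trans (hfK x))
  have ht := BoundedContinuousFunction.tendsto_of_tendsto_probabilityMeasure h
    (f := fun x => f x * min (Real.exp (y x)) M) (by fun_prop) hbd
  filter_upwards [hi, (Metric.tendsto_nhds.1 ht) (ε / 3) (by positivity)] with n ⟨hn1, hn2⟩ hn3
  have h1 := abs_integral_mul_exp_sub_le hy.measurable hf.measurable hfK hn1 hn2 hM0
  have h2 := abs_integral_mul_exp_sub_le hy.measurable hf.measurable hfK hi' hC' hM0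
  rw [Real.dist_eq] at hn3 ⊢
  rw [abs_lt] at hn3 ⊢
  rw [abs_le] at h1 h2
  constructor <;> linarith [h1.1, h1.2, h2.1, h2.2, hn3.1, hn3.2]

end TiltedLimit

/-! ### Tightness and limits of the joint laws -/

theorem isTightMeasureSet_pi {κ X : Type*} [Fintype κ] [TopologicalSpace X] [MeasurableSpace X]
    {S : Set (Measure (κ → X))}
    (h : ∀ k, IsTightMeasureSet ((fun μ => Measure.map (fun x : κ → X => x k) μ) '' S)) :
    IsTightMeasureSet S := by
  simp_rw [isTightMeasureSet_iff_exists_isCompact_measure_compl_le] at h ⊢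
  intro ε hε
  have hε' : 0 < ε / (Fintype.card κ + 1) :=
    ENNReal.div_pos hε.ne' (by finiteness)
  choose K hKc hK using fun k => h k _ hε'
  refine ⟨Set.univ.pi K, isCompact_univ_pi hKc, fun μ hμ => ?_⟩
  have hsub : (Set.univ.pi K)ᶜ ⊆ ⋃ k, (fun x : κ → X => x k) ⁻¹' (K k)ᶜ := fun x hx => by
    simpa [Set.mem_pi] using hx
  calc μ (Set.univ.pi K)ᶜ ≤ μ (⋃ k, (fun x : κ → X => x k) ⁻¹' (K k)ᶜ) := measure_mono hsub
    _ ≤ ∑ k, μ ((fun x : κ → X => x k) ⁻¹' (K k)ᶜ) := measure_iUnion_fintype_le _ _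
    _ ≤ ∑ _k : κ, ε / (Fintype.card κ + 1) := Finset.sum_le_sum fun k _ =>
        (Measure.le_map_apply (measurable_pi_apply k).aemeasurable _).trans
          (hK k _ ⟨μ, hμ, rfl⟩)
    _ = Fintype.card κ * (ε / (Fintype.card κ + 1)) := by simp
    _ ≤ (Fintype.card κ + 1) * (ε / (Fintype.card κ + 1)) := by gcongr; exact le_self_add
    _ ≤ ε := ENNReal.mul_div_le

/-- A convergent sequence together with its limit is compact, and compact sets of laws on a Polish
space are tight. -/
theorem isTightMeasureSet_range_of_tendsto {X : Type*} [MetricSpace X] [CompleteSpace X]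
    [SecondCountableTopology X] [MeasurableSpace X] [BorelSpace X] {ν : ℕ → ProbabilityMeasure X}
    {ν' : ProbabilityMeasure X} (h : Tendsto ν atTop (𝓝 ν')) :
    IsTightMeasureSet (Set.range fun n => (ν n : Measure X)) := by
  have hc := h.isCompact_insert_range
  have ht := isTightMeasureSet_of_isCompact_closure hc.closure
  refine ht.subset ?_
  rintro _ ⟨n, rfl⟩
  exact ⟨ν n, Set.mem_insert_of_mem _ ⟨n, rfl⟩, rfl⟩

/-- Prokhorov's theorem gives compactness. An ultrafilter takes the place of a subsequence, so no
sequential compactness is needed. -/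
theorem exists_ultrafilter_limit {X : Type*} [TopologicalSpace X] [T2Space X] [MeasurableSpace X]
    [BorelSpace X] {ν : ℕ → ProbabilityMeasure X}
    (h : IsTightMeasureSet (Set.range fun n => (ν n : Measure X))) :
    ∃ ν' : ProbabilityMeasure X, Tendsto ν (hyperfilter ℕ) (𝓝 ν') := by
  have hc : IsCompact (closure (Set.range ν)) := by
    refine isCompact_closure_of_isTightMeasureSet (h.subset ?_)
    rintro _ ⟨_, ⟨n, rfl⟩, rfl⟩
    exact ⟨n, rfl⟩
  obtain ⟨ν', -, hν'⟩ := hc.ultrafilter_le_nhds' ((hyperfilter ℕ).map ν)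
    (Filter.mem_of_superset (Filter.range_mem_map) subset_closure)
  exact ⟨ν', hν'⟩

-- Tightness of the statistics comes from their convergence at `h = 0`, that of the block sums from
-- their characteristic functions. Independence passes to the limit because it is tested by products
-- of bounded continuous functions. The tilted integrals converge by the bound on second exponential
-- moments.
open LimitExperiment in
theorem exists_adapted_limit {D : ℕ} {E : Type*} [NormedAddCommGroup E] [InnerProductSpace ℝ E]
    [FiniteDimensional ℝ E] [MeasurableSpace E] [BorelSpace E]
    (ν : ℕ → ProbabilityMeasure ((Fin D → ℝ) × (Fin D → E)))
    (L : E → ProbabilityMeasure (Fin D → ℝ)) (γ : Fin D → Measure E)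
    [∀ d, IsProbabilityMeasure (γ d)] (c : E → ℝ)
    (hind : ∀ n d, IndepFun (fun (x : (Fin D → ℝ) × (Fin D → E)) (i : Set.Iio d) =>
      (x.1 i, x.2 i)) (fun x => x.2 d) (ν n : Measure ((Fin D → ℝ) × (Fin D → E))))
    (hγ : ∀ d u, Tendsto (fun n => charFun ((ν n : Measure ((Fin D → ℝ) × (Fin D → E))).map
      (fun x => x.2 d)) u) atTop (𝓝 (charFun (γ d) u)))
    (hexp : ∀ h : E, ∃ C, ∀ᶠ n in atTop,
      Integrable (fun x => Real.exp (2 * (inner ℝ h (∑ d, x.2 d) - c h)))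
        (ν n : Measure ((Fin D → ℝ) × (Fin D → E))) ∧
      ∫ x, Real.exp (2 * (inner ℝ h (∑ d, x.2 d) - c h))
        ∂(ν n : Measure ((Fin D → ℝ) × (Fin D → E))) ≤ C)
    (hfst : ConvergesWeakly
      (fun n => (ν n : Measure ((Fin D → ℝ) × (Fin D → E))).map Prod.fst)
      (L 0 : Measure (Fin D → ℝ)))
    (hL : ∀ (h : E) (f : BoundedContinuousFunction (Fin D → ℝ) ℝ), Tendsto (fun n =>
      ∫ x, f x.1 * Real.exp (inner ℝ h (∑ d, x.2 d) - c h)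
        ∂(ν n : Measure ((Fin D → ℝ) × (Fin D → E)))) atTop (𝓝 (∫ x, f x ∂(L h : Measure _)))) :
    ∃ Q : Measure ((Fin D → ℝ) × (Fin D → E)), IsProbabilityMeasure Q ∧
      (∀ d, IndepFun (fun (x : (Fin D → ℝ) × (Fin D → E)) (i : Set.Iio d) => (x.1 i, x.2 i))
        (fun x => x.2 d) Q) ∧
      (∀ d, Q.map (fun x => x.2 d) = γ d) ∧
      ∀ (h : E) (f : BoundedContinuousFunction (Fin D → ℝ) ℝ),
        ∫ x, f x.1 * Real.exp (inner ℝ h (∑ d, x.2 d) - c h) ∂Q = ∫ x, f x ∂(L h : Measure _) := by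
  have htight : IsTightMeasureSet
      (Set.range fun n => (ν n : Measure ((Fin D → ℝ) × (Fin D → E)))) := by
    refine IsTightMeasureSet.prodMk ?_ (isTightMeasureSet_pi fun d => ?_)
    · have : Tendsto (fun n => (ν n).map (f := Prod.fst) measurable_fst.aemeasurable) atTop
          (𝓝 (L 0)) := ProbabilityMeasure.tendsto_iff_forall_integral_tendsto.2 fun f => hfst f
      refine (isTightMeasureSet_range_of_tendsto this).subset ?_
      rintro _ ⟨_, ⟨n, rfl⟩, rfl⟩
      exact ⟨n, rfl⟩
    · have : ∀ n, IsProbabilityMeasure ((ν n : Measure ((Fin D → ℝ) × (Fin D → E))).map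
          (fun x => x.2 d)) := fun n => Measure.isProbabilityMeasure_map (by fun_prop)
      refine (isTightMeasureSet_of_tendsto_charFun (f := charFun (γ d)) (by fun_prop)
        (hγ d)).subset ?_
      rintro _ ⟨_, ⟨_, ⟨n, rfl⟩, rfl⟩, rfl⟩
      refine ⟨n, ?_⟩
      simp only [Measure.snd]
      rw [Measure.map_map (measurable_pi_apply d) measurable_snd]
      rfl
  obtain ⟨Q, hQ⟩ := exists_ultrafilter_limit htight
  -- Limits assumed along `atTop` persist along the ultrafilter, where they are compared with
  -- integrals under `Q`.
  have hU : ((hyperfilter ℕ : Ultrafilter ℕ) : Filter ℕ) ≤ atTop := Nat.hyperfilter_le_atTop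
  refine ⟨Q, inferInstance, fun d => ?_, fun d => ?_, fun h f => ?_⟩
  · refine indepFun_of_bcf (by fun_prop) (by fun_prop) fun f g => ?_
    have h1 := BoundedContinuousFunction.tendsto_of_tendsto_probabilityMeasure hQ
      (f := fun x => f (fun i : Set.Iio d => (x.1 i, x.2 i)) * g (x.2 d)) (by fun_prop)
      (K := ‖f‖ * ‖g‖) (fun x => by
        rw [abs_mul]
        exact mul_le_mul (f.norm_coe_le_norm _) (g.norm_coe_le_norm _) (abs_nonneg _)
          (norm_nonneg _))
    have h2 := BoundedContinuousFunction.tendsto_of_tendsto_probabilityMeasure hQ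
      (f := fun x => f (fun i : Set.Iio d => (x.1 i, x.2 i))) (by fun_prop)
      (fun x => f.norm_coe_le_norm _)
    have h3 := BoundedContinuousFunction.tendsto_of_tendsto_probabilityMeasure hQ
      (f := fun x => g (x.2 d)) (by fun_prop) (fun x => g.norm_coe_le_norm _)
    refine tendsto_nhds_unique h1 ((h2.mul h3).congr fun n => ?_)
    have hi := (hind n d).comp f.continuous.measurable g.continuous.measurable
    exact (hi.integral_fun_mul_eq_mul_integral
      (Measurable.aestronglyMeasurable (by fun_prop))
      (Measurable.aestronglyMeasurable (by fun_prop))).symm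
  · have : IsProbabilityMeasure ((Q : Measure ((Fin D → ℝ) × (Fin D → E))).map
      (fun x => x.2 d)) := Measure.isProbabilityMeasure_map (by fun_prop)
    refine Measure.ext_of_charFun (funext fun u => ?_)
    set g := (BoundedContinuousFunction.innerProbChar u).compContinuous
      ⟨fun x : (Fin D → ℝ) × (Fin D → E) => x.2 d, by fun_prop⟩ with hg
    have hq := (ProbabilityMeasure.tendsto_iff_forall_integral_rclike_tendsto ℂ).1 hQ g
    have he : ∀ ρ : Measure ((Fin D → ℝ) × (Fin D → E)),
        charFun (ρ.map (fun x => x.2 d)) u = ∫ x, g x ∂ρ := fun ρ => by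
      rw [charFun_eq_integral_innerProbChar, integral_map (by fun_prop)
        (BoundedContinuousFunction.continuous _).aestronglyMeasurable]
      rfl
    rw [he]
    exact tendsto_nhds_unique hq (((hγ d u).mono_left hU).congr fun n => he _)
  · obtain ⟨C, hC⟩ := hexp h
    have hC' := hC.filter_mono hU
    have hy : Continuous fun x : (Fin D → ℝ) × (Fin D → E) =>
        (inner ℝ h (∑ d, x.2 d) - c h : ℝ) := by fun_prop
    have hf : Continuous fun x : (Fin D → ℝ) × (Fin D → E) => f x.1 := by fun_prop
    have h1 := tendsto_integral_mul_exp_of_tendsto hQ hy hC' hf (K := ‖f‖)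
      fun x => f.norm_coe_le_norm x.1
    exact tendsto_nhds_unique h1 ((hL h f).mono_left hU)

/-! ### Independence of functions of disjoint groups of observations -/

/-- A function of the coordinates in `A` is recovered from the restriction to `A` by filling the
other coordinates with an arbitrary point; restrictions to disjoint sets are independent. -/
theorem indepFun_pi_of_dependsOn {ι Z α β : Type*} [Fintype ι] [MeasurableSpace Z]
    [MeasurableSpace α] [MeasurableSpace β] (P : Measure Z) [IsProbabilityMeasure P]
    {A B : Finset ι} (hAB : Disjoint A B) {F : (ι → Z) → α} {G : (ι → Z) → β}
    (hF : Measurable F) (hG : Measurable G) (hFA : DependsOn F A) (hGB : DependsOn G B) :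
    IndepFun F G (Measure.pi fun _ : ι => P) := by
  classical
  have hZ : Nonempty Z := P.nonempty_of_neZero
  have h0 := (iIndepFun_pi (μ := fun _ : ι => P) (X := fun _ => id)
    fun _ => aemeasurable_id).indepFun_finset A B hAB fun i => measurable_pi_apply i
  let ext : ∀ C : Finset ι, (C → Z) → ι → Z := fun C w i =>
    if hi : i ∈ C then w ⟨i, hi⟩ else Classical.arbitrary Z
  have hext : ∀ C, Measurable (ext C) := fun C => by
    refine measurable_pi_lambda _ fun i => ?_
    by_cases hi : i ∈ C
    · simp only [ext, hi, dite_true]; exact measurable_pi_apply _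
    · simp only [ext, hi, dite_false]; exact measurable_const
  have h1 := h0.comp (hF.comp (hext A)) (hG.comp (hext B))
  have e1 : (F ∘ ext A) ∘ (fun (z : ι → Z) (i : A) => id (z i)) = F := funext fun z =>
    hFA fun i hi => by simp [ext, Finset.mem_coe.1 hi]
  have e2 : (G ∘ ext B) ∘ (fun (z : ι → Z) (i : B) => id (z i)) = G := funext fun z =>
    hGB fun i hi => by simp [ext, Finset.mem_coe.1 hi]
  rwa [e1, e2] at h1

/-! ### Blocks of observations -/

namespace LimitExperiment

theorem pred_lt_of_pos {D : ℕ} (hD : 0 < D) : D - 1 < D := Nat.sub_lt hD Nat.one_pos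

open Classical in
/-- The observations with relative index at most `a`. -/
noncomputable def upto (n : ℕ) (a : ℝ) : Finset (Fin n) :=
  Finset.univ.filter fun i => ((i : ℕ) + 1 : ℝ) / n ≤ a

theorem mem_upto {n : ℕ} {a : ℝ} {i : Fin n} : i ∈ upto n a ↔ ((i : ℕ) + 1 : ℝ) / n ≤ a := by
  simp [upto]

theorem upto_mono (n : ℕ) {a b : ℝ} (h : a ≤ b) : upto n a ⊆ upto n b := fun _ hi =>
  mem_upto.2 ((mem_upto.1 hi).trans h)

/-- The condition on `i` says `i + 1 ≤ ⌊a * n⌋₊`, and `a ≤ 1` keeps all these indices below `n`. -/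
theorem card_upto (n : ℕ) {a : ℝ} (ha1 : a ≤ 1) : (upto n a).card = ⌊a * n⌋₊ := by
  classical
  rw [← Finset.card_image_of_injective _ Fin.val_injective, ← Finset.card_range ⌊a * n⌋₊]
  congr 1
  ext k
  simp only [Finset.mem_image, mem_upto, Finset.mem_range]
  constructor
  · rintro ⟨i, hi, rfl⟩
    have hn : (0 : ℝ) < n := by exact_mod_cast i.pos
    rw [div_le_iff₀ hn] at hi
    exact Nat.lt_of_succ_le (Nat.le_floor (by push_cast; exact hi))
  · intro hk
    have hk1 : ((k + 1 : ℕ) : ℝ) ≤ a * n :=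
      (Nat.le_floor_iff' (Nat.succ_ne_zero k)).1 (Nat.succ_le_of_lt hk)
    have hkn : k + 1 ≤ n := by
      have : ((k + 1 : ℕ) : ℝ) ≤ n := hk1.trans (mul_le_of_le_one_left (Nat.cast_nonneg n) ha1)
      exact_mod_cast this
    refine ⟨⟨k, hkn⟩, ?_, rfl⟩
    have hn : (0 : ℝ) < n := by exact_mod_cast (Nat.succ_pos k).trans_le hkn
    rw [div_le_iff₀ hn]
    push_cast at hk1
    exact hk1

theorem tendsto_card_upto {a : ℝ} (ha0 : 0 ≤ a) (ha1 : a ≤ 1) :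
    Tendsto (fun n : ℕ => ((upto n a).card : ℝ) / n) atTop (𝓝 a) := by
  simp_rw [card_upto _ ha1]
  exact (tendsto_nat_floor_mul_div_atTop ha0).comp tendsto_natCast_atTop_atTop

/-- The time that precedes `t d`, which is `0` for the first index. -/
noncomputable def prevTime {D : ℕ} (t : Fin D → I) (d : Fin D) : I :=
  if 0 < (d : ℕ) then t ⟨d - 1, by omega⟩ else 0

/-- The observations with relative index in the `d`-th interval. -/
noncomputable def block {D : ℕ} (t : Fin D → I) (n : ℕ) (d : Fin D) : Finset (Fin n) :=
  upto n (t d) \ upto n (prevTime t d)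

section Blocks

variable {D : ℕ} {t : Fin D → I}

theorem prevTime_lt (ht_pos : ∀ d, 0 < t d) (ht : StrictMono t) (d : Fin D) :
    prevTime t d < t d := by
  unfold prevTime
  split_ifs with h
  · exact ht (Fin.lt_def.2 (by simp; omega))
  · exact ht_pos d

/-- Observation `i` lies in block `d` when `d` is the first index whose time is not before it.
Disjointness of the blocks and their union follow from this form. -/
theorem mem_block (ht : StrictMono t) {n : ℕ} {d : Fin D} {i : Fin n} :
    i ∈ block t n d ↔ ((i : ℕ) + 1 : ℝ) / n ≤ t d ∧ ∀ c < d, (t c : ℝ) < ((i : ℕ) + 1 : ℝ) / n := by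
  rw [block, Finset.mem_sdiff, mem_upto, mem_upto, not_le]
  refine and_congr_right fun _ => ⟨fun h c hc => ?_, fun h => ?_⟩
  · have hd : 0 < (d : ℕ) := by have := Fin.lt_def.1 hc; omega
    refine lt_of_le_of_lt ?_ h
    rw [prevTime, if_pos hd]
    exact_mod_cast ht.monotone (Fin.le_def.2 (by have := Fin.lt_def.1 hc; simp; omega))
  · unfold prevTime
    split_ifs with hd
    · exact h _ (Fin.lt_def.2 (by simp; omega))
    · have hn : (0 : ℝ) < n := by exact_mod_cast i.pos
      simp only [Set.Icc.coe_zero]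
      positivity

theorem tendsto_card_block (ht_pos : ∀ d, 0 < t d) (ht : StrictMono t) (d : Fin D) :
    Tendsto (fun n : ℕ => ((block t n d).card : ℝ) / n) atTop (𝓝 (t d - prevTime t d)) := by
  have hle : (prevTime t d : ℝ) ≤ t d := by exact_mod_cast (prevTime_lt ht_pos ht d).le
  refine ((tendsto_card_upto (t d).2.1 (t d).2.2).sub
    (tendsto_card_upto (prevTime t d).2.1 (prevTime t d).2.2)).congr fun n => ?_
  rw [block, Finset.card_sdiff_of_subset (upto_mono n hle),
    Nat.cast_sub (Finset.card_le_card (upto_mono n hle)), sub_div]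

theorem pairwiseDisjoint_block (ht : StrictMono t) (n : ℕ) :
    (Set.univ : Set (Fin D)).PairwiseDisjoint (block t n) := by
  have key : ∀ d e : Fin D, d < e → Disjoint (block t n d) (block t n e) := fun d e hde => by
    refine Finset.disjoint_left.2 fun i hd he => ?_
    exact absurd ((mem_block ht).1 hd).1 (not_le.2 (((mem_block ht).1 he).2 d hde))
  intro d _ e _ hne
  rcases lt_or_gt_of_ne hne with h | h
  · exact key d e h
  · exact (key e d h).symm

theorem biUnion_block (ht : StrictMono t) (hD : 0 < D) (n : ℕ) :
    Finset.univ.biUnion (block t n) = upto n (t ⟨D - 1, pred_lt_of_pos hD⟩) := by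
  ext i
  simp only [Finset.mem_biUnion, Finset.mem_univ, true_and, mem_block ht, mem_upto]
  constructor
  · rintro ⟨d, hd, -⟩
    refine hd.trans ?_
    exact_mod_cast ht.monotone (Fin.le_def.2 (by simp; omega))
  · intro hi
    obtain ⟨d, hd, hmin⟩ := WellFounded.has_min (wellFounded_lt (α := Fin D))
      {d | ((i : ℕ) + 1 : ℝ) / n ≤ t d} ⟨_, hi⟩
    exact ⟨d, hd, fun c hc => not_le.1 fun h => hmin c h hc⟩

theorem sum_sum_block {M : Type*} [AddCommMonoid M] (ht : StrictMono t) (hD : 0 < D) (n : ℕ)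
    (f : Fin n → M) :
    ∑ d, ∑ i ∈ block t n d, f i = ∑ i ∈ upto n (t ⟨D - 1, pred_lt_of_pos hD⟩), f i := by
  rw [← biUnion_block ht hD, Finset.sum_biUnion]
  exact fun d _ e _ h => pairwiseDisjoint_block ht n (Set.mem_univ d) (Set.mem_univ e) h

/-- A telescoping sum, read off as the limit of the identity between the cardinalities of the blocks
and of their union. -/
theorem sum_sub_prevTime (ht_pos : ∀ d, 0 < t d) (ht : StrictMono t) (hD : 0 < D) :
    ∑ d, ((t d : ℝ) - prevTime t d) = t ⟨D - 1, pred_lt_of_pos hD⟩ := by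
  have h1 := tendsto_finsetSum Finset.univ fun d _ => tendsto_card_block ht_pos ht d
  have h2 := tendsto_card_upto (t ⟨D - 1, pred_lt_of_pos hD⟩).2.1 (t ⟨D - 1, pred_lt_of_pos hD⟩).2.2
  refine tendsto_nhds_unique h1 (h2.congr fun n => ?_)
  have := sum_sum_block ht hD n fun _ => (1 : ℝ)
  simp only [Finset.sum_const, nsmul_eq_mul, mul_one] at this
  rw [← Finset.sum_div, this]

end Blocks

/-! ### The limit of the statistics together with the block sums of the scores -/

/-- The normalized sum of the centred scores over the `d`-th block of observations. -/
noncomputable def blockScore {m D : ℕ} {𝒵 : Type*} [MeasurableSpace 𝒵] (P : Measure 𝒵)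
    (s : 𝒵 → EuclideanSpace ℝ (Fin m)) (t : Fin D → I) (n : ℕ) (z : Fin n → 𝒵) (d : Fin D) :
    EuclideanSpace ℝ (Fin m) :=
  ∑ i ∈ block t n d, (√(n : ℝ))⁻¹ • centredScore P s n (z i)

/-- The exponent has the form of the limit in `IsSmallArray.tendsto_integral_exp` at `w =
Complex.I`, so that the two can be matched directly. -/
theorem charFun_map_smul_stdGaussian {m : ℕ}
    {R : EuclideanSpace ℝ (Fin m) →L[ℝ] EuclideanSpace ℝ (Fin m)}
    (hR : ∀ x y, inner ℝ (R x) y = inner ℝ x (R y)) {δ : ℝ} (hδ : 0 ≤ δ)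
    (u : EuclideanSpace ℝ (Fin m)) :
    charFun ((stdGaussian (EuclideanSpace ℝ (Fin m))).map fun x => √δ • R x) u =
      Complex.exp (δ * (Complex.I ^ 2 / 2 * (‖R u‖ ^ 2 : ℝ))) := by
  have h1 : charFun ((stdGaussian (EuclideanSpace ℝ (Fin m))).map fun x => √δ • R x) u =
      charFun (stdGaussian (EuclideanSpace ℝ (Fin m))) (√δ • R u) := by
    rw [charFun_apply, charFun_apply, integral_map (by fun_prop) (by fun_prop)]
    simp_rw [inner_smul_left, inner_smul_right, hR, RCLike.conj_to_real]
  have h2 : ‖√δ • R u‖ ^ 2 = δ * ‖R u‖ ^ 2 := by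
    rw [norm_smul, mul_pow, Real.norm_eq_abs, sq_abs, Real.sq_sqrt hδ]
  rw [h1, charFun_stdGaussian, ← Complex.ofReal_pow, h2, Complex.I_sq]
  congr 1
  push_cast
  ring

section Limit

variable {m D : ℕ} {𝒵 : Type*} [MeasurableSpace 𝒵] {μ : Measure 𝒵}
  {Θ : Set (EuclideanSpace ℝ (Fin m))} {p : EuclideanSpace ℝ (Fin m) → 𝒵 → ℝ}
  {θ₀ : EuclideanSpace ℝ (Fin m)} {s : 𝒵 → EuclideanSpace ℝ (Fin m)} {t : Fin D → I}

theorem measurable_blockScore (P : Measure 𝒵) (hs : Measurable s) (n : ℕ) :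
    Measurable (blockScore P s t n) := by
  have := measurable_centredScore P hs n
  unfold blockScore
  fun_prop

theorem inner_blockScore (P : Measure 𝒵) (n : ℕ) (z : Fin n → 𝒵) (d : Fin D)
    (h : EuclideanSpace ℝ (Fin m)) :
    inner ℝ h (blockScore P s t n z d) = ∑ i ∈ block t n d, scoreArray P s h n (z i) := by
  rw [blockScore, inner_sum]
  simp_rw [inner_smul_right]
  rfl

theorem inner_sum_blockScore (P : Measure 𝒵) (ht : StrictMono t) (hD : 0 < D) (n : ℕ)
    (z : Fin n → 𝒵) (h : EuclideanSpace ℝ (Fin m)) :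
    inner ℝ h (∑ d, blockScore P s t n z d) =
      ∑ i ∈ upto n (t ⟨D - 1, pred_lt_of_pos hD⟩), scoreArray P s h n (z i) := by
  rw [inner_sum, ← sum_sum_block ht hD]
  simp_rw [inner_blockScore]

theorem IsAdapted.dependsOn_upto {S : (n : ℕ) → (Fin n → 𝒵) → Fin D → ℝ} (hS : IsAdapted t S)
    (n : ℕ) (d : Fin D) : DependsOn (fun z => S n z d) (upto n (t d)) := fun _ _ hxy =>
  hS.dependsOn n d fun i hi => hxy i (Finset.mem_coe.2 (mem_upto.2 hi.2))

/-- Earlier statistics and block sums use only observations up to `prevTime t d`, while the `d`-th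
block starts after that time. -/
theorem IsAdapted.indepFun_blockScore {P : Measure 𝒵} [IsProbabilityMeasure P]
    (hs : Measurable s) (ht : StrictMono t) {S : (n : ℕ) → (Fin n → 𝒵) → Fin D → ℝ}
    (hS : IsAdapted t S) (n : ℕ) (d : Fin D) :
    IndepFun (fun z (c : Set.Iio d) => (S n z c, blockScore P s t n z c))
      (fun z => blockScore P s t n z d) (Measure.pi fun _ : Fin n => P) := by
  have hb := measurable_blockScore (t := t) P hs n
  refine indepFun_pi_of_dependsOn P (A := upto n (prevTime t d)) (B := block t n d)
    Finset.disjoint_sdiff ?_ ?_ ?_ ?_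
  · refine measurable_pi_lambda _ fun c => Measurable.prodMk ?_ ?_
    · exact (measurable_pi_apply _).comp (hS.measurable n)
    · exact (measurable_pi_apply _).comp hb
  · exact (measurable_pi_apply _).comp hb
  · intro x y hxy
    funext ⟨c, hc⟩
    have hcd : (t c : ℝ) ≤ prevTime t d := by
      have hc' := Fin.lt_def.1 hc
      rw [prevTime, if_pos (by omega)]
      exact_mod_cast ht.monotone (Fin.le_def.2 (by simp; omega))
    refine Prod.ext ?_ ?_
    · exact hS.dependsOn_upto n c fun i hi => hxy i (upto_mono n hcd hi)
    · simp only [blockScore]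
      refine Finset.sum_congr rfl fun i hi => ?_
      rw [hxy i (upto_mono n hcd (Finset.mem_sdiff.1 hi).1)]
  · intro x y hxy
    simp only [blockScore]
    refine Finset.sum_congr rfl fun i hi => ?_
    rw [hxy i hi]

/-- Three replacements: the local law by the product density, the full product by its factors up to
the last time, and those factors by their exponential approximation in `L²`. -/
theorem IsRegularModel.tendsto_integral_tilted (hM : IsRegularModel μ Θ p θ₀ s) (hD : 0 < D)
    (ht : StrictMono t) {S : (n : ℕ) → (Fin n → 𝒵) → Fin D → ℝ}
    (hS : IsAdapted t S) (h : EuclideanSpace ℝ (Fin m)) {ν : Measure (Fin D → ℝ)}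
    (hL : ConvergesWeakly
      (fun n => (sampleLaw μ p (localParam θ₀ h n) n).map (S n)) ν)
    (f : BoundedContinuousFunction (Fin D → ℝ) ℝ) :
    Tendsto (fun n => ∫ z, f (S n z) * Real.exp
      (∑ i ∈ upto n (t ⟨D - 1, pred_lt_of_pos hD⟩), scoreArray (obsLaw μ p θ₀) s h n (z i) -
        t ⟨D - 1, pred_lt_of_pos hD⟩ * (∫ z, inner ℝ h (s z) ^ 2 ∂(obsLaw μ p θ₀)) / 2)
        ∂(sampleLaw μ p θ₀ n)) atTop (𝓝 (∫ x, f x ∂ν)) := by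
  have hP := hM.isProbabilityMeasure
  have hA := hM.isSmallArray h
  set P := obsLaw μ p θ₀ with hPdef
  set T : I := t ⟨D - 1, pred_lt_of_pos hD⟩ with hT
  set v := ∫ z, inner ℝ h (s z) ^ 2 ∂P with hv
  set X := scoreArray P s h with hX
  have hfS : ∀ n, Measurable fun z => f (S n z) := fun n =>
    f.continuous.measurable.comp (hS.measurable n)
  have hfb : ∀ n z, |f (S n z)| ≤ ‖f‖ := fun n z => f.norm_coe_le_norm _
  have h1 : Tendsto (fun n => ∫ z, f (S n z) ∂(sampleLaw μ p (localParam θ₀ h n) n)) atTop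
      (𝓝 (∫ x, f x ∂ν)) := by
    refine (hL f).congr fun n => ?_
    rw [integral_map (hS.measurable n).aemeasurable f.continuous.aestronglyMeasurable]
  have h2 := hM.tendsto_integral_sub h hfS hfb
  -- The factors after time `T` are independent of the statistics and have mean one. This is why the
  -- tilt involves `W` only up to `t_D`.
  have h3 : ∀ n, ∫ z, f (S n z) * ∏ i, (1 + X n (z i)) ∂(sampleLaw μ p θ₀ n) =
      ∫ z, f (S n z) * ∏ i ∈ upto n T, (1 + X n (z i)) ∂(sampleLaw μ p θ₀ n) := fun n => by
    have hXm := hA.measurable n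
    have hi := indepFun_pi_of_dependsOn P (A := upto n T) (B := (upto n T)ᶜ) disjoint_compl_right
      (F := fun z => f (S n z) * ∏ i ∈ upto n T, (1 + X n (z i)))
      (G := fun z => ∏ i ∈ (upto n T)ᶜ, (1 + X n (z i)))
      ((hfS n).mul (by fun_prop)) (by fun_prop)
      (fun x y hxy => by
        have e : S n x = S n y := funext fun c => hS.dependsOn_upto n c fun i hi =>
          hxy i (upto_mono n (by exact_mod_cast ht.monotone (Fin.le_def.2 (by simp; omega))) hi)
        simp only [e]
        congr 1
        exact Finset.prod_congr rfl fun i hi => by rw [hxy i hi])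
      (fun x y hxy => Finset.prod_congr rfl fun i hi => by rw [hxy i hi])
    have hm := hi.integral_fun_mul_eq_mul_integral
      ((hfS n).mul (by fun_prop)).aestronglyMeasurable
      (Measurable.aestronglyMeasurable (by fun_prop))
    rw [integral_pi_finset_prod (P := P) _ (fun z => 1 + X n z)] at hm
    have hXi : Integrable (X n) P :=
      Integrable.of_bound hXm.aestronglyMeasurable _ (ae_of_all _ (hA.abs_le n))
    rw [integral_add (integrable_const _) hXi, hA.integral_eq_zero n] at hm
    simp only [integral_const, probReal_univ, one_smul, add_zero, one_pow, mul_one] at hm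
    rw [sampleLaw, ← hPdef, ← hm]
    refine integral_congr_ae (ae_of_all _ fun z => ?_)
    simp only
    rw [mul_assoc, Finset.prod_mul_prod_compl]
  have hcard := tendsto_card_upto T.2.1 T.2.2
  have h4 : Tendsto (fun n => ∫ z, f (S n z) * ∏ i ∈ upto n T, (1 + X n (z i))
        ∂(sampleLaw μ p θ₀ n) -
      ∫ z, f (S n z) * Real.exp (∑ i ∈ upto n T, X n (z i) - T * v / 2)
        ∂(sampleLaw μ p θ₀ n)) atTop (𝓝 0) := by
    have hsq := (Real.continuous_sqrt.tendsto 0).comp (hA.tendsto_integral_sq hcard)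
    rw [Real.sqrt_zero] at hsq
    have hlim := hsq.const_mul ‖f‖
    rw [mul_zero] at hlim
    refine squeeze_zero_norm (fun n => ?_) hlim
    have hXm := hA.measurable n
    have i1 := hA.integrable_prod_one_add n (upto n T)
    have i2 : Integrable (fun z : Fin n → 𝒵 => Real.exp (∑ i ∈ upto n T, X n (z i) - T * v / 2))
        (Measure.pi fun _ => P) := by
      have := (hA.integrable_exp n (upto n T) 1).div_const (Real.exp (T * v / 2))
      refine this.congr (ae_of_all _ fun z => ?_)
      simp only [one_mul]
      rw [Real.exp_sub]
    have hL2 : MemLp (fun z : Fin n → 𝒵 => ∏ i ∈ upto n T, (1 + X n (z i)) -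
        Real.exp (∑ i ∈ upto n T, X n (z i) - T * v / 2)) 2 (Measure.pi fun _ => P) := by
      have hb : ∀ z : Fin n → 𝒵, |∑ i ∈ upto n T, X n (z i)| ≤ _ := fun z =>
        hA.abs_sum_le n z (upto n T)
      refine MemLp.sub ?_ ?_
      · refine MemLp.of_bound (Measurable.aestronglyMeasurable (by fun_prop))
          (∏ i ∈ upto n T, (1 + |2 * ‖h‖ * (√√(n : ℝ))⁻¹|)) (ae_of_all _ fun z => ?_)
        rw [Real.norm_eq_abs, Finset.abs_prod]
        refine Finset.prod_le_prod (fun i _ => abs_nonneg _) fun i _ => ?_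
        refine (abs_add_le _ _).trans ?_
        rw [abs_one]
        exact add_le_add le_rfl ((hA.abs_le n _).trans (le_abs_self _))
      · refine MemLp.of_bound (Measurable.aestronglyMeasurable (by fun_prop))
          (Real.exp (n * |2 * ‖h‖ * (√√(n : ℝ))⁻¹| - T * v / 2)) (ae_of_all _ fun z => ?_)
        rw [Real.norm_eq_abs, Real.abs_exp]
        exact Real.exp_le_exp.2 (sub_le_sub_right ((le_abs_self _).trans (hb z)) _)
    rw [sampleLaw, ← hPdef, ← integral_sub
      (i1.bdd_mul (hfS n).aestronglyMeasurable (ae_of_all _ (hfb n)))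
      (i2.bdd_mul (hfS n).aestronglyMeasurable (ae_of_all _ (hfb n)))]
    refine (norm_integral_le_of_norm_le ((i1.fun_sub i2).abs.const_mul ‖f‖)
      (ae_of_all _ fun z => ?_)).trans ?_
    · rw [← mul_sub, norm_mul]
      exact mul_le_mul_of_nonneg_right (hfb n z) (norm_nonneg _)
    · rw [integral_const_mul]
      exact mul_le_mul_of_nonneg_left
        (integral_abs_le_sqrt _ (i1.fun_sub i2) hL2.integrable_sq) (norm_nonneg _)
  have h5 := (h1.sub h2).sub h4
  simp only [sub_zero] at h5
  refine h5.congr fun n => ?_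
  rw [h3]
  ring

theorem IsRegularModel.exists_limit (hM : IsRegularModel μ Θ p θ₀ s) (hD : 0 < D)
    (ht_pos : ∀ d, 0 < t d) (ht : StrictMono t) {S : (n : ℕ) → (Fin n → 𝒵) → Fin D → ℝ}
    (hS : IsAdapted t S) (L : EuclideanSpace ℝ (Fin m) → ProbabilityMeasure (Fin D → ℝ))
    (hL : ∀ h, ConvergesWeakly
      (fun n => (sampleLaw μ p (localParam θ₀ h n) n).map (S n)) (L h : Measure (Fin D → ℝ)))
    {R : EuclideanSpace ℝ (Fin m) →L[ℝ] EuclideanSpace ℝ (Fin m)}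
    (hR : ∀ x y, inner ℝ (R x) y = inner ℝ x (R y))
    (hRs : ∀ h, ∫ z, inner ℝ h (s z) ^ 2 ∂(obsLaw μ p θ₀) = ‖R h‖ ^ 2) :
    ∃ Q : Measure ((Fin D → ℝ) × (Fin D → EuclideanSpace ℝ (Fin m))), IsProbabilityMeasure Q ∧
      (∀ d, IndepFun (fun (x : (Fin D → ℝ) × (Fin D → EuclideanSpace ℝ (Fin m)))
        (i : Set.Iio d) => (x.1 i, x.2 i)) (fun x => x.2 d) Q) ∧
      (∀ d, Q.map (fun x => x.2 d) = (stdGaussian (EuclideanSpace ℝ (Fin m))).map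
        fun x => √((t d : ℝ) - prevTime t d) • R x) ∧
      ∀ (h : EuclideanSpace ℝ (Fin m)) (f : BoundedContinuousFunction (Fin D → ℝ) ℝ),
        ∫ x, f x.1 * Real.exp (inner ℝ h (∑ d, x.2 d) -
          (t ⟨D - 1, pred_lt_of_pos hD⟩ : ℝ) * ‖R h‖ ^ 2 / 2) ∂Q = ∫ x, f x ∂(L h : Measure _) := by
  have hP := hM.isProbabilityMeasure
  have hsm := hM.dqm.measurable_score
  set P := obsLaw μ p θ₀ with hPdef
  set T : I := t ⟨D - 1, pred_lt_of_pos hD⟩ with hT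
  have hpair : ∀ n, Measurable fun z => (S n z, blockScore P s t n z) := fun n =>
    (hS.measurable n).prodMk (measurable_blockScore P hsm n)
  have hpr : ∀ n, IsProbabilityMeasure (sampleLaw μ p θ₀ n) := fun n => by
    rw [sampleLaw, ← hPdef]; infer_instance
  have hγ : ∀ d, IsProbabilityMeasure ((stdGaussian (EuclideanSpace ℝ (Fin m))).map
      fun x => √((t d : ℝ) - prevTime t d) • R x) := fun d =>
    Measure.isProbabilityMeasure_map (by fun_prop)
  let ν : ℕ → ProbabilityMeasure ((Fin D → ℝ) × (Fin D → EuclideanSpace ℝ (Fin m))) := fun n =>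
    ⟨(sampleLaw μ p θ₀ n).map fun z => (S n z, blockScore P s t n z),
      Measure.isProbabilityMeasure_map (hpair n).aemeasurable⟩
  have hν : ∀ n, (ν n : Measure _) =
    (sampleLaw μ p θ₀ n).map fun z => (S n z, blockScore P s t n z) := fun n => rfl
  refine exists_adapted_limit ν L _ (fun h => (T : ℝ) * ‖R h‖ ^ 2 / 2) (fun n d => ?_)
    (fun d u => ?_) (fun h => ?_) ?_ (fun h f => ?_)
  · have hi := hS.indepFun_blockScore (P := P) hsm ht n d
    rw [hν, indepFun_iff_map_prod_eq_prod_map_map (by fun_prop) (by fun_prop),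
      Measure.map_map (by fun_prop) (hpair n), Measure.map_map (by fun_prop) (hpair n),
      Measure.map_map (by fun_prop) (hpair n)]
    refine (indepFun_iff_map_prod_eq_prod_map_map ?_ ?_).1 hi
    · refine (measurable_pi_lambda _ fun c => Measurable.prodMk ?_ ?_).aemeasurable
      · exact (measurable_pi_apply _).comp (hS.measurable n)
      · exact (measurable_pi_apply _).comp (measurable_blockScore P hsm n)
    · exact ((measurable_pi_apply _).comp (measurable_blockScore P hsm n)).aemeasurable
  · have hlt : (prevTime t d : ℝ) ≤ t d := by exact_mod_cast (prevTime_lt ht_pos ht d).le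
    rw [charFun_map_smul_stdGaussian hR (by linarith), ← hRs]
    refine ((hM.isSmallArray u).tendsto_integral_exp Complex.I
      (tendsto_card_block ht_pos ht d)).congr fun n => ?_
    have hmd : Measurable ((fun x : (Fin D → ℝ) × (Fin D → EuclideanSpace ℝ (Fin m)) => x.2 d) ∘
        fun z => (S n z, blockScore P s t n z)) :=
      (measurable_pi_apply d).comp (measurable_snd.comp (hpair n))
    rw [hν, Measure.map_map (by fun_prop) (hpair n), charFun_apply,
      integral_map hmd.aemeasurable (by fun_prop)]
    refine integral_congr_ae (ae_of_all _ fun z => ?_)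
    simp only [Function.comp_apply]
    rw [real_inner_comm, inner_blockScore, mul_comm]
  -- Second exponential moments of the score sum converge, so they are eventually bounded.
  · have h1 := (hM.isSmallArray h).tendsto_integral_exp_real 2 (tendsto_card_upto T.2.1 T.2.2)
    have h2 := h1.div_const (Real.exp ((T : ℝ) * ‖R h‖ ^ 2 / 2) ^ 2)
    have he : ∀ n (z : Fin n → 𝒵), Real.exp (2 * (inner ℝ h (∑ d, blockScore P s t n z d) -
        (T : ℝ) * ‖R h‖ ^ 2 / 2)) = Real.exp (2 * ∑ i ∈ upto n T, scoreArray P s h n (z i)) /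
          Real.exp ((T : ℝ) * ‖R h‖ ^ 2 / 2) ^ 2 := fun n z => by
      rw [inner_sum_blockScore P ht hD, mul_sub, Real.exp_sub, ← Real.exp_nat_mul]
      norm_num
      rfl
    obtain ⟨C, hC⟩ := h2.isBoundedUnder_le
    refine ⟨C, (eventually_map.1 hC).mono fun n hn => ⟨?_, ?_⟩⟩
    · rw [hν, integrable_map_measure (by fun_prop) (hpair n).aemeasurable]
      exact (((hM.isSmallArray h).integrable_exp n (upto n T) 2).div_const _).congr
        (ae_of_all _ fun z => (he n z).symm)
    · rw [hν, integral_map (hpair n).aemeasurable (by fun_prop)]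
      refine le_of_eq_of_le ?_ hn
      rw [← integral_div]
      exact integral_congr_ae (ae_of_all _ fun z => he n z)
  · have h0 := hL 0
    intro f
    refine (h0 f).congr fun n => ?_
    have e : localParam θ₀ (0 : EuclideanSpace ℝ (Fin m)) n = θ₀ := by simp [localParam]
    beta_reduce
    rw [e, hν, Measure.map_map measurable_fst (hpair n)]
    rfl
  · refine (hM.tendsto_integral_tilted hD ht hS h (hL h) f).congr fun n => ?_
    rw [hν, integral_map (hpair n).aemeasurable
      (Measurable.aestronglyMeasurable (by
        have := f.continuous.measurable
        fun_prop))]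
    refine integral_congr_ae (ae_of_all _ fun z => ?_)
    simp only
    rw [inner_sum_blockScore P ht hD, hRs]

end Limit

end LimitExperiment

/-! ### Shifted Gaussian vectors with independent randomization -/

/-- The Cameron-Martin formula in each coordinate; the density does not involve the randomizing
factor, whose law is unchanged. -/
theorem pi_stdGaussian_prod_withDensity_exp {ι κ X : Type*} [Fintype ι] [Fintype κ]
    [MeasurableSpace X] (ν : Measure X) [IsProbabilityMeasure ν] (a : κ → EuclideanSpace ℝ ι) :
    (Measure.pi fun _ : κ => (stdGaussian (EuclideanSpace ℝ ι)).prod ν).withDensity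
        (fun x => ENNReal.ofReal (Real.exp (∑ k, (inner ℝ (a k) (x k).1 - ‖a k‖ ^ 2 / 2)))) =
      (Measure.pi fun _ : κ => (stdGaussian (EuclideanSpace ℝ ι)).prod ν).map
        (fun x k => ((x k).1 + a k, (x k).2)) := by
  have hp : ∀ k, IsProbabilityMeasure ((stdGaussian (EuclideanSpace ℝ ι)).map (· + a k)) :=
    fun k => Measure.isProbabilityMeasure_map (by fun_prop)
  have h1 : ∀ k, ((stdGaussian (EuclideanSpace ℝ ι)).prod ν).withDensity
      (fun x => ENNReal.ofReal (Real.exp (inner ℝ (a k) x.1 - ‖a k‖ ^ 2 / 2))) =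
      ((stdGaussian (EuclideanSpace ℝ ι)).prod ν).map fun x => (x.1 + a k, x.2) := fun k => by
    have h := prod_withDensity_left (μ := stdGaussian (EuclideanSpace ℝ ι)) (ν := ν)
      (f := fun x => ENNReal.ofReal (Real.exp (inner ℝ (a k) x - ‖a k‖ ^ 2 / 2))) (by fun_prop)
    rw [← h, stdGaussian_withDensity_exp]
    have h2 := Measure.map_prod_map (f := (· + a k)) (g := (id : X → X))
      (stdGaussian (EuclideanSpace ℝ ι)) ν (by fun_prop) measurable_id
    rw [Measure.map_id] at h2
    exact h2
  have hs : ∀ k, IsProbabilityMeasure (((stdGaussian (EuclideanSpace ℝ ι)).prod ν).map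
      fun x => (x.1 + a k, x.2)) :=
    fun k => Measure.isProbabilityMeasure_map (by fun_prop)
  have hs' : ∀ k, SigmaFinite (((stdGaussian (EuclideanSpace ℝ ι)).prod ν).withDensity
      (fun x => ENNReal.ofReal (Real.exp (inner ℝ (a k) x.1 - ‖a k‖ ^ 2 / 2)))) := fun k => by
    rw [h1]; infer_instance
  simp_rw [Real.exp_sum, ENNReal.ofReal_prod_of_nonneg fun i _ => (Real.exp_pos _).le]
  rw [← Measure.pi_withDensity (fun _ : κ => (stdGaussian (EuclideanSpace ℝ ι)).prod ν)
    (fun k x => ENNReal.ofReal (Real.exp (inner ℝ (a k) x.1 - ‖a k‖ ^ 2 / 2)))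
    (fun i => by fun_prop), Measure.pi_map_pi
    (f := fun k (x : EuclideanSpace ℝ ι × X) => (x.1 + a k, x.2)) fun i => by fun_prop]
  simp_rw [h1]

theorem integral_pi_stdGaussian_shift {ι κ X : Type*} [Fintype ι] [Fintype κ]
    [MeasurableSpace X] (ν : Measure X) [IsProbabilityMeasure ν] (a : κ → EuclideanSpace ℝ ι)
    {F : (κ → EuclideanSpace ℝ ι × X) → ℝ} (hF : Measurable F) :
    ∫ x, F (fun k => ((x k).1 + a k, (x k).2))
        ∂(Measure.pi fun _ : κ => (stdGaussian (EuclideanSpace ℝ ι)).prod ν) =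
      ∫ x, F x * Real.exp (∑ k, (inner ℝ (a k) (x k).1 - ‖a k‖ ^ 2 / 2))
        ∂(Measure.pi fun _ : κ => (stdGaussian (EuclideanSpace ℝ ι)).prod ν) := by
  rw [← integral_map (φ := fun (x : κ → EuclideanSpace ℝ ι × X) k => ((x k).1 + a k, (x k).2)) (f := F)
    (Measurable.aemeasurable (by fun_prop)) hF.aestronglyMeasurable,
    ← pi_stdGaussian_prod_withDensity_exp,
    integral_withDensity_eq_integral_toReal_smul (by fun_prop) (by simp)]
  refine integral_congr_ae (ae_of_all _ fun x => ?_)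
  simp only
  rw [ENNReal.toReal_ofReal (Real.exp_pos _).le, smul_eq_mul, mul_comm]

namespace LimitExperiment

/-! ### The representation in terms of Gaussian increments -/

/-- By symmetry of `R`, an innovation `√δ R x` contributes `⟨√δ R h, x⟩ - ‖√δ R h‖² / 2` to the
exponent of the tilt. This is the Cameron-Martin density of the shift of `x` by `√δ R h`. -/
theorem exists_gaussian_representation {m D : ℕ}
    (Q : Measure ((Fin D → ℝ) × (Fin D → EuclideanSpace ℝ (Fin m)))) [IsProbabilityMeasure Q]
    (hind : ∀ d, IndepFun (fun (x : (Fin D → ℝ) × (Fin D → EuclideanSpace ℝ (Fin m)))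
        (i : Set.Iio d) => (x.1 i, x.2 i)) (fun x => x.2 d) Q)
    {R : EuclideanSpace ℝ (Fin m) →L[ℝ] EuclideanSpace ℝ (Fin m)}
    (hR : ∀ x y, inner ℝ (R x) y = inner ℝ x (R y)) {δ : Fin D → ℝ} (hδ : ∀ d, 0 ≤ δ d)
    (hQ : ∀ d, Q.map (fun x => x.2 d) =
      (stdGaussian (EuclideanSpace ℝ (Fin m))).map fun x => √(δ d) • R x) :
    ∃ T : (d : Fin D) → (Fin D → EuclideanSpace ℝ (Fin m) × I) → ℝ,
      (∀ d, Measurable (T d)) ∧ (∀ d, DependsOn (T d) (Set.Iic d)) ∧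
      ∀ (h : EuclideanSpace ℝ (Fin m)) (f : BoundedContinuousFunction (Fin D → ℝ) ℝ),
        ∫ x, f (fun d => T d fun c => (√(δ c) • R ((x c).1 + √(δ c) • R h), (x c).2))
            ∂(Measure.pi fun _ : Fin D => (stdGaussian (EuclideanSpace ℝ (Fin m))).prod volume) =
          ∫ x, f x.1 * Real.exp (inner ℝ h (∑ d, x.2 d) - (∑ d, δ d) * ‖R h‖ ^ 2 / 2) ∂Q := by
  obtain ⟨T, hT, hTd, hTQ⟩ := exists_adapted_representation Q D (fun d x => x.1 d)
    (fun d x => x.2 d) (fun d => by fun_prop) (fun d => by fun_prop) hind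
  refine ⟨T, hT, hTd, fun h f => ?_⟩
  have hf := f.continuous.measurable
  set c := (∑ d, δ d) * ‖R h‖ ^ 2 / 2 with hc
  have hTm : Measurable fun (x : Fin D → EuclideanSpace ℝ (Fin m) × I) (d : Fin D) => T d x :=
    measurable_pi_lambda _ hT
  rw [integral_pi_stdGaussian_shift (volume : Measure I) (fun c => √(δ c) • R h)
    (F := fun x => f (fun d => T d fun c => (√(δ c) • R (x c).1, (x c).2)))
    (hf.comp (hTm.comp (by fun_prop)))]
  have hpi : (Measure.pi fun d => (Q.map fun x => x.2 d).prod (volume : Measure I)) =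
      (Measure.pi fun _ : Fin D => (stdGaussian (EuclideanSpace ℝ (Fin m))).prod
        (volume : Measure I)).map fun x d => (√(δ d) • R (x d).1, (x d).2) := by
    have hp : ∀ d, IsProbabilityMeasure ((stdGaussian (EuclideanSpace ℝ (Fin m))).map
        fun x => √(δ d) • R x) := fun d => Measure.isProbabilityMeasure_map (by fun_prop)
    have h2 : ∀ d, ((stdGaussian (EuclideanSpace ℝ (Fin m))).map fun x => √(δ d) • R x).prod
        (volume : Measure I) = ((stdGaussian (EuclideanSpace ℝ (Fin m))).prod
          (volume : Measure I)).map fun x => (√(δ d) • R x.1, x.2) := fun d => by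
      have h3 := Measure.map_prod_map (f := fun x => √(δ d) • R x) (g := (id : I → I))
        (stdGaussian (EuclideanSpace ℝ (Fin m))) volume (by fun_prop) measurable_id
      rw [Measure.map_id] at h3
      exact h3
    have hs : ∀ d, IsProbabilityMeasure (((stdGaussian (EuclideanSpace ℝ (Fin m))).prod
        (volume : Measure I)).map fun x => (√(δ d) • R x.1, x.2)) :=
      fun d => Measure.isProbabilityMeasure_map (by fun_prop)
    rw [Measure.pi_map_pi 
      (f := fun d (x : EuclideanSpace ℝ (Fin m) × I) => (√(δ d) • R x.1, x.2))
      fun d => by fun_prop]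
    simp_rw [hQ, h2]
  have hG : Measurable fun y : Fin D → ℝ × EuclideanSpace ℝ (Fin m) =>
      f (fun d => (y d).1) * Real.exp (inner ℝ h (∑ d, (y d).2) - c) :=
    (hf.comp (by fun_prop)).mul (by fun_prop)
  have e1 := integral_map (μ := Q) (φ := fun x d => (x.1 d, x.2 d))
    (Measurable.aemeasurable (by fun_prop)) hG.aestronglyMeasurable
  rw [← hTQ, hpi, Measure.map_map (by fun_prop) (by fun_prop),
    integral_map (Measurable.aemeasurable (by fun_prop)) hG.aestronglyMeasurable] at e1
  refine Eq.trans ?_ e1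
  refine integral_congr_ae (ae_of_all _ fun x => ?_)
  simp only [Function.comp_apply]
  congr 2
  rw [Finset.sum_sub_distrib, inner_sum]
  congr 1
  · refine Finset.sum_congr rfl fun d _ => ?_
    rw [inner_smul_left, inner_smul_right, hR, RCLike.conj_to_real]
  · rw [hc, Finset.sum_mul, Finset.sum_div]
    refine Finset.sum_congr rfl fun d _ => ?_
    rw [norm_smul, mul_pow, Real.norm_eq_abs, sq_abs, Real.sq_sqrt (hδ d)]

end LimitExperiment

namespace LimitExperiment

/-! ### The square root of the Fisher information -/

section Fisher

variable {m : ℕ} {𝒵 : Type*} [MeasurableSpace 𝒵] {μ : Measure 𝒵}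
  {Θ : Set (EuclideanSpace ℝ (Fin m))} {p : EuclideanSpace ℝ (Fin m) → 𝒵 → ℝ}
  {θ₀ : EuclideanSpace ℝ (Fin m)} {s : 𝒵 → EuclideanSpace ℝ (Fin m)}

open Matrix in
theorem IsRegularModel.integral_inner_sq (hM : IsRegularModel μ Θ p θ₀ s)
    (h : EuclideanSpace ℝ (Fin m)) :
    ∫ z, inner ℝ h (s z) ^ 2 ∂(obsLaw μ p θ₀) =
      h.ofLp ⬝ᵥ fisherInfo μ p θ₀ s *ᵥ h.ofLp := by
  have hi : ∀ i j, Integrable (fun z => s z i * s z j) (obsLaw μ p θ₀) := fun i j => by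
    have hL : ∀ i, MemLp (fun z => s z i) 2 (obsLaw μ p θ₀) := fun i => by
      refine (hM.memLp_inner (EuclideanSpace.single i 1)).ae_eq (ae_of_all _ fun z => ?_)
      simp [EuclideanSpace.inner_single_left]
    exact (hL i).integrable_mul (hL j)
  have e : ∀ z, inner ℝ h (s z) ^ 2 = ∑ i, ∑ j, h i * h j * (s z i * s z j) := fun z => by
    rw [sq, PiLp.inner_apply, Finset.sum_mul_sum]
    refine Finset.sum_congr rfl fun i _ => Finset.sum_congr rfl fun j _ => ?_
    simp only [RCLike.inner_apply, conj_trivial]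
    ring
  simp_rw [e]
  rw [integral_finsetSum _ fun i _ => integrable_finsetSum _ fun j _ => (hi i j).const_mul _]
  simp_rw [dotProduct, mulVec, dotProduct, Finset.mul_sum, fisherInfo, Matrix.of_apply]
  refine Finset.sum_congr rfl fun i _ => ?_
  rw [integral_finsetSum _ fun j _ => (hi i j).const_mul _]
  refine Finset.sum_congr rfl fun j _ => ?_
  rw [integral_const_mul]
  ring

theorem IsRegularModel.posSemidef_fisherInfo (hM : IsRegularModel μ Θ p θ₀ s) :
    (fisherInfo μ p θ₀ s).PosSemidef := by
  refine Matrix.PosSemidef.of_dotProduct_mulVec_nonneg ?_ fun x => ?_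
  · ext i j
    simp [fisherInfo, mul_comm]
  · have := hM.integral_inner_sq (WithLp.toLp 2 x)
    rw [star_trivial, ← this]
    exact integral_nonneg fun z => sq_nonneg _

-- `R` is the square root of the information matrix, so `‖R h‖²` is the quadratic form `h'J₀h`.
-- Nonsingularity is needed only for the last property, where `R` cancels `J₀^{-1/2}`.
open scoped MatrixOrder in
theorem IsRegularModel.exists_sqrt_fisherInfo (hM : IsRegularModel μ Θ p θ₀ s)
    (hns : IsUnit (fisherInfo μ p θ₀ s).det) :
    ∃ R : EuclideanSpace ℝ (Fin m) →L[ℝ] EuclideanSpace ℝ (Fin m),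
      (∀ x y, inner ℝ (R x) y = inner ℝ x (R y)) ∧
      (∀ h, ∫ z, inner ℝ h (s z) ^ 2 ∂(obsLaw μ p θ₀) = ‖R h‖ ^ 2) ∧
      ∀ x, R (Matrix.toEuclideanCLM (𝕜 := ℝ) (invSqrt (fisherInfo μ p θ₀ s)) x) = x := by
  have hJ := hM.posSemidef_fisherInfo
  set J := fisherInfo μ p θ₀ s with hJdef
  have hsq : CFC.sqrt J * CFC.sqrt J = J := CFC.sqrt_mul_sqrt_self _ hJ.nonneg
  have hadj : IsSelfAdjoint (Matrix.toEuclideanCLM (𝕜 := ℝ) (CFC.sqrt J)) :=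
    (CFC.sqrt_nonneg J).isSelfAdjoint.map _
  have hR : ∀ x y, inner ℝ (Matrix.toEuclideanCLM (𝕜 := ℝ) (CFC.sqrt J) x) y =
      inner ℝ x (Matrix.toEuclideanCLM (𝕜 := ℝ) (CFC.sqrt J) y) := fun x y => by
    conv_lhs => rw [← hadj.adjoint_eq]
    exact ContinuousLinearMap.adjoint_inner_left _ _ _
  refine ⟨Matrix.toEuclideanCLM (𝕜 := ℝ) (CFC.sqrt J), hR, fun h => ?_, fun x => ?_⟩
  · rw [← real_inner_self_eq_norm_sq, hR, ← mul_apply_eq_comp, ← map_mul, hsq,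
      Matrix.inner_toEuclideanCLM, hM.integral_inner_sq]
  · have hu : IsUnit (CFC.sqrt J).det := by
      rw [← hsq, Matrix.det_mul] at hns
      exact isUnit_of_mul_isUnit_left hns
    rw [← mul_apply_eq_comp, ← map_mul, invSqrt, Matrix.mul_nonsing_inv _ hu, map_one]
    rfl

end Fisher

/-! ### Increments of the Brownian motion -/

/-- The increments of a finite sequence that starts at zero. -/
def increment {D : ℕ} {E : Type*} [AddGroup E] (w : Fin D → E) (d : Fin D) : E :=
  w d - if 0 < (d : ℕ) then w ⟨d - 1, by omega⟩ else 0

theorem multivariateGaussian_smul_one {m : ℕ} {r : ℝ} (hr : 0 ≤ r) :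
    multivariateGaussian (0 : EuclideanSpace ℝ (Fin m)) (r • 1) =
      (stdGaussian (EuclideanSpace ℝ (Fin m))).map fun x => √r • x := by
  have hS : (r • (1 : Matrix (Fin m) (Fin m) ℝ)).PosSemidef := Matrix.PosSemidef.one.smul hr
  refine Measure.ext_of_charFun ?_
  funext u
  have h := charFun_map_smul_stdGaussian
    (R := ContinuousLinearMap.id ℝ (EuclideanSpace ℝ (Fin m))) (fun x y => rfl) hr u
  simp only [ContinuousLinearMap.coe_id', id_eq] at h
  have h2 : u.ofLp ⬝ᵥ Matrix.mulVec (r • 1) u.ofLp = r * ‖u‖ ^ 2 := by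
    rw [Matrix.smul_mulVec, Matrix.one_mulVec, dotProduct_smul, EuclideanSpace.real_norm_sq_eq,
      smul_eq_mul]
    simp [dotProduct, sq]
  rw [h, charFun_multivariateGaussian hS, h2, Complex.I_sq]
  congr 1
  simp
  ring

section Brownian

variable {m D : ℕ} {Ω : Type*} [MeasurableSpace Ω] {P : Measure Ω}
  {B : I → Ω → EuclideanSpace ℝ (Fin m)} {t : Fin D → I}

theorem IsStdBrownianMotion.aemeasurable (hB : IsStdBrownianMotion B P) (r : I) :
    AEMeasurable (B r) P := by
  refine (hB.law_increment 0 r r.2.1).aemeasurable.congr ?_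
  filter_upwards [hB.start_zero] with ω hω
  simp [hω]

theorem cons_zero_castSucc (d : Fin D) :
    (Fin.cons 0 t : Fin (D + 1) → I) d.castSucc = prevTime t d := by
  obtain ⟨k, hk⟩ := d
  cases k with
  | zero => rfl
  | succ k => rfl

theorem IsStdBrownianMotion.iIndepFun_increment (hB : IsStdBrownianMotion B P)
    (ht_pos : ∀ d, 0 < t d) (ht : StrictMono t) :
    iIndepFun (fun d ω => B (t d) ω - B (prevTime t d) ω) P := by
  -- Time zero is prepended to the grid, so that the first increment also starts at the previous
  -- time.
  have h := hB.indep_increments D (Fin.cons 0 t) (Fin.monotone_iff_le_succ.2 fun i => by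
    rw [cons_zero_castSucc, Fin.cons_succ]
    exact (prevTime_lt ht_pos ht i).le)
  simpa only [cons_zero_castSucc, Fin.cons_succ] using h

theorem IsStdBrownianMotion.hasLaw_increment [IsProbabilityMeasure P] (hB : IsStdBrownianMotion B P)
    (ht_pos : ∀ d, 0 < t d) (ht : StrictMono t) :
    HasLaw (fun ω d => (√((t d : ℝ) - prevTime t d))⁻¹ • (B (t d) ω - B (prevTime t d) ω))
      (Measure.pi fun _ => stdGaussian (EuclideanSpace ℝ (Fin m))) P := by
  have hpos : ∀ d, 0 < (t d : ℝ) - prevTime t d := fun d => sub_pos.2 (prevTime_lt ht_pos ht d)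
  have hm : ∀ d, AEMeasurable
      (fun ω => (√((t d : ℝ) - prevTime t d))⁻¹ • (B (t d) ω - B (prevTime t d) ω)) P := fun d =>
    ((hB.aemeasurable _).fun_sub (hB.aemeasurable _)).fun_const_smul _
  have hi : iIndepFun (fun d ω =>
      (√((t d : ℝ) - prevTime t d))⁻¹ • (B (t d) ω - B (prevTime t d) ω)) P :=
    (hB.iIndepFun_increment ht_pos ht).comp (fun d x => (√((t d : ℝ) - prevTime t d))⁻¹ • x)
      fun d => by fun_prop
  refine ⟨aemeasurable_pi_lambda _ hm, ?_⟩
  rw [(iIndepFun_iff_map_fun_eq_pi_map hm).1 hi]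
  congr 1
  funext d
  have h := hB.law_increment (prevTime t d) (t d) (prevTime_lt ht_pos ht d).le
  have h1 := h.map_eq
  rw [multivariateGaussian_smul_one (hpos d).le] at h1
  have h2 := AEMeasurable.map_map_of_aemeasurable (μ := P)
    (g := fun x => (√((t d : ℝ) - prevTime t d))⁻¹ • x) (by fun_prop) h.aemeasurable
  rw [h1, Measure.map_map (by fun_prop) (by fun_prop)] at h2
  refine h2.symm.trans ?_
  convert Measure.map_id using 2
  funext x
  simp only [Function.comp_apply, id]
  rw [smul_smul, inv_mul_cancel₀ (Real.sqrt_pos.2 (hpos d)).ne', one_smul]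

theorem IsStdBrownianMotion.hasLaw_increment_prod [IsProbabilityMeasure P] (hB : IsStdBrownianMotion B P)
    (ht_pos : ∀ d, 0 < t d) (ht : StrictMono t) {U : Ω → ℝ}
    (hU : HasLaw U (volume.restrict (Set.Icc (0 : ℝ) 1)) P)
    (hBU : IndepFun (fun ω r => B r ω) U P) {g : ℝ → Fin D → I} (hg : Measurable g)
    (hgU : (volume.restrict (Set.Icc 0 1)).map g = Measure.pi fun _ => (volume : Measure I)) :
    HasLaw (fun ω d => ((√((t d : ℝ) - prevTime t d))⁻¹ • (B (t d) ω - B (prevTime t d) ω),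
        g (U ω) d))
      (Measure.pi fun _ => (stdGaussian (EuclideanSpace ℝ (Fin m))).prod volume) P := by
  have h1 := hB.hasLaw_increment ht_pos ht
  have h2 : HasLaw (fun ω => g (U ω)) (Measure.pi fun _ => (volume : Measure I)) P := by
    refine ⟨hg.comp_aemeasurable hU.aemeasurable, ?_⟩
    rw [← hgU, ← hU.map_eq, AEMeasurable.map_map_of_aemeasurable hg.aemeasurable hU.aemeasurable]
    rfl
  have hi : IndepFun (fun ω d =>
      (√((t d : ℝ) - prevTime t d))⁻¹ • (B (t d) ω - B (prevTime t d) ω)) (fun ω => g (U ω)) P :=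
    hBU.comp (φ := fun (b : I → EuclideanSpace ℝ (Fin m)) d =>
      (√((t d : ℝ) - prevTime t d))⁻¹ • (b (t d) - b (prevTime t d)))
      (by fun_prop) hg
  have h3 := (indepFun_iff_map_prod_eq_prod_map_map h1.aemeasurable h2.aemeasurable).1 hi
  rw [h1.map_eq, h2.map_eq, ← (measurePreserving_arrowProdEquivProdArrow
    (EuclideanSpace ℝ (Fin m)) I (Fin D) (fun _ => stdGaussian (EuclideanSpace ℝ (Fin m)))
    fun _ => volume).map_eq] at h3
  have hm := (MeasurableEquiv.arrowProdEquivProdArrow (EuclideanSpace ℝ (Fin m)) I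
    (Fin D)).symm.measurable
  have h4 := congrArg (Measure.map (MeasurableEquiv.arrowProdEquivProdArrow
    (EuclideanSpace ℝ (Fin m)) I (Fin D)).symm) h3
  rw [AEMeasurable.map_map_of_aemeasurable hm.aemeasurable
    (h1.aemeasurable.prodMk h2.aemeasurable), MeasurableEquiv.map_symm_map] at h4
  exact ⟨hm.comp_aemeasurable (h1.aemeasurable.prodMk h2.aemeasurable), h4⟩

end Brownian

/-- With `R = J^{1/2}` this reads `J ΔW = δ J h + J^{1/2} ΔB`, rewritten in terms of the
standardized increment `ΔB / √δ`. The right side is the shifted Gaussian innovation. -/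
theorem increment_driftedBM {m D : ℕ} {Ω : Type*} {B : I → Ω → EuclideanSpace ℝ (Fin m)}
    {t : Fin D → I} {J : Matrix (Fin m) (Fin m) ℝ}
    {R : EuclideanSpace ℝ (Fin m) →L[ℝ] EuclideanSpace ℝ (Fin m)}
    (hR : ∀ x, R (Matrix.toEuclideanCLM (𝕜 := ℝ) (invSqrt J) x) = x)
    (h : EuclideanSpace ℝ (Fin m)) (d : Fin D) (hlt : prevTime t d < t d) {ω : Ω}
    (hω : B 0 ω = 0) :
    R (R (increment (fun c => driftedBM J B h (t c) ω) d)) = √((t d : ℝ) - prevTime t d) •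
      R ((√((t d : ℝ) - prevTime t d))⁻¹ • (B (t d) ω - B (prevTime t d) ω) +
        √((t d : ℝ) - prevTime t d) • R h) := by
  have hpos : 0 < (t d : ℝ) - prevTime t d := sub_pos.2 hlt
  have e : increment (fun c => driftedBM J B h (t c) ω) d =
      driftedBM J B h (t d) ω - driftedBM J B h (prevTime t d) ω := by
    unfold increment prevTime
    split_ifs with hd
    · rfl
    · simp [driftedBM, hω]
  rw [e]
  simp only [driftedBM, map_sub, map_add, map_smul, hR, smul_add, smul_smul]
  rw [mul_inv_cancel₀ (Real.sqrt_pos.2 hpos).ne', Real.mul_self_sqrt hpos.le]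
  module

end LimitExperiment

namespace LimitExperiment

/-! ### The two representations -/

/-- Extension by zero of a family indexed by a subset of the index set. -/
noncomputable def extendZero {ι E : Type*} [Zero E] (A : Set ι) (w : A → E) (c : ι) : E :=
  open Classical in if hc : c ∈ A then w ⟨c, hc⟩ else 0

theorem extendZero_of_mem {ι E : Type*} [Zero E] {A : Set ι} (w : A → E) {c : ι} (hc : c ∈ A) :
    extendZero A w c = w ⟨c, hc⟩ := dif_pos hc

theorem measurable_extendZero {ι E : Type*} [Zero E] [MeasurableSpace E] (A : Set ι) :
    Measurable (extendZero A : (A → E) → ι → E) := by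
  refine measurable_pi_lambda _ fun c => ?_
  unfold extendZero
  split_ifs with hc
  · exact measurable_pi_apply _
  · exact measurable_const

theorem measurable_increment {m D : ℕ} :
    Measurable (increment : (Fin D → EuclideanSpace ℝ (Fin m)) → _) := by
  refine measurable_pi_lambda _ fun d => ?_
  unfold increment
  split_ifs <;> fun_prop

theorem increment_congr {D : ℕ} {E : Type*} [AddGroup E] {v w : Fin D → E} {c d : Fin D}
    (hvw : ∀ i ≤ d, v i = w i) (hc : c ≤ d) : increment v c = increment w c := by
  unfold increment
  rw [hvw c hc, hvw ⟨c - 1, by omega⟩ (Fin.le_def.2 (by have := Fin.le_def.1 hc; simp; omega))]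

/-- The statistics obtained by applying functions of Gaussian vectors and uniform variables to the
increments of an observed path, normalized by `R ∘ R`, and to the variables generated by `g`. -/
noncomputable def pathStatistic {m D : ℕ}
    (R : EuclideanSpace ℝ (Fin m) →L[ℝ] EuclideanSpace ℝ (Fin m)) (g : ℝ → Fin D → I)
    (T : Fin D → (Fin D → EuclideanSpace ℝ (Fin m) × I) → ℝ) (d : Fin D)
    (x : (Set.Iic d → EuclideanSpace ℝ (Fin m)) × ℝ) : ℝ :=
  T d fun c => (R (R (increment (extendZero (Set.Iic d) x.1) c)), g x.2 c)

/-- The values of functions of Gaussian vectors and uniform variables when the `d`-th Gaussian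
vector has covariance `δ d • R²` and mean `δ d • R² h`. -/
noncomputable def shiftedStatistic {m D : ℕ}
    (R : EuclideanSpace ℝ (Fin m) →L[ℝ] EuclideanSpace ℝ (Fin m)) (δ : Fin D → ℝ)
    (T : Fin D → (Fin D → EuclideanSpace ℝ (Fin m) × I) → ℝ) (h : EuclideanSpace ℝ (Fin m))
    (x : Fin D → EuclideanSpace ℝ (Fin m) × I) (d : Fin D) : ℝ :=
  T d fun c => (√(δ c) • R ((x c).1 + √(δ c) • R h), (x c).2)

theorem measurable_pathStatistic {m D : ℕ}
    (R : EuclideanSpace ℝ (Fin m) →L[ℝ] EuclideanSpace ℝ (Fin m)) {g : ℝ → Fin D → I}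
    (hg : Measurable g) {T : Fin D → (Fin D → EuclideanSpace ℝ (Fin m) × I) → ℝ}
    (hT : ∀ d, Measurable (T d)) (d : Fin D) : Measurable (pathStatistic R g T d) := by
  refine (hT d).comp ?_
  have h1 := (measurable_increment (m := m) (D := D)).comp
    (measurable_extendZero (E := EuclideanSpace ℝ (Fin m)) (Set.Iic d))
  have h2 : ∀ c, Measurable fun x : (Set.Iic d → EuclideanSpace ℝ (Fin m)) × ℝ =>
      increment (extendZero (Set.Iic d) x.1) c := fun c =>
    (measurable_pi_apply c).comp (h1.comp measurable_fst)
  fun_prop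

theorem IsRegularModel.exists_hasLaw_shiftedStatistic {m D : ℕ} {𝒵 : Type*} [MeasurableSpace 𝒵]
    {μ : Measure 𝒵} {Θ : Set (EuclideanSpace ℝ (Fin m))} {p : EuclideanSpace ℝ (Fin m) → 𝒵 → ℝ}
    {θ₀ : EuclideanSpace ℝ (Fin m)} {s : 𝒵 → EuclideanSpace ℝ (Fin m)}
    (hM : IsRegularModel μ Θ p θ₀ s) (hD : 0 < D)
    {t : Fin D → I} (ht_pos : ∀ d, 0 < t d) (ht : StrictMono t)
    {S : (n : ℕ) → (Fin n → 𝒵) → Fin D → ℝ} (hS : IsAdapted t S)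
    (L : EuclideanSpace ℝ (Fin m) → ProbabilityMeasure (Fin D → ℝ))
    (hL : ∀ h, ConvergesWeakly
      (fun n => (sampleLaw μ p (localParam θ₀ h n) n).map (S n)) (L h : Measure (Fin D → ℝ)))
    {R : EuclideanSpace ℝ (Fin m) →L[ℝ] EuclideanSpace ℝ (Fin m)}
    (hR : ∀ x y, inner ℝ (R x) y = inner ℝ x (R y))
    (hRs : ∀ h, ∫ z, inner ℝ h (s z) ^ 2 ∂(obsLaw μ p θ₀) = ‖R h‖ ^ 2) :
    ∃ T : Fin D → (Fin D → EuclideanSpace ℝ (Fin m) × I) → ℝ,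
      (∀ d, Measurable (T d)) ∧ (∀ d, DependsOn (T d) (Set.Iic d)) ∧
      ∀ h, HasLaw (shiftedStatistic R (fun d => (t d : ℝ) - prevTime t d) T h)
        (L h : Measure (Fin D → ℝ))
        (Measure.pi fun _ => (stdGaussian (EuclideanSpace ℝ (Fin m))).prod volume) := by
  obtain ⟨Q, hQp, hQi, hQm, hQL⟩ := hM.exists_limit hD ht_pos ht hS L hL hR hRs
  obtain ⟨T, hT, hTd, hTL⟩ := exists_gaussian_representation Q hQi hR
    (δ := fun d => (t d : ℝ) - (prevTime t d : ℝ))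
    (fun d => sub_nonneg.2 (Subtype.coe_le_coe.2 (prevTime_lt ht_pos ht d).le)) hQm
  refine ⟨T, hT, hTd, fun h => ?_⟩
  have hFm : Measurable (shiftedStatistic R (fun d => (t d : ℝ) - prevTime t d) T h) :=
    measurable_pi_lambda _ fun d => (hT d).comp (by fun_prop)
  refine ⟨hFm.aemeasurable, ?_⟩
  have := Measure.isProbabilityMeasure_map (μ := Measure.pi fun _ : Fin D =>
    (stdGaussian (EuclideanSpace ℝ (Fin m))).prod (volume : Measure I)) hFm.aemeasurable
  -- Bounded continuous functions determine the law. The interval lengths add up to the last time,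
  -- so the constants in the two tilts agree.
  refine ext_of_forall_integral_eq_of_IsFiniteMeasure fun f => ?_
  rw [integral_map hFm.aemeasurable f.continuous.aestronglyMeasurable, ← hQL h f,
    ← sum_sub_prevTime ht_pos ht hD, ← hTL h f]
  rfl

/-- Standardized Brownian increments and the variables generated from `U` have the law used for the
shifted statistics. Extending the observed path by zero after index `d` is harmless, as `T d` uses
only increments up to `d`. -/
theorem IsStdBrownianMotion.hasLaw_pathStatistic {m D : ℕ} {Ω : Type*} [MeasurableSpace Ω]
    {P : Measure Ω} [IsProbabilityMeasure P] {B : I → Ω → EuclideanSpace ℝ (Fin m)}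
    (hB : IsStdBrownianMotion B P) {U : Ω → ℝ}
    (hU : HasLaw U (volume.restrict (Set.Icc (0 : ℝ) 1)) P)
    (hBU : IndepFun (fun ω r => B r ω) U P)
    {t : Fin D → I} (ht_pos : ∀ d, 0 < t d) (ht : StrictMono t)
    {J : Matrix (Fin m) (Fin m) ℝ} {R : EuclideanSpace ℝ (Fin m) →L[ℝ] EuclideanSpace ℝ (Fin m)}
    (hR : ∀ x, R (Matrix.toEuclideanCLM (𝕜 := ℝ) (invSqrt J) x) = x)
    {g : ℝ → Fin D → I} (hg : Measurable g)
    (hgU : (volume.restrict (Set.Icc 0 1)).map g = Measure.pi fun _ => (volume : Measure I))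
    {T : Fin D → (Fin D → EuclideanSpace ℝ (Fin m) × I) → ℝ}
    (hTd : ∀ d, DependsOn (T d) (Set.Iic d))
    {h : EuclideanSpace ℝ (Fin m)} {ν : Measure (Fin D → ℝ)}
    (hν : HasLaw (shiftedStatistic R (fun d => (t d : ℝ) - prevTime t d) T h) ν
      (Measure.pi fun _ => (stdGaussian (EuclideanSpace ℝ (Fin m))).prod volume)) :
    HasLaw (fun ω d => pathStatistic R g T d (fun c => driftedBM J B h (t c) ω, U ω)) ν P := by
  refine (hν.comp (hB.hasLaw_increment_prod ht_pos ht hU hBU hg hgU)).congr ?_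
  filter_upwards [hB.start_zero] with ω hω
  funext d
  refine hTd d fun c hc => ?_
  simp only
  rw [increment_congr (w := fun c => driftedBM J B h (t c) ω)
    (fun i hi => extendZero_of_mem _ (Set.mem_Iic.2 hi)) hc,
    increment_driftedBM hR h c (prevTime_lt ht_pos ht c) hω]

/-- In `W(r) - (r / t) W(t)` the drift cancels. The linear correction of the bridge cancels in the
same combination, so `B` may be replaced by its bridge. -/
theorem driftedBM_eq_add_bridge {m : ℕ} {Ω : Type*} (J : Matrix (Fin m) (Fin m) ℝ)
    (B : I → Ω → EuclideanSpace ℝ (Fin m)) (h : EuclideanSpace ℝ (Fin m)) (τ : I) {r t : I}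
    (ht : 0 < t) (ω : Ω) :
    driftedBM J B h r ω = ((r : ℝ) / t) • driftedBM J B h t ω +
      Matrix.toEuclideanCLM (𝕜 := ℝ) (invSqrt J)
        (bridge B τ r ω - ((r : ℝ) / t) • bridge B τ t ω) := by
  have ht' : (t : ℝ) ≠ 0 := (show (0 : ℝ) < t from ht).ne'
  have e : (r : ℝ) / t * t = r := div_mul_cancel₀ _ ht'
  have e' : (r : ℝ) / t * ((t : ℝ) / τ) = r / τ := by rw [← mul_div_assoc, e]
  simp only [driftedBM, bridge, map_sub, map_smul, smul_add, smul_sub, smul_smul, e, e']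
  abel

theorem bridge_self {m : ℕ} {Ω : Type*} (B : I → Ω → EuclideanSpace ℝ (Fin m)) {τ : I}
    (hτ : 0 < τ) (ω : Ω) : bridge B τ τ ω = 0 := by
  have h : (τ : ℝ) ≠ 0 := (show (0 : ℝ) < τ from hτ).ne'
  rw [bridge, div_self h, one_smul, sub_self]

/-- The only `c ≤ d` that can be missing from `bridgeIndices d` is the last index, where the bridge
is zero; extension by zero thus returns its true value. -/
theorem extendZero_bridge {m D : ℕ} {Ω : Type*} (B : I → Ω → EuclideanSpace ℝ (Fin m))
    {t : Fin D → I} (ht_pos : ∀ d, 0 < t d) (hD : 0 < D) {c d : Fin D} (hd : 0 < (d : ℕ))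
    (hc : c ≤ d) (ω : Ω) :
    extendZero (bridgeIndices d) (fun c => bridge B (t ⟨D - 1, pred_lt_of_pos hD⟩) (t c) ω) c =
      bridge B (t ⟨D - 1, pred_lt_of_pos hD⟩) (t c) ω := by
  by_cases h : c ∈ bridgeIndices d
  · exact extendZero_of_mem _ h
  · have e : c = ⟨D - 1, pred_lt_of_pos hD⟩ := by
      have : ¬ (c : ℕ) + 1 < D := fun h' => h ⟨hd, hc, h'⟩
      exact Fin.ext (by simp; omega)
    rw [extendZero, dif_neg h, e, bridge_self B (ht_pos _)]

end LimitExperiment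

/-! ### The representation theorem. -/

theorem corollary1 {m D : ℕ} (hD : 0 < D) {𝒵 : Type*} [MeasurableSpace 𝒵]
    (μ : Measure 𝒵) (Θ : Set (EuclideanSpace ℝ (Fin m)))
    (p : EuclideanSpace ℝ (Fin m) → 𝒵 → ℝ) (hp : LimitExperiment.IsDensityFamily μ Θ p)
    (θ₀ : EuclideanSpace ℝ (Fin m)) (hθ₀ : θ₀ ∈ interior Θ)
    (s : 𝒵 → EuclideanSpace ℝ (Fin m)) (hdqm : LimitExperiment.IsDQM μ p θ₀ s)
    (J₀ : Matrix (Fin m) (Fin m) ℝ) (hJ₀ : J₀ = LimitExperiment.fisherInfo μ p θ₀ s)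
    (hns : IsUnit J₀.det)
    (t : Fin D → I) (ht_pos : ∀ d, 0 < t d) (ht : StrictMono t)
    (S : (n : ℕ) → (Fin n → 𝒵) → Fin D → ℝ) (hS : LimitExperiment.IsAdapted t S)
    (L : EuclideanSpace ℝ (Fin m) → ProbabilityMeasure (Fin D → ℝ))
    (hL : ∀ h : EuclideanSpace ℝ (Fin m),
      LimitExperiment.ConvergesWeakly
        (fun n => (LimitExperiment.sampleLaw μ p (LimitExperiment.localParam θ₀ h n) n).map (S n))
        (L h : Measure (Fin D → ℝ))) :
    (∃ T : (d : Fin D) → (Set.Iic d → EuclideanSpace ℝ (Fin m)) × ℝ → ℝ,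
      (∀ d, Measurable (T d)) ∧
      ∀ {Ω : Type*} [MeasurableSpace Ω] (P : Measure Ω) [IsProbabilityMeasure P]
        (B : I → Ω → EuclideanSpace ℝ (Fin m)) (U : Ω → ℝ),
        LimitExperiment.IsStdBrownianMotion B P →
        HasLaw U (volume.restrict (Set.Icc (0 : ℝ) 1)) P →
        IndepFun (fun ω r => B r ω) U P →
        ∀ h : EuclideanSpace ℝ (Fin m),
          HasLaw
            (fun ω d => T d (fun c => LimitExperiment.driftedBM J₀ B h (t c) ω, U ω))
            (L h : Measure (Fin D → ℝ)) P) ∧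
    (∃ T' : (d : Fin D) → EuclideanSpace ℝ (Fin m) ×
        (LimitExperiment.bridgeIndices d → EuclideanSpace ℝ (Fin m)) × ℝ → ℝ,
      (∀ d, Measurable (T' d)) ∧
      ∀ {Ω : Type*} [MeasurableSpace Ω] (P : Measure Ω) [IsProbabilityMeasure P]
        (B : I → Ω → EuclideanSpace ℝ (Fin m)) (U : Ω → ℝ),
        LimitExperiment.IsStdBrownianMotion B P →
        HasLaw U (volume.restrict (Set.Icc (0 : ℝ) 1)) P →
        IndepFun (fun ω r => B r ω) U P →
        ∀ h : EuclideanSpace ℝ (Fin m),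
          HasLaw
            (fun ω d => T' d (LimitExperiment.driftedBM J₀ B h (t d) ω,
              fun c => LimitExperiment.bridge B (t ⟨D - 1, by omega⟩) (t c) ω, U ω))
            (L h : Measure (Fin D → ℝ)) P) := by
  subst hJ₀
  have hM : LimitExperiment.IsRegularModel μ Θ p θ₀ s := ⟨hp, hθ₀, hdqm⟩
  obtain ⟨R, hR, hRs, hRinv⟩ := hM.exists_sqrt_fisherInfo hns
  obtain ⟨T, hT, hTd, hTL⟩ :=
    hM.exists_hasLaw_shiftedStatistic hD ht_pos ht hS L hL hR hRs
  obtain ⟨g, hg, hgU⟩ := exists_measurable_map_pi_volume D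
  have hTm := LimitExperiment.measurable_pathStatistic R hg hT
  refine ⟨⟨LimitExperiment.pathStatistic R g T, hTm, fun P _ B U hB hU hBU h =>
    hB.hasLaw_pathStatistic hU hBU ht_pos ht hRinv hg hgU hTd (hTL h)⟩, ?_⟩
  set K := Matrix.toEuclideanCLM (𝕜 := ℝ)
    (LimitExperiment.invSqrt (LimitExperiment.fisherInfo μ p θ₀ s)) with hK
  -- The path up to `d` is rebuilt from its value at `t d` and the bridge, without `h`, and then
  -- passed to the functions of part (i).
  refine ⟨fun d x => LimitExperiment.pathStatistic R g T d (fun c => ((t c : ℝ) / t d) • x.1 +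
      K (LimitExperiment.extendZero _ x.2.1 c -
        ((t c : ℝ) / t d) • LimitExperiment.extendZero _ x.2.1 d), x.2.2),
    fun d => (hTm d).comp ?_, fun P _ B U hB hU hBU h => ?_⟩
  · have h1 := LimitExperiment.measurable_extendZero (E := EuclideanSpace ℝ (Fin m))
      (LimitExperiment.bridgeIndices d)
    have h2 : ∀ c, Measurable fun x : EuclideanSpace ℝ (Fin m) ×
        (LimitExperiment.bridgeIndices d → EuclideanSpace ℝ (Fin m)) × ℝ =>
        LimitExperiment.extendZero (LimitExperiment.bridgeIndices d) x.2.1 c := fun c =>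
      (measurable_pi_apply c).comp (h1.comp (measurable_fst.comp measurable_snd))
    fun_prop
  · convert hB.hasLaw_pathStatistic hU hBU ht_pos ht hRinv hg hgU hTd (hTL h) using 5 with ω d
    funext ⟨c, hc⟩
    have hc : c ≤ d := hc
    refine Eq.trans ?_ (LimitExperiment.driftedBM_eq_add_bridge _ B h
      (t ⟨D - 1, LimitExperiment.pred_lt_of_pos hD⟩)
      (r := t c) (ht_pos d) ω).symm
    rw [← hK]
    simp only
    -- The first function sees no bridge value; there `c = d`, the coefficient `t c / t d` is one
    -- and the bridge terms cancel.
    rcases Nat.eq_zero_or_pos d with hd | hd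
    · have e : c = d := Fin.ext (by have := Fin.le_def.1 hc; omega)
      have h1 : ((t d : I) : ℝ) / t d = 1 := div_self (show (0 : ℝ) < t d from ht_pos d).ne'
      subst e
      rw [h1]
      simp only [one_smul, sub_self]
    · rw [LimitExperiment.extendZero_bridge B ht_pos hD hd hc,
        LimitExperiment.extendZero_bridge B ht_pos hD hd le_rfl]
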